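/- **Setting.** Fix a local dimension $d\ge 2$. For $p\in[0,1]$ let $\rho(p)=p\,|\phi^+\rangle\langle\phi^+|+\frac{1-p}{d^2}\mathbb 1$ on $\mathbb C^d\otimes\mathbb C^d$, where $|\phi^+\rangle=\frac1{\sqrt d}\sum_{i=1}^d|ii\rangle$, be the isotropic state of visibility $p$. For a finite simple graph $G=(V,E)$ the isotropic network state is $\sigma(G,p)=\bigotimes_{e\in E}\rho_e(p)$: for every edge $e=\{u,v\}$ the parties $u$ and $v$ share a copy of $\rho(p)$, so that party $v$ holds one system $\mathbb C^d$ for each edge at $v$. A graph sequence $(G_n)$, $G_n=(V_n,E_n)$, consists of finite connected simple graphs with $V_n\subset V_{n+1}$ and $|G_n|=|V_n|\to\infty$. It has *partial distillability* (for $d$) if there is $p_0<1$ such that for every finite set of parties $V_0\subset\bigcup_nV_n$ and every pure state $\psi$ of $(\mathbb C^d)^{\otimes V_0}$ there are maps $\Lambda_{n,p}$, for $p\in[0,1]$ and all $n$ with $V_0\subset V_n$, each implementable by local operations and finitely many rounds of classical communication among the parties $V_n$, that take states of the network $G_n$ to states of $(\mathbb C^d)^{\otimes V_0}$ (one factor held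 by each party of $V_0$, the other parties keeping nothing), with $$\lim_{n\to\infty}F\big(\Lambda_{n,p}(\sigma(G_n,p)),\psi\big)=1\quad\text{for all }p\in(p_0,1],\qquad F(\rho,\sigma)=\Big(\operatorname{tr}\sqrt{\sqrt\rho\,\sigma\sqrt\rho}\Big)^2 .$$ **Theorem.** For every $\alpha\in(0,1)$ there is an integer $k\ge1$ such that the sequence $(G_n)_{n\ge1}$ of graphs on $V_n=[n]^k$, in which two vertices are adjacent if and only if they differ in exactly one coordinate, has the following properties. 1. The maximum degree $\delta_{\max}(G_n)$ is $O(|G_n|^\alpha)$ as $n\to\infty$. 2. $(G_n)_{n\ge1}$ has partial distillability, for every local dimension $d\ge2$. 3. For all $n\ge 1$, all $V_0\subset V_n$ with $|V_0|\ge2$ and all $v_0\in V_0$, the graph $G_n$ contains at least $$\Big(\Big\lfloor\frac{n-1}{|V_0|-1}\Big\rfloor-1\Big)k$$ pairwise edge-disjoint spiders with centre $v_0$, each with exactly $|V_0|-1$ legs, one ending at each vertex of $V_0\setminus\{v_0\}$, and all legs of length at most $k+1$. (A spider with centre $v_0$ is a union of simple paths, its legs, that start at $v_0$ and have pairwise no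 other vertex in common.) -/

import Mathlib

open Filter Topology Asymptotics
open scoped MatrixOrder ComplexOrder

noncomputable section

/-! ## Multipartite systems, fidelity and LOCC

A system of parties `P` in which party `v` holds a Hilbert space with orthonormal basis `H v` has
total Hilbert space with basis `∀ v, H v`. Operators are matrices in this product basis. -/

/-- Operators on the tensor product of the local spaces with bases `H v`. -/
abbrev MultiOp {P : Type} (H : P → Type) : Type := Matrix (∀ v, H v) (∀ v, H v) ℂ

/-- The tensor product `⨂ v, A v` of local operators `A v`. -/
def localTensor {P : Type} [Fintype P] {H K : P → Type} (A : ∀ v, Matrix (K v) (H v) ℂ) :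
    Matrix (∀ v, K v) (∀ v, H v) ℂ :=
  Matrix.of fun x y => ∏ v, A v (x v) (y v)

/-- The pure state `|ψ⟩⟨ψ|`. -/
def pureState {X : Type} (ψ : X → ℂ) : Matrix X X ℂ := Matrix.vecMulVec ψ (star ψ)

/-- The fidelity `F(ρ, σ) = (tr √(√ρ σ √ρ))²`. -/
def fidelity {X : Type} [Fintype X] [DecidableEq X] (ρ σ : Matrix X X ℂ) : ℝ :=
  (CFC.sqrt (CFC.sqrt ρ * σ * CFC.sqrt ρ)).trace.re ^ 2

/-- Maps implementable by local operations and finitely many rounds of classical communication.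
A protocol is a finite tree. At a leaf (`done`) every party applies a local isometry. In a `round`
one party `v` performs a local measurement with Kraus operators `A i v` (complete:
`∑ i, (A i v)ᴴ (A i v) = 1`) and announces the outcome `i` to everybody, every other party `u`
applies a local isometry `A i u` that may depend on `i`, and the parties go on with an LOCC
protocol `Λ i` that may depend on `i`. Averaging over the outcomes gives the map. Discarding
information (in particular partial traces and arbitrary local channels) is the case in which the
continuation ignores the outcome. -/
inductive IsLOCC {P : Type} [Fintype P] [DecidableEq P] {K : P → Type}
    [∀ v, Fintype (K v)] [∀ v, DecidableEq (K v)] :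
    ∀ {H : P → Type} [∀ v, Fintype (H v)] [∀ v, DecidableEq (H v)],
      (MultiOp H → MultiOp K) → Prop
  | done {H : P → Type} [∀ v, Fintype (H v)] [∀ v, DecidableEq (H v)]
      (U : ∀ v, Matrix (K v) (H v) ℂ) (hU : ∀ v, (U v).conjTranspose * U v = 1)
      (Λ : MultiOp H → MultiOp K)
      (hΛ : ∀ ρ, Λ ρ = localTensor U * ρ * (localTensor U).conjTranspose) :
      IsLOCC Λ
  | round {H : P → Type} [∀ v, Fintype (H v)] [∀ v, DecidableEq (H v)]
      {ι : Type} [Fintype ι] {H' : ι → P → Type}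
      [∀ i v, Fintype (H' i v)] [∀ i v, DecidableEq (H' i v)]
      (v : P) (A : ∀ i u, Matrix (H' i u) (H u) ℂ)
      (hv : ∑ i, (A i v).conjTranspose * A i v = 1)
      (hA : ∀ i u, u ≠ v → (A i u).conjTranspose * A i u = 1)
      (next : ∀ i, MultiOp (H' i) → MultiOp K)
      (hnext : ∀ i, IsLOCC (next i))
      (Λ : MultiOp H → MultiOp K)
      (hΛ : ∀ ρ, Λ ρ =
        ∑ i, next i (localTensor (A i) * ρ * (localTensor (A i)).conjTranspose)) :
      IsLOCC Λ

/-! ## Isotropic network states -/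

/-- The maximally entangled vector `|φ⁺⟩ = d^{-1/2} ∑ i, |ii⟩`. -/
def maxEntangled (d : ℕ) : Fin d × Fin d → ℂ :=
  fun a => if a.1 = a.2 then ((1 / Real.sqrt d : ℝ) : ℂ) else 0

/-- The isotropic state `ρ(p) = p φ⁺ + (1 - p) / d² 𝟙` of visibility `p`. -/
def isotropic (d : ℕ) (p : ℝ) : Matrix (Fin d × Fin d) (Fin d × Fin d) ℂ :=
  (p : ℂ) • pureState (maxEntangled d) + (((1 - p) / (d : ℝ) ^ 2 : ℝ) : ℂ) • 1

/-- The isotropic state is invariant under exchange of the two parties. -/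
theorem isotropic_swap (d : ℕ) (p : ℝ) (a b : Fin d × Fin d) :
    isotropic d p a.swap b.swap = isotropic d p a b := by
  simp [isotropic, pureState, maxEntangled, Matrix.vecMulVec_apply, Matrix.one_apply, eq_comm]

/-- The local space of `v` in a network: one `d`-dimensional system for every edge at `v`, the
edge being named by its other endpoint. -/
abbrev NetSystem {W : Type} (G : SimpleGraph W) (d : ℕ) (v : W) : Type :=
  {w : W // G.Adj v w} → Fin d

/-- The matrix entry, at the product basis elements `x` and `y`, of the isotropic state that lives
on the edge `e` (`1` if `e` is not an edge of `G`). -/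
def linkEntry {W : Type} (G : SimpleGraph W) [DecidableRel G.Adj] (d : ℕ) (p : ℝ)
    (x y : ∀ v, NetSystem G d v) (e : Sym2 W) : ℂ :=
  Sym2.lift
    ⟨fun u w => if h : G.Adj u w then
        isotropic d p (x u ⟨w, h⟩, x w ⟨u, h.symm⟩) (y u ⟨w, h⟩, y w ⟨u, h.symm⟩) else 1,
      by
        intro u w
        by_cases h : G.Adj u w
        · simp only [h, h.symm, dif_pos]
          exact (isotropic_swap d p _ _).symm
        · have h' : ¬ G.Adj w u := fun q => h q.symm
          simp only [h, h', dif_neg, not_false_eq_true]⟩ e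

/-- The isotropic network state `σ(G, p) = ⨂_{e ∈ E} ρ_e(p)`. -/
def networkState {W : Type} [Fintype W] [DecidableEq W] (G : SimpleGraph W)
    [DecidableRel G.Adj] (d : ℕ) (p : ℝ) : MultiOp (NetSystem G d) :=
  Matrix.of fun x y => ∏ e ∈ G.edgeFinset, linkEntry G d p x y e

/-! ## Graph sequences and partial distillability -/

/-- A growing sequence of networks: finite connected simple graphs on nested sets of parties,
whose order tends to infinity. -/
structure GraphSequence where
  Party : Type
  [decParty : DecidableEq Party]
  V : ℕ → Finset Party
  graph : ∀ n, SimpleGraph {v // v ∈ V n}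
  [decAdj : ∀ n, DecidableRel (graph n).Adj]
  nested : ∀ n, V n ⊆ V (n + 1)
  connected : ∀ n, (graph n).Connected
  order_tendsto : Tendsto (fun n => (V n).card) atTop atTop

attribute [instance] GraphSequence.decParty GraphSequence.decAdj

/-- The output space of a party: `d`-dimensional for parties in `V₀`, trivial (one-dimensional)
for the other parties. -/
abbrev OutSystem {Q : Type} (V : Finset Q) (V₀ : Finset Q) (d : ℕ)
    (v : {v // v ∈ V}) : Type :=
  v.1 ∈ V₀ → Fin d

/-- A vector of `⨂_{v ∈ V₀} ℂ^d`, seen in the output space of all parties in `V ⊇ V₀` (where the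
parties outside `V₀` contribute one-dimensional factors). -/
def extendVector {Q : Type} {V V₀ : Finset Q} (h : V₀ ⊆ V) {d : ℕ}
    (ψ : ({v // v ∈ V₀} → Fin d) → ℂ) : (∀ v, OutSystem V V₀ d v) → ℂ :=
  fun x => ψ fun v => x ⟨v.1, h v.2⟩ v.2

/-- Partial distillability of a graph sequence, for links of local dimension `d`. There is a
visibility threshold `p₀ < 1` such that for each finite set `V₀` of parties and each pure state `ψ`
of `V₀` there are LOCC maps `Λ n p`, for all `n` with `V₀ ⊆ V n`, that take the isotropic network
state of visibility `p` to states of fidelity tending to `1` with `ψ`, for all `p > p₀`. -/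
def PartiallyDistillable (S : GraphSequence) (d : ℕ) : Prop :=
  ∃ p₀ : ℝ, p₀ < 1 ∧
    ∀ (V₀ : Finset S.Party) (ψ : ({v // v ∈ V₀} → Fin d) → ℂ), ∑ x, ‖ψ x‖ ^ 2 = 1 →
      ∃ Λ : ∀ (n : {n // V₀ ⊆ S.V n}), ℝ →
          MultiOp (NetSystem (S.graph n) d) → MultiOp (OutSystem (S.V n) V₀ d),
        (∀ n p, IsLOCC (Λ n p)) ∧
        ∀ p : ℝ, 0 ≤ p → p₀ < p → p ≤ 1 →
          Tendsto (fun n : {n // V₀ ⊆ S.V n} =>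
              fidelity (Λ n p (networkState (S.graph n) d p)) (pureState (extendVector n.2 ψ)))
            atTop (𝓝 1)

/-! ## Hamming graphs and spiders -/

/-- The points of `[n]^k`, where `[n]` is `{0, …, n - 1}`. -/
def hammingVertices (k n : ℕ) : Finset (Fin k → ℕ) :=
  Fintype.piFinset fun _ => Finset.range n

/-- The graph on `[n]^k` in which two vertices are adjacent when they differ in exactly one
coordinate. -/
def hammingGraph (k n : ℕ) : SimpleGraph {v // v ∈ hammingVertices k n} where
  Adj I J := hammingDist I.1 J.1 = 1
  symm := ⟨fun I J h => by rw [hammingDist_comm]; exact h⟩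
  loopless := ⟨fun I h => by simp at h⟩

instance (k n : ℕ) : DecidableRel (hammingGraph k n).Adj :=
  fun I J => inferInstanceAs (Decidable (hammingDist I.1 J.1 = 1))

theorem hammingGraph_connected (k n : ℕ) : (hammingGraph k (n + 1)).Connected := by
  classical
  have key : ∀ (c : ℕ) (I J : {v // v ∈ hammingVertices k (n + 1)}),
      hammingDist I.1 J.1 = c → (hammingGraph k (n + 1)).Reachable I J := by
    intro c
    induction c with
    | zero =>
      intro I J h
      rw [Subtype.ext (hammingDist_eq_zero.1 h)]
    | succ c ih =>
      intro I J h
      have hne : I.1 ≠ J.1 := by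
        intro e
        rw [e, hammingDist_self] at h
        omega
      obtain ⟨m, hm⟩ := Function.ne_iff.1 hne
      have hmem : Function.update I.1 m (J.1 m) ∈ hammingVertices k (n + 1) := by
        have hI := I.2
        have hJ := J.2
        simp only [hammingVertices, Fintype.mem_piFinset] at hI hJ ⊢
        intro a
        by_cases ha : a = m
        · subst ha
          simpa using hJ a
        · simpa [ha] using hI a
      let I' : {v // v ∈ hammingVertices k (n + 1)} := ⟨_, hmem⟩
      have h1 : hammingDist I.1 I'.1 = 1 := by
        have : ({a | I.1 a ≠ I'.1 a} : Finset (Fin k)) = {m} := by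
          ext a
          by_cases ha : a = m
          · subst ha
            simpa [I'] using hm
          · simp [I', ha]
        rw [hammingDist, this, Finset.card_singleton]
      have h2 : hammingDist I'.1 J.1 = c := by
        have : ({a | I'.1 a ≠ J.1 a} : Finset (Fin k)) =
            ({a | I.1 a ≠ J.1 a} : Finset (Fin k)).erase m := by
          ext a
          by_cases ha : a = m
          · subst ha
            simp [I']
          · simp [I', ha]
        rw [hammingDist, this, Finset.card_erase_of_mem (by simpa using hm)]
        have h' := h
        rw [hammingDist] at h'
        omega
      exact (SimpleGraph.Adj.reachable (G := hammingGraph k (n + 1)) h1).trans (ih I' J h2)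
  have : Nonempty {v // v ∈ hammingVertices k (n + 1)} :=
    ⟨⟨fun _ => 0, by simp [hammingVertices]⟩⟩
  exact ⟨fun I J => key _ I J rfl⟩

/-- The sequence of Hamming graphs on `[1]^k, [2]^k, [3]^k, …`, for a fixed `k ≥ 1`. The indices
of the sequence begin with `0`, so that its graph of index `n` is the one on `[n + 1]^k`. -/
def hammingSequence (k : ℕ) (hk : 1 ≤ k) : GraphSequence where
  Party := Fin k → ℕ
  V n := hammingVertices k (n + 1)
  graph n := hammingGraph k (n + 1)
  nested n := Fintype.piFinset_subset _ _ fun _ => Finset.range_subset_range.2 (by omega)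
  connected n := hammingGraph_connected k n
  order_tendsto := by
    have h : ∀ n, n ≤ (hammingVertices k (n + 1)).card := by
      intro n
      have h1 : n + 1 ≤ (n + 1) ^ k := Nat.le_self_pow (by omega) _
      simp only [hammingVertices, Fintype.card_piFinset, Finset.card_range, Finset.prod_const,
        Finset.card_univ, Fintype.card_fin]
      omega
    exact tendsto_atTop_mono h tendsto_id

/-- A spider in `G` with centre `c` and with exactly one leg for each element of `T` (`c ∉ T`):
the leg of `t` is a simple path from `c` to `t`, and different legs only meet in `c`. -/
structure Spider {W : Type} (G : SimpleGraph W) (c : W) (T : Finset W) where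
  center_notMem : c ∉ T
  leg : ∀ t : {t // t ∈ T}, G.Walk c t
  isPath : ∀ t, (leg t).IsPath
  legs_disjoint : ∀ s t, s ≠ t → ∀ w, w ∈ (leg s).support → w ∈ (leg t).support → w = c

/-- The set of edges of a spider. -/
def Spider.edges {W : Type} {G : SimpleGraph W} {c : W} {T : Finset W} (S : Spider G c T) :
    Set (Sym2 W) :=
  {e | ∃ t, e ∈ (S.leg t).edges}

end

/-!
The parties work in two rounds. First the inner vertices of the legs of edge-disjoint spiders
centred at `v₀` make Bell measurements, which turns each leg into one link between `v₀` and its end,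
up to a unitary. An isotropic state is a mixture of the maximally entangled state, with probability
`p`, and of basis states, so a leg of length `ℓ` is faulty with probability at most `ℓ (1 - p)`, and
faults of edge-disjoint legs are independent. Then `v₀` and each end distil one link from `9 ^ m`
legs by a concatenated nine-qudit code, which tolerates one faulty block out of nine on each
level, and `v₀` teleports `ψ` through the resulting links. If `ℓ (1 - p) ≤ 1 / 162`, the
distillation fails with probability at most `(1 / 2) ^ m` for each end, and `m` tends to infinity
with the number of spiders.

In the Hamming graph on `[n]^k`, a spider arises from a coordinate `j` and from values `a` which no
vertex of `V₀` has there: the leg to a vertex first moves coordinate `j` to its own value `a`, then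
the other coordinates to their targets one by one, and coordinate `j` last. The degree `k (n - 1)`
is `O((n ^ k) ^ α)` for `k ≥ 1 / α`.
-/

noncomputable section

open scoped Matrix

/-! ## Hamming graphs -/

section HammingDist

variable {ι : Type*} {β : ι → Type*} [Fintype ι] [∀ i, DecidableEq (β i)]

theorem hammingDist_lt_card_of_eq {x y : ∀ i, β i} {i : ι} (h : x i = y i) :
    hammingDist x y < Fintype.card ι :=
  Finset.card_lt_card (Finset.filter_ssubset.2 ⟨i, Finset.mem_univ i, not_not.2 h⟩)

variable [DecidableEq ι]

theorem hammingDist_update_of_ne {x : ∀ i, β i} {i : ι} {a : β i} (h : x i ≠ a) :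
    hammingDist x (Function.update x i a) = 1 := by
  refine Finset.card_eq_one.2 ⟨i, Finset.ext fun j => ?_⟩
  by_cases hj : j = i
  · subst hj
    simpa using h
  · simp [hj]

theorem hammingDist_update_add_one {x y : ∀ i, β i} {i : ι} (h : x i ≠ y i) :
    hammingDist (Function.update x i (y i)) y + 1 = hammingDist x y := by
  have herase : ({j | Function.update x i (y i) j ≠ y j} : Finset ι) =
      ({j | x j ≠ y j} : Finset ι).erase i := by
    ext j
    by_cases hj : j = i
    · subst hj
      simp
    · simp [hj]
  rw [hammingDist, hammingDist, herase, Finset.card_erase_add_one (by simpa using h)]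

theorem exists_eq_update_of_hammingDist_eq_one {x y : ∀ i, β i} (h : hammingDist x y = 1) :
    ∃ i, y = Function.update x i (y i) := by
  obtain ⟨i, hi⟩ := Finset.card_eq_one.1 h
  refine ⟨i, funext fun j => ?_⟩
  by_cases hj : j = i
  · subst hj
    simp
  · have : j ∉ ({j | x j ≠ y j} : Finset ι) := by simpa [hi] using hj
    simpa [hj, eq_comm] using this

end HammingDist

/-- The vertices of `hammingGraph k n`. -/
abbrev HammingVertex (k n : ℕ) : Type := {v // v ∈ hammingVertices k n}

section HammingGraph

variable {k n : ℕ}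

theorem HammingVertex.lt (x : HammingVertex k n) (j : Fin k) : x.1 j < n :=
  Finset.mem_range.1 (Fintype.mem_piFinset.1 x.2 j)

/-- The vertex obtained from `x` by moving its coordinate `j` to `a`. -/
def HammingVertex.update (x : HammingVertex k n) (j : Fin k) {a : ℕ} (ha : a < n) :
    HammingVertex k n :=
  ⟨Function.update x.1 j a, Fintype.mem_piFinset.2 fun i => by
    rcases eq_or_ne i j with rfl | hij
    · simpa using ha
    · simpa [hij] using x.lt i⟩

theorem hammingGraph_adj_update (x : HammingVertex k n) {j : Fin k} {a : ℕ} (ha : a < n)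
    (h : x.1 j ≠ a) : (hammingGraph k n).Adj x (x.update j ha) :=
  hammingDist_update_of_ne h

theorem hammingGraph_degree_le (v : HammingVertex k n) :
    (hammingGraph k n).degree v ≤ k * n := by
  let f : Fin k × Fin n → HammingVertex k n := fun a => v.update a.1 a.2.2
  have hsub : (hammingGraph k n).neighborFinset v ⊆ Finset.univ.image f := by
    intro (w : HammingVertex k n) hw
    obtain ⟨j, hj⟩ := exists_eq_update_of_hammingDist_eq_one
      ((SimpleGraph.mem_neighborFinset _ _ _).1 hw)
    exact Finset.mem_image.2 ⟨(j, ⟨w.1 j, w.lt j⟩), Finset.mem_univ _, Subtype.ext hj.symm⟩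
  calc (hammingGraph k n).degree v ≤ (Finset.univ.image f).card := Finset.card_le_card hsub
    _ ≤ (Finset.univ : Finset (Fin k × Fin n)).card := Finset.card_image_le
    _ = k * n := by simp

theorem card_hammingVertices (k n : ℕ) : (hammingVertices k n).card = n ^ k := by
  simp [hammingVertices]

theorem hammingSequence_maxDegree_isBigO {α : ℝ} (hk : 1 ≤ k) (hα : 1 ≤ k * α) :
    (fun n => (((hammingSequence k hk).graph n).maxDegree : ℝ)) =O[atTop]
      fun n => (((hammingSequence k hk).V n).card : ℝ) ^ α := by
  refine IsBigO.of_bound k (Eventually.of_forall fun n => ?_)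
  have hdeg : ((hammingSequence k hk).graph n).maxDegree ≤ k * (n + 1) :=
    SimpleGraph.maxDegree_le_of_forall_degree_le _ _ fun v => by
      convert! hammingGraph_degree_le v
  have hside : ((n + 1 : ℕ) : ℝ) ≤ (((hammingSequence k hk).V n).card : ℝ) ^ α := by
    change _ ≤ ((hammingVertices k (n + 1)).card : ℝ) ^ α
    rw [card_hammingVertices, Nat.cast_pow, ← Real.rpow_natCast, ← Real.rpow_mul (by positivity)]
    exact Real.self_le_rpow_of_one_le (by simp) hα
  rw [Real.norm_of_nonneg (by positivity), Real.norm_of_nonneg (by positivity)]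
  calc (((hammingSequence k hk).graph n).maxDegree : ℝ) ≤ ((k * (n + 1) : ℕ) : ℝ) := by
        exact_mod_cast hdeg
    _ = k * ((n + 1 : ℕ) : ℝ) := Nat.cast_mul _ _
    _ ≤ k * (((hammingSequence k hk).V n).card : ℝ) ^ α := by gcongr

theorem exists_walk_length_eq_hammingDist (s t : HammingVertex k n) :
    ∃ w : (hammingGraph k n).Walk s t, w.length = hammingDist s.1 t.1 ∧
      ∀ x ∈ w.support, ∀ b, x.1 b = s.1 b ∨ x.1 b = t.1 b := by
  induction hc : hammingDist s.1 t.1 generalizing s with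
  | zero =>
    obtain rfl := Subtype.ext (hammingDist_eq_zero.1 hc)
    exact ⟨.nil, rfl, by simp⟩
  | succ c ih =>
    obtain ⟨j, hj⟩ := Function.ne_iff.1 (hammingDist_ne_zero.1 (hc.trans_ne c.succ_ne_zero))
    let s' := s.update j (t.lt j)
    have hdist : hammingDist s'.1 t.1 = c :=
      Nat.succ.inj ((hammingDist_update_add_one hj).trans hc)
    obtain ⟨w, hlen, hsupp⟩ := ih s' hdist
    refine ⟨.cons (hammingGraph_adj_update s (t.lt j) hj) w, by simp [hlen], fun x hx b => ?_⟩
    rcases List.mem_cons.1 hx with rfl | hx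
    · exact .inl rfl
    rcases hsupp x hx b with h | h
    · rcases eq_or_ne b j with rfl | hb
      · exact .inr (h.trans (Function.update_self ..))
      · exact .inl (h.trans (Function.update_of_ne hb ..))
    · exact .inr h

/-! ## Spiders in Hamming graphs -/

theorem exists_path_detour (s t : HammingVertex k n) {j : Fin k} {a : ℕ} (ha : a < n)
    (hs : s.1 j ≠ a) (ht : t.1 j ≠ a) :
    ∃ p : (hammingGraph k n).Walk s t, p.IsPath ∧ p.length ≤ k + 1 ∧
      (∀ x ∈ p.support,
        x = s ∨ x = t ∨ x.1 j = a ∧ ∀ b, b ≠ j → x.1 b = s.1 b ∨ x.1 b = t.1 b) ∧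
      ∀ e ∈ p.edges, ∃ x ∈ e, x.1 j = a := by
  classical
  let s' := s.update j ha
  let t' := t.update j ha
  have hs' : s'.1 j = a := Function.update_self ..
  have ht' : t'.1 j = a := Function.update_self ..
  obtain ⟨q, hlen, hsupp⟩ := exists_walk_length_eq_hammingDist s' t'
  have hj : ∀ x ∈ q.support, x.1 j = a := fun x hx => by simpa [hs', ht'] using hsupp x hx j
  let w : (hammingGraph k n).Walk s t :=
    .cons (hammingGraph_adj_update s ha hs) (q.append (hammingGraph_adj_update t ha ht).symm.toWalk)
  refine ⟨w.bypass, w.bypass_isPath, w.length_bypass_le_length.trans ?_, fun x hx => ?_,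
    fun e he => ?_⟩
  · have hdist : hammingDist s'.1 t'.1 < k := by
      simpa using hammingDist_lt_card_of_eq (hs'.trans ht'.symm)
    simp only [w, SimpleGraph.Walk.length_cons, SimpleGraph.Walk.length_append,
      SimpleGraph.Walk.length_nil, hlen]
    omega
  · have hx' : x = s ∨ x ∈ q.support ∨ x = t' ∨ x = t := by
      simpa [w, SimpleGraph.Walk.mem_support_append_iff] using w.support_bypass_subset_support hx
    have hq : x ∈ q.support → x.1 j = a ∧ ∀ b, b ≠ j → x.1 b = s.1 b ∨ x.1 b = t.1 b :=
      fun hx => ⟨hj x hx, fun b hb => by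
        simpa [s', t', HammingVertex.update, hb] using hsupp x hx b⟩
    rcases hx' with h | h | rfl | h
    · exact .inl h
    · exact .inr (.inr (hq h))
    · exact .inr (.inr (hq q.end_mem_support))
    · exact .inr (.inl h)
  · have he' : e = s(s, s') ∨ e ∈ q.edges ∨ e = s(t', t) := by
      simpa [w] using w.edges_bypass_subset_edges he
    rcases he' with rfl | he' | rfl
    · exact ⟨s', Sym2.mem_mk_right .., hs'⟩
    · obtain ⟨x, y⟩ := e
      exact ⟨x, Sym2.mem_mk_left .., hj x (q.fst_mem_support_of_mem_edges he')⟩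
    · exact ⟨t', Sym2.mem_mk_left .., ht'⟩

theorem exists_edgeDisjoint_spiders_of_paths {W I : Type} [DecidableEq W] {G : SimpleGraph W}
    {V₀ : Finset W} {v₀ : W} (p : I → ∀ t : {t // t ∈ V₀.erase v₀}, G.Walk v₀ t)
    (hpath : ∀ i t, (p i t).IsPath)
    (hends : ∀ i t, ∀ x ∈ (p i t).support, x ∈ V₀ → x = v₀ ∨ x = t)
    (hinner : ∀ i t i' t', ∀ x ∈ (p i t).support, x ∈ (p i' t').support → x ∉ V₀ →
      i = i' ∧ t = t')
    (hedge : ∀ i t, ∀ e ∈ (p i t).edges, ∃ x ∈ e, x ∉ V₀) :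
    ∃ S : I → Spider G v₀ (V₀.erase v₀), (∀ i t, (S i).leg t = p i t) ∧
      Pairwise fun i j => Disjoint (S i).edges (S j).edges := by
  refine ⟨fun i => ⟨Finset.notMem_erase _ _, p i, hpath i, fun s t hst x hxs hxt => ?_⟩,
    fun _ _ => rfl, fun i i' hne => Set.disjoint_left.2 ?_⟩
  · by_cases hx : x ∈ V₀
    · rcases hends i s x hxs hx with h | h
      · exact h
      · rcases hends i t x hxt hx with h' | h'
        · exact h'
        · exact absurd (Subtype.ext (h.symm.trans h')) hst
    · exact absurd (hinner i s i t x hxs hxt hx).2 hst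
  · rintro e ⟨s, hs⟩ ⟨t, ht⟩
    obtain ⟨x, hxe, hx⟩ := hedge i s e hs
    exact hne (hinner i s i' t x (SimpleGraph.Walk.mem_support_of_mem_edges hs hxe)
      (SimpleGraph.Walk.mem_support_of_mem_edges ht hxe) hx).1

/-- `x` has in coordinate `j` the value `a`, which no vertex of `V₀` has there, while its other
coordinates are coordinates of vertices of `V₀`. The pair `(j, a)` is then determined by `x`. -/
def IsFreshAt (V₀ : Finset (HammingVertex k n)) (j : Fin k) (a : ℕ) (x : HammingVertex k n) :
    Prop :=
  x.1 j = a ∧ (∀ v ∈ V₀, v.1 j ≠ a) ∧ ∀ b, b ≠ j → ∃ v ∈ V₀, v.1 b = x.1 b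

theorem IsFreshAt.eq_and_eq {V₀ : Finset (HammingVertex k n)} {j j' : Fin k} {a a' : ℕ}
    {x : HammingVertex k n} (h : IsFreshAt V₀ j a x) (h' : IsFreshAt V₀ j' a' x) :
    j = j' ∧ a = a' := by
  obtain rfl : j = j' := by
    by_contra hne
    obtain ⟨v, hv, hvx⟩ := h'.2.2 j hne
    exact h.2.1 v hv (hvx.trans h.1)
  exact ⟨rfl, h.1.symm.trans h'.1⟩

theorem exists_path_of_fresh {V₀ : Finset (HammingVertex k n)} {s t : HammingVertex k n}
    (hs : s ∈ V₀) (ht : t ∈ V₀) {j : Fin k} {a : ℕ} (ha : a < n)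
    (hfresh : ∀ v ∈ V₀, v.1 j ≠ a) :
    ∃ p : (hammingGraph k n).Walk s t, p.IsPath ∧ p.length ≤ k + 1 ∧
      (∀ x ∈ p.support, x = s ∨ x = t ∨ IsFreshAt V₀ j a x) ∧
      ∀ e ∈ p.edges, ∃ x ∈ e, x ∉ V₀ := by
  obtain ⟨p, hp, hlen, hsupp, hedge⟩ := exists_path_detour s t ha (hfresh s hs) (hfresh t ht)
  refine ⟨p, hp, hlen, fun x hx => ?_, fun e he => ?_⟩
  · refine (hsupp x hx).imp_right (Or.imp_right fun ⟨hxj, hxb⟩ => ⟨hxj, hfresh, fun b hb => ?_⟩)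
    rcases hxb b hb with h | h
    · exact ⟨s, hs, h.symm⟩
    · exact ⟨t, ht, h.symm⟩
  · obtain ⟨x, hxe, hxj⟩ := hedge e he
    exact ⟨x, hxe, fun hx => hfresh x hx hxj⟩

theorem exists_fresh_embedding (V₀ : Finset (HammingVertex k n)) (j : Fin k) {A : Type*} [Fintype A]
    (hA : Fintype.card A ≤ n - V₀.card) :
    ∃ f : A ↪ ℕ, ∀ i, f i < n ∧ ∀ v ∈ V₀, v.1 j ≠ f i := by
  classical
  let Z : Finset ℕ := Finset.range n \ V₀.image fun v => v.1 j
  have hcard : Fintype.card A ≤ Fintype.card Z :=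
    calc Fintype.card A ≤ n - V₀.card := hA
      _ ≤ n - (V₀.image fun v => v.1 j).card := Nat.sub_le_sub_left Finset.card_image_le n
      _ ≤ Z.card := by simpa using Finset.le_card_sdiff (V₀.image fun v => v.1 j) (Finset.range n)
      _ = Fintype.card Z := (Fintype.card_coe Z).symm
  obtain ⟨f⟩ := Function.Embedding.nonempty_of_card_le hcard
  refine ⟨f.trans (Function.Embedding.subtype _), fun i => ?_⟩
  have hi : (f i : ℕ) ∈ Z := (f i).2
  rw [Finset.mem_sdiff, Finset.mem_range, Finset.mem_image] at hi
  exact ⟨hi.1, fun v hv h => hi.2 ⟨v, hv, h⟩⟩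

theorem exists_edgeDisjoint_spiders (V₀ : Finset (HammingVertex k n)) {v₀ : HammingVertex k n}
    (hv₀ : v₀ ∈ V₀) (hV₀ : 2 ≤ V₀.card) :
    ∃ S : Fin (((n - 1) / (V₀.card - 1) - 1) * k) →
        Spider (hammingGraph k n) v₀ (V₀.erase v₀),
      (∀ i t, ((S i).leg t).length ≤ k + 1) ∧
      Pairwise fun i j => Disjoint (S i).edges (S j).edges := by
  classical
  set c := (n - 1) / (V₀.card - 1) - 1 with hc
  have hcard : Fintype.card (Fin c × {t // t ∈ V₀.erase v₀}) ≤ n - V₀.card := by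
    have hmul := Nat.div_mul_le_self (n - 1) (V₀.card - 1)
    rw [Fintype.card_prod, Fintype.card_fin, Fintype.card_coe, Finset.card_erase_of_mem hv₀, hc,
      Nat.sub_mul]
    omega
  choose f hlt hfresh using fun j : Fin k => exists_fresh_embedding V₀ j hcard
  choose p hpath hlen hsupp hedge using fun (i : Fin c × Fin k) (t : {t // t ∈ V₀.erase v₀}) =>
    exists_path_of_fresh hv₀ (Finset.mem_of_mem_erase t.2) (hlt i.2 (i.1, t)) (hfresh i.2 (i.1, t))
  have hends : ∀ i t, ∀ x ∈ (p i t).support, x ∈ V₀ → x = v₀ ∨ x = t := fun i t x hx hxV =>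
    (hsupp i t x hx).imp_right (Or.resolve_right · fun h => h.2.1 x hxV h.1)
  have hinner : ∀ i t i' t', ∀ x ∈ (p i t).support, x ∈ (p i' t').support → x ∉ V₀ →
      i = i' ∧ t = t' := by
    intro i t i' t' x hx hx' hxV
    have hfr : ∀ {i t}, x ∈ (p i t).support → IsFreshAt V₀ i.2 (f i.2 (i.1, t)) x := by
      intro i t hx
      rcases hsupp i t x hx with rfl | rfl | h
      · exact absurd hv₀ hxV
      · exact absurd (Finset.mem_of_mem_erase t.2) hxV
      · exact h
    obtain ⟨hj, ha⟩ := (hfr hx).eq_and_eq (hfr hx')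
    rw [hj] at ha
    obtain ⟨hi, ht⟩ := Prod.ext_iff.1 ((f i'.2).injective ha)
    exact ⟨Prod.ext hi hj, ht⟩
  obtain ⟨S, hleg, hdisj⟩ := exists_edgeDisjoint_spiders_of_paths
    (fun i => p (finProdFinEquiv.symm i)) (fun i => hpath _) (fun i => hends _)
    (fun i t i' t' x hx hx' hxV =>
      (hinner _ t _ t' x hx hx' hxV).imp_left (finProdFinEquiv.symm.injective ·)) (fun i => hedge _)
  exact ⟨S, fun i t => hleg i t ▸ hlen _ t, hdisj⟩

end HammingGraph

/-! ## Local operators -/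

section LocalTensor

variable {P : Type} [Fintype P] {H K L : P → Type}

theorem localTensor_apply (A : ∀ v, Matrix (K v) (H v) ℂ) (x : ∀ v, K v) (y : ∀ v, H v) :
    localTensor A x y = ∏ v, A v (x v) (y v) := rfl

theorem localTensor_conjTranspose (A : ∀ v, Matrix (K v) (H v) ℂ) :
    (localTensor A)ᴴ = localTensor fun v => (A v)ᴴ := by
  ext x y
  simp [localTensor_apply, Matrix.conjTranspose_apply]

theorem localTensor_transpose (A : ∀ v, Matrix (K v) (H v) ℂ) :
    (localTensor A)ᵀ = localTensor fun v => (A v)ᵀ := rfl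

theorem localTensor_mul [DecidableEq P] [∀ v, Fintype (K v)] (A : ∀ v, Matrix (L v) (K v) ℂ)
    (B : ∀ v, Matrix (K v) (H v) ℂ) :
    localTensor A * localTensor B = localTensor fun v => A v * B v := by
  ext x y
  simp only [localTensor_apply, Matrix.mul_apply, Finset.prod_univ_sum, Fintype.piFinset_univ,
    Finset.prod_mul_distrib]

theorem localTensor_one [∀ v, DecidableEq (H v)] [DecidableEq (∀ v, H v)] :
    localTensor (fun v => (1 : Matrix (H v) (H v) ℂ)) = 1 := by
  ext x y
  rw [localTensor_apply, Matrix.one_apply]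
  split_ifs with h
  · subst h
    exact Finset.prod_eq_one fun v _ => Matrix.one_apply_eq _
  · obtain ⟨v, hv⟩ := Function.ne_iff.1 h
    exact Finset.prod_eq_zero (Finset.mem_univ v) (Matrix.one_apply_ne hv)

theorem localTensor_smul (c : P → ℂ) (A : ∀ v, Matrix (K v) (H v) ℂ) :
    localTensor (fun v => c v • A v) = (∏ v, c v) • localTensor A := by
  ext x y
  simp [localTensor_apply, Finset.prod_mul_distrib]

theorem sum_localTensor [DecidableEq P] {O : P → Type} [∀ v, Fintype (O v)]
    (A : ∀ v, O v → Matrix (K v) (H v) ℂ) :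
    ∑ o : ∀ v, O v, localTensor (fun v => A v (o v)) = localTensor fun v => ∑ i, A v i := by
  ext x y
  simp only [localTensor_apply, Matrix.sum_apply, Finset.prod_univ_sum, Fintype.piFinset_univ]

theorem sum_localTensor_of_eq_one_of_ne [∀ v, DecidableEq (H v)]
    [DecidableEq (∀ v, H v)] {ι : Type} [Fintype ι] (v : P) (A : ι → ∀ u, Matrix (H u) (H u) ℂ)
    (hv : ∑ i, A i v = 1) (hA : ∀ i u, u ≠ v → A i u = 1) :
    ∑ i, localTensor (A i) = 1 := by
  classical
  have factor_out (i x y) : localTensor (A i) x y =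
      A i v (x v) (y v) * ∏ u ∈ Finset.univ.erase v, (1 : Matrix (H u) (H u) ℂ) (x u) (y u) := by
    rw [localTensor_apply, ← Finset.mul_prod_erase _ _ (Finset.mem_univ v)]
    exact congrArg _ (Finset.prod_congr rfl fun u hu => by rw [hA i u (Finset.ne_of_mem_erase hu)])
  ext x y
  simp only [Matrix.sum_apply, factor_out]
  rw [← Finset.sum_mul, ← Matrix.sum_apply, hv, ← localTensor_one, localTensor_apply,
    Finset.mul_prod_erase _ (fun u => (1 : Matrix (H u) (H u) ℂ) (x u) (y u)) (Finset.mem_univ v)]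

theorem trace_localTensor_conj [DecidableEq P] [∀ v, Fintype (H v)] [∀ v, Fintype (K v)]
    (A : ∀ v, Matrix (K v) (H v) ℂ) (ρ : MultiOp H) :
    (localTensor A * ρ * (localTensor A)ᴴ).trace =
      (localTensor (fun v => (A v)ᴴ * A v) * ρ).trace := by
  rw [Matrix.trace_mul_comm, ← Matrix.mul_assoc, localTensor_conjTranspose, localTensor_mul]

end LocalTensor

theorem IsLOCC.trace_eq {P : Type} [Fintype P] [DecidableEq P] {K H : P → Type}
    [∀ v, Fintype (K v)] [∀ v, DecidableEq (K v)] [∀ v, Fintype (H v)] [∀ v, DecidableEq (H v)]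
    {Λ : MultiOp H → MultiOp K} (h : IsLOCC Λ) (ρ : MultiOp H) : (Λ ρ).trace = ρ.trace := by
  induction h with
  | done U hU Λ hΛ =>
    simp only [hΛ, trace_localTensor_conj, hU, localTensor_one, Matrix.one_mul]
  | round v A hv hA next _ Λ hΛ ih =>
    simp only [hΛ, Matrix.trace_sum, ih, trace_localTensor_conj]
    rw [← Matrix.trace_sum, ← Finset.sum_mul, sum_localTensor_of_eq_one_of_ne v _ hv hA,
      Matrix.one_mul]

/-- The Kraus operators `A i` form a complete measurement. -/
def IsMeasurement {ι X Y : Type*} [Fintype ι] [Fintype Y] [DecidableEq X]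
    (A : ι → Matrix Y X ℂ) : Prop :=
  ∑ i, (A i)ᴴ * A i = 1

theorem IsMeasurement.sum_eq {ι X Y : Type*} [Fintype ι] [Fintype Y] [DecidableEq X]
    {A : ι → Matrix Y X ℂ} (hA : IsMeasurement A) : ∑ i, (A i)ᴴ * A i = 1 := hA

theorem IsMeasurement.submatrix {ι X X' Y : Type*} [Fintype ι] [Fintype Y] [DecidableEq X]
    [DecidableEq X'] {A : ι → Matrix Y X ℂ} (hA : IsMeasurement A) (e : X' ≃ X) :
    IsMeasurement fun i => (A i).submatrix id e := by
  rw [IsMeasurement, ← Matrix.submatrix_one_equiv e, ← hA]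
  ext x y
  simp [Matrix.sum_apply, Matrix.mul_apply]

theorem IsMeasurement.mul {ι κ X Y Z : Type*} [Fintype ι] [Fintype κ] [Fintype Y] [Fintype Z]
    [DecidableEq X] [DecidableEq Y] {A : ι → Matrix Y X ℂ} {B : κ → Matrix Z Y ℂ}
    (hB : IsMeasurement B) (hA : IsMeasurement A) :
    IsMeasurement fun i : ι × κ => B i.2 * A i.1 := by
  have reassociate (i j) : (B j * A i)ᴴ * (B j * A i) =
      (A i)ᴴ * ((B j)ᴴ * B j) * A i := by
    simp only [Matrix.conjTranspose_mul, Matrix.mul_assoc]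
  simp only [IsMeasurement, Fintype.sum_prod_type, reassociate, ← Matrix.sum_mul,
    ← Matrix.mul_sum, hB.sum_eq, Matrix.mul_one, hA.sum_eq]

theorem IsMeasurement.localTensor {P : Type} [Fintype P] [DecidableEq P] {O H K : P → Type}
    [∀ v, Fintype (O v)] [∀ v, Fintype (K v)] [∀ v, DecidableEq (H v)]
    [DecidableEq (∀ v, H v)] {A : ∀ v, O v → Matrix (K v) (H v) ℂ} (hA : ∀ v, IsMeasurement (A v)) :
    IsMeasurement fun o : ∀ v, O v => localTensor fun v => A v (o v) := by
  simp only [IsMeasurement, localTensor_conjTranspose, localTensor_mul]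
  rw [sum_localTensor fun v i => (A v i)ᴴ * A v i]
  simp only [(hA _).sum_eq, localTensor_one]

/-- `Λ` has a Kraus decomposition all of whose operators satisfy `p`. For an LOCC map these are
the operators of the branches of the protocol. -/
def HasKrausOps {X Y : Type} [Fintype X] (p : Matrix Y X ℂ → Prop)
    (Λ : Matrix X X ℂ → Matrix Y Y ℂ) : Prop :=
  ∃ (B : Type) (_ : Fintype B) (A : B → Matrix Y X ℂ),
    (∀ ρ, Λ ρ = ∑ b, A b * ρ * (A b)ᴴ) ∧ ∀ b, p (A b)

theorem HasKrausOps.mono {X Y : Type} [Fintype X] {p q : Matrix Y X ℂ → Prop}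
    {Λ : Matrix X X ℂ → Matrix Y Y ℂ} (h : HasKrausOps p Λ) (hpq : ∀ A, p A → q A) :
    HasKrausOps q Λ :=
  let ⟨B, hB, A, hA, hp⟩ := h
  ⟨B, hB, A, hA, fun b => hpq _ (hp b)⟩

/-! ## Protocols in which every party measures once -/

section MeasuredSystem

variable {P : Type} [DecidableEq P] {K H : P → Type}

/-- The local systems after the measurement of `v`: `K v` for `v`, unchanged otherwise. A subtype
of the sum (and not an `if`) gives every party's system its finiteness without case distinction. -/
abbrev MeasuredSystem (K H : P → Type) (v : P) (u : P) : Type :=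
  {x : K u ⊕ H u // x.isLeft = true ↔ u = v}

/-- The system of the party that has measured is its output system. -/
def measuredEquiv {v u : P} (huv : u = v) : MeasuredSystem K H v u ≃ K u where
  toFun x := x.1.getLeft (x.2.2 huv)
  invFun k := ⟨Sum.inl k, by simp [huv]⟩
  left_inv x := Subtype.ext (by simp)
  right_inv _ := rfl

/-- The system of a party that has not measured is its input system. -/
def unmeasuredEquiv {v u : P} (huv : u ≠ v) : MeasuredSystem K H v u ≃ H u where
  toFun x := x.1.getRight (by simpa using mt x.2.1 huv)
  invFun h := ⟨Sum.inr h, by simp [huv]⟩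
  left_inv x := Subtype.ext (by simp)
  right_inv _ := rfl

/-- The step of a protocol in which `v` applies `B v` and the other parties wait. -/
def measureOp [∀ v, DecidableEq (H v)] (v : P) (B : ∀ u, Matrix (K u) (H u) ℂ) (u : P) :
    Matrix (MeasuredSystem K H v u) (H u) ℂ :=
  if huv : u = v then (B u).submatrix (measuredEquiv huv) id
  else (1 : Matrix (H u) (H u) ℂ).submatrix (unmeasuredEquiv huv) id

/-- What the parties have to do after the measurement of `v`, in order to apply `B`. -/
def remainingOp [∀ v, DecidableEq (K v)] (v : P) (B : ∀ u, Matrix (K u) (H u) ℂ) (u : P) :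
    Matrix (K u) (MeasuredSystem K H v u) ℂ :=
  if huv : u = v then (1 : Matrix (K u) (K u) ℂ).submatrix id (measuredEquiv huv)
  else (B u).submatrix id (unmeasuredEquiv huv)

theorem remainingOp_of_ne [∀ v, DecidableEq (K v)] {v u : P} (huv : u ≠ v)
    (B : ∀ u, Matrix (K u) (H u) ℂ) :
    remainingOp v B u = (B u).submatrix id (unmeasuredEquiv huv) := dif_neg huv

variable [∀ v, Fintype (K v)]

theorem measureOp_conjTranspose_mul_self [∀ v, Fintype (H v)] [∀ v, DecidableEq (H v)] (v : P)
    (B : ∀ u, Matrix (K u) (H u) ℂ) :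
    (measureOp v B v)ᴴ * measureOp v B v = (B v)ᴴ * B v := by
  rw [measureOp, dif_pos rfl, Matrix.conjTranspose_submatrix, Matrix.submatrix_mul_equiv,
    Matrix.submatrix_id_id]

theorem measureOp_conjTranspose_mul_of_ne [∀ v, Fintype (H v)] [∀ v, DecidableEq (H v)] {v u : P}
    (huv : u ≠ v) (B : ∀ u, Matrix (K u) (H u) ℂ) :
    (measureOp v B u)ᴴ * measureOp v B u = 1 := by
  rw [measureOp, dif_neg huv, Matrix.conjTranspose_submatrix, Matrix.submatrix_mul_equiv,
    Matrix.submatrix_id_id, Matrix.conjTranspose_one, Matrix.one_mul]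

variable [∀ v, DecidableEq (K v)]

theorem remainingOp_conjTranspose_mul_self [∀ v, DecidableEq (H v)] (v : P)
    (B : ∀ u, Matrix (K u) (H u) ℂ) :
    (remainingOp v B v)ᴴ * remainingOp v B v = 1 := by
  rw [remainingOp, dif_pos rfl, Matrix.conjTranspose_submatrix,
    ← Matrix.submatrix_mul _ _ _ _ _ Function.bijective_id, Matrix.conjTranspose_one,
    Matrix.one_mul, Matrix.submatrix_one_equiv]

theorem remainingOp_conjTranspose_mul_of_ne {v u : P} (huv : u ≠ v)
    (B : ∀ u, Matrix (K u) (H u) ℂ) :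
    (remainingOp v B u)ᴴ * remainingOp v B u =
      ((B u)ᴴ * B u).submatrix (unmeasuredEquiv huv) (unmeasuredEquiv huv) := by
  rw [remainingOp_of_ne huv, Matrix.conjTranspose_submatrix,
    Matrix.submatrix_mul _ _ _ id _ Function.bijective_id]

theorem remainingOp_mul_measureOp [∀ v, Fintype (H v)] [∀ v, DecidableEq (H v)] (v : P)
    (B B' : ∀ u, Matrix (K u) (H u) ℂ) (u : P) :
    remainingOp v B u * measureOp v B' u = if u = v then B' u else B u := by
  by_cases huv : u = v
  · rw [remainingOp, measureOp, dif_pos huv, dif_pos huv, if_pos huv, Matrix.submatrix_mul_equiv,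
      Matrix.submatrix_id_id, Matrix.one_mul]
  · rw [remainingOp, measureOp, dif_neg huv, dif_neg huv, if_neg huv, Matrix.submatrix_mul_equiv,
      Matrix.submatrix_id_id, Matrix.mul_one]

end MeasuredSystem

theorem dependsOn_inter {ι β : Type*} {α : ι → Type*} {f : (∀ i, α i) → β} {s t : Set ι}
    (hs : DependsOn f s) (ht : DependsOn f t) : DependsOn f (s ∩ t) := by
  classical
  intro x y hxy
  calc f x = f (s.piecewise x y) := hs fun i hi => by simp [hi]
    _ = f y := ht fun i hi => by
      by_cases his : i ∈ s
      · simpa [his] using hxy i ⟨his, hi⟩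
      · simp [his]

theorem dependsOn_setOf_notMem_list {ι β : Type*} {α : ι → Type*} {f : (∀ i, α i) → β}
    (l : List ι) (h : ∀ i ∈ l, DependsOn f {i}ᶜ) : DependsOn f {i | i ∉ l} := by
  induction l with
  | nil => simpa using dependsOn_univ f
  | cons i l ih =>
    rw [List.forall_mem_cons] at h
    exact (dependsOn_inter h.1 (ih h.2)).mono fun j hj => by simpa using hj

section TwoRounds

variable {P : Type} {O O' : P → Type} {X X' : P → Type*} {T : Finset P}

/-- Something that every party `v` makes depend on outcomes `o` can be done in two rounds: the
parties outside `T` use their own outcome only, those in `T` also the outcomes of the former. -/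
structure IsTwoRound (T : Finset P) (M : ∀ v, (∀ u, O u) → X v) : Prop where
  first : ∀ v ∉ T, DependsOn (M v) {v}
  second : ∀ v ∈ T, DependsOn (M v) {u | u ∈ T → u = v}

theorem IsTwoRound.map {M : ∀ v, (∀ u, O u) → X v} (hM : IsTwoRound T M) (π : ∀ u, O' u → O u)
    (Φ : ∀ v, X v → O' v → X' v) :
    IsTwoRound T fun v (o : ∀ u, O' u) => Φ v (M v fun u => π u (o u)) (o v) where
  first v hv o o' h := by
    beta_reduce
    rw [hM.first v hv (y := fun u => π u (o' u)) fun u hu => congrArg (π u) (h u hu), h v rfl]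
  second v hv o o' h := by
    beta_reduce
    rw [hM.second v hv (y := fun u => π u (o' u)) fun u hu => congrArg (π u) (h u hu),
      h v fun _ => rfl]

end TwoRounds

section Protocols

variable {P : Type} [DecidableEq P] {K : P → Type} [∀ v, Fintype (K v)] [∀ v, DecidableEq (K v)]
  {O : P → Type} [∀ v, Fintype (O v)]

/-- A protocol in which the parties of `l` measure once each, in the order of `l`: the operator
`M v o` that `v` applies, if the outcomes of the parties are `o`, does not depend on the outcomes
of those who come after `v`. The parties outside `l` apply an isometry. -/
structure IsAdaptive {H : P → Type} [∀ v, DecidableEq (H v)] (l : List P)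
    (M : ∀ v, (∀ u, O u) → Matrix (K v) (H v) ℂ) : Prop where
  isMeasurement : ∀ v ∈ l, ∀ o, IsMeasurement fun i => M v (Function.update o v i)
  isometry : ∀ v ∉ l, ∀ o, (M v o)ᴴ * M v o = 1
  causal : l.Pairwise fun v u => DependsOn (M v) {u}ᶜ

variable {H : P → Type} [∀ v, DecidableEq (H v)]

theorem IsAdaptive.tail {v : P} {l : List P} (hl : (v :: l).Nodup)
    {M : ∀ v, (∀ u, O u) → Matrix (K v) (H v) ℂ} (hM : IsAdaptive (v :: l) M) :
    IsAdaptive l fun u o => remainingOp v (fun w => M w o) u where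
  isMeasurement u hu o := by
    have huv : u ≠ v := fun e => (List.nodup_cons.1 hl).1 (e ▸ hu)
    simp only [remainingOp_of_ne huv]
    exact (hM.isMeasurement u (List.mem_cons_of_mem _ hu) o).submatrix _
  isometry u hu o := by
    by_cases huv : u = v
    · subst huv
      exact remainingOp_conjTranspose_mul_self u _
    · rw [remainingOp_conjTranspose_mul_of_ne huv, hM.isometry u (by simp [huv, hu]),
        Matrix.submatrix_one_equiv]
  causal := (List.pairwise_cons.1 hM.causal).2.imp fun {u w} h o o' ho => by
    simp only [remainingOp, h ho]

variable [Fintype P] [∀ v, Fintype (H v)]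

/- The outcomes `o₀` of the parties outside `l` are a parameter, so that the induction can record
there what the earlier parties have measured. -/
theorem IsAdaptive.exists_isLOCC {l : List P} (hl : l.Nodup)
    {M : ∀ v, (∀ u, O u) → Matrix (K v) (H v) ℂ} (hM : IsAdaptive l M) (o₀ : ∀ v, O v) :
    ∃ Λ : MultiOp H → MultiOp K, IsLOCC Λ ∧
      HasKrausOps (fun A => ∃ o, A = localTensor (fun v => M v o) ∧ ∀ v ∉ l, o v = o₀ v) Λ := by
  induction l generalizing H o₀ with
  | nil =>
    exact ⟨_, .done (fun v => M v o₀) (fun v => hM.isometry v (by simp) o₀) _ fun ρ => rfl,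
      Unit, inferInstance, fun _ => localTensor fun v => M v o₀, fun ρ => by simp,
      fun _ => ⟨o₀, rfl, fun _ _ => rfl⟩⟩
  | cons v l ih =>
    choose next hnext B hB A hA o ho using fun i =>
      ih hl.of_cons (hM.tail hl) (Function.update o₀ v i)
    have hMv : DependsOn (M v) {u | u ∉ l} :=
      dependsOn_setOf_notMem_list l (List.pairwise_cons.1 hM.causal).1
    let first (i : O v) := measureOp v fun u => M u (Function.update o₀ v i)
    have compose (i : O v) (b : B i) :
        A i b * localTensor (first i) = localTensor fun u => M u (o i b) := by
      rw [(ho i b).1, localTensor_mul]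
      congr 1 with u : 1
      rw [remainingOp_mul_measureOp]
      split_ifs with huv
      · subst huv
        exact (hMv (ho i b).2).symm
      · rfl
    refine ⟨_, .round v first ?_ (fun i u huv => measureOp_conjTranspose_mul_of_ne huv _) next
      hnext _ fun ρ => rfl, Σ i, B i, inferInstance, fun b => A b.1 b.2 * localTensor (first b.1),
      fun ρ => ?_, fun b => ⟨o b.1 b.2, compose b.1 b.2, fun u hu => ?_⟩⟩
    · simp only [first, measureOp_conjTranspose_mul_self]
      exact hM.isMeasurement v (by simp) o₀
    · simp only [hA, Fintype.sum_sigma, Matrix.conjTranspose_mul, Matrix.mul_assoc]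
    · rw [(ho b.1 b.2).2 u fun h => hu (List.mem_cons_of_mem _ h),
        Function.update_of_ne fun e => hu (by simp [e])]

theorem IsTwoRound.exists_isLOCC [∀ v, Nonempty (O v)] {T : Finset P}
    {M : ∀ v, (∀ u, O u) → Matrix (K v) (H v) ℂ} (hM : IsTwoRound T M)
    (hmeas : ∀ v o, IsMeasurement fun i => M v (Function.update o v i)) :
    ∃ Λ : MultiOp H → MultiOp K, IsLOCC Λ ∧
      HasKrausOps (fun A => ∃ o, A = localTensor fun v => M v o) Λ := by
  have nodup : (Tᶜ.toList ++ T.toList).Nodup := List.nodup_append.2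
    ⟨Tᶜ.nodup_toList, T.nodup_toList, fun u hu v hv => by
      rintro rfl
      simp_all⟩
  have first {v u : P} (hv : v ∈ Tᶜ.toList) (hvu : v ≠ u) : DependsOn (M v) {u}ᶜ :=
    (hM.first v (by simpa using hv)).mono (by simpa using hvu.symm)
  have second {v u : P} (hv : v ∈ T.toList) (hu : u ∈ T.toList) (hvu : v ≠ u) :
      DependsOn (M v) {u}ᶜ :=
    (hM.second v (by simpa using hv)).mono fun w hw => by
      rintro rfl
      exact hvu (hw (by simpa using hu)).symm
  have adaptive : IsAdaptive (Tᶜ.toList ++ T.toList) M :=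
    { isMeasurement := fun v _ => hmeas v
      isometry := fun v hv => absurd hv (by simp [em'])
      causal := List.pairwise_append.2
        ⟨Tᶜ.nodup_toList.imp_of_mem fun hv _ => first hv, T.nodup_toList.imp_of_mem second,
          fun v hv u hu => first hv ((List.nodup_append.1 nodup).2.2 v hv u hu)⟩ }
  obtain ⟨Λ, hΛ, hK⟩ := adaptive.exists_isLOCC nodup fun _ => Classical.arbitrary _
  exact ⟨Λ, hΛ, hK.mono fun A ⟨o, hA, _⟩ => ⟨o, hA⟩⟩

end Protocols

/-! ## Fidelity with a pure state -/

section PureState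

variable {X Y : Type}

theorem pureState_posSemidef [Finite X] (η : X → ℂ) : (pureState η).PosSemidef :=
  Matrix.posSemidef_vecMulVec_self_star η

variable [Fintype X]

theorem star_dotProduct_self (w : X → ℂ) : star w ⬝ᵥ w = ((∑ x, ‖w x‖ ^ 2 : ℝ) : ℂ) := by
  simp [dotProduct, Complex.conj_mul']

theorem trace_pureState (η : X → ℂ) : (pureState η).trace = ((∑ x, ‖η x‖ ^ 2 : ℝ) : ℂ) := by
  rw [pureState, Matrix.trace_vecMulVec, dotProduct_comm, star_dotProduct_self]

theorem mul_pureState_mul_conjTranspose (A : Matrix Y X ℂ) (η : X → ℂ) :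
    A * pureState η * Aᴴ = pureState (A *ᵥ η) := by
  rw [pureState, pureState, Matrix.mul_vecMulVec, Matrix.vecMulVec_mul, Matrix.star_mulVec]

theorem dotProduct_pureState_mulVec (ψ η : X → ℂ) :
    star ψ ⬝ᵥ pureState η *ᵥ ψ = ((‖star ψ ⬝ᵥ η‖ ^ 2 : ℝ) : ℂ) := by
  rw [pureState, Matrix.vecMulVec_mulVec, Matrix.star_dotProduct η ψ, dotProduct_smul]
  simp [Complex.mul_conj']

theorem norm_star_dotProduct_sq_le {ψ : X → ℂ} (hψ : ∑ x, ‖ψ x‖ ^ 2 = 1) (η : X → ℂ) :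
    ‖star ψ ⬝ᵥ η‖ ^ 2 ≤ ∑ x, ‖η x‖ ^ 2 := by
  have cauchy_schwarz := norm_inner_le_norm (𝕜 := ℂ) (WithLp.toLp 2 ψ) (WithLp.toLp 2 η)
  have unit : ‖WithLp.toLp 2 ψ‖ = 1 := by rw [EuclideanSpace.norm_eq, Real.sqrt_eq_one, hψ]
  rw [unit, one_mul, EuclideanSpace.inner_toLp_toLp, dotProduct_comm] at cauchy_schwarz
  calc _ ≤ ‖WithLp.toLp 2 η‖ ^ 2 := by gcongr
    _ = _ := EuclideanSpace.norm_sq_eq _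

open scoped Classical in
theorem sqrt_pureState (w : X → ℂ) :
    CFC.sqrt (pureState w) = (((Real.sqrt (∑ x, ‖w x‖ ^ 2))⁻¹ : ℝ) : ℂ) • pureState w := by
  set c : ℝ := ∑ x, ‖w x‖ ^ 2 with hc
  refine CFC.sqrt_unique ?_ (Matrix.nonneg_iff_posSemidef.2
    ((pureState_posSemidef w).smul (by exact_mod_cast inv_nonneg.2 (Real.sqrt_nonneg c))))
  have square : pureState w * pureState w = (c : ℂ) • pureState w := by
    rw [pureState, Matrix.vecMulVec_mul_vecMulVec, star_dotProduct_self, Matrix.vecMulVec_smul]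
  rw [Matrix.smul_mul, Matrix.mul_smul, square, smul_smul, smul_smul]
  rcases eq_or_ne c 0 with h0 | h0
  · have : w = 0 := by
      ext x
      have := (Finset.sum_eq_zero_iff_of_nonneg fun x _ => by positivity).1 (hc ▸ h0) x
        (Finset.mem_univ x)
      simpa using this
    simp [this, pureState]
  · rw [← Complex.ofReal_mul, ← mul_inv, Real.mul_self_sqrt (by positivity), ← Complex.ofReal_mul,
      inv_mul_cancel₀ h0, Complex.ofReal_one, one_smul]

variable [DecidableEq X]

theorem fidelity_pureState {ρ : Matrix X X ℂ} (hρ : ρ.PosSemidef) (ψ : X → ℂ) :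
    fidelity ρ (pureState ψ) = (star ψ ⬝ᵥ ρ *ᵥ ψ).re := by
  have sqrt_hermitian : (CFC.sqrt ρ)ᴴ = CFC.sqrt ρ :=
    (Matrix.nonneg_iff_posSemidef.1 (CFC.sqrt_nonneg ρ)).isHermitian
  have sqrt_mul_sqrt : CFC.sqrt ρ * CFC.sqrt ρ = ρ :=
    CFC.sqrt_mul_sqrt_self ρ (Matrix.nonneg_iff_posSemidef.2 hρ)
  set w := CFC.sqrt ρ *ᵥ ψ with hw
  have sandwich : CFC.sqrt ρ * pureState ψ * CFC.sqrt ρ = pureState w := by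
    nth_rw 2 [← sqrt_hermitian]
    exact mul_pureState_mul_conjTranspose _ _
  have expectation : star ψ ⬝ᵥ ρ *ᵥ ψ = star w ⬝ᵥ w := by
    conv_lhs => rw [← sqrt_mul_sqrt]
    rw [hw, Matrix.star_mulVec, sqrt_hermitian, ← Matrix.mulVec_mulVec, Matrix.dotProduct_mulVec]
  rw [fidelity, sandwich, sqrt_pureState, Matrix.trace_smul, trace_pureState, smul_eq_mul,
    ← Complex.ofReal_mul, inv_mul_eq_div, Real.div_sqrt, expectation, star_dotProduct_self,
    Complex.ofReal_re, Complex.ofReal_re, Real.sq_sqrt (by positivity)]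

theorem fidelity_sum_smul_pureState {Q : Type*} [Fintype Q] {w : Q → ℝ} (hw : ∀ q, 0 ≤ w q)
    (η : Q → X → ℂ) (ψ : X → ℂ) :
    fidelity (∑ q, (w q : ℂ) • pureState (η q)) (pureState ψ) =
      ∑ q, w q * ‖star ψ ⬝ᵥ η q‖ ^ 2 := by
  rw [fidelity_pureState (Matrix.posSemidef_sum _ fun q _ =>
    (pureState_posSemidef _).smul (by exact_mod_cast hw q))]
  simp only [Matrix.sum_mulVec, dotProduct_sum, Matrix.smul_mulVec, dotProduct_smul,
    dotProduct_pureState_mulVec, Complex.re_sum, smul_eq_mul, ← Complex.ofReal_mul,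
    Complex.ofReal_re]

end PureState

section KrausFidelity

variable {X Y B : Type} [Fintype X] [Fintype Y] [Fintype B] {A : B → Matrix Y X ℂ}
  {Λ : Matrix X X ℂ → Matrix Y Y ℂ}

theorem sum_norm_mulVec_kraus (hA : ∀ ρ, Λ ρ = ∑ b, A b * ρ * (A b)ᴴ)
    (htr : ∀ ρ, (Λ ρ).trace = ρ.trace) (η : X → ℂ) :
    ∑ b, ∑ y, ‖(A b *ᵥ η) y‖ ^ 2 = ∑ x, ‖η x‖ ^ 2 := by
  have h := htr (pureState η)
  simp only [hA, Matrix.trace_sum, mul_pureState_mul_conjTranspose, trace_pureState] at h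
  exact_mod_cast h

theorem fidelity_kraus_mixture [DecidableEq Y] {Q : Type*} [Fintype Q]
    (hA : ∀ ρ, Λ ρ = ∑ b, A b * ρ * (A b)ᴴ) {w : Q → ℝ} (hw : ∀ q, 0 ≤ w q)
    (η : Q → X → ℂ) (ψ : Y → ℂ) :
    fidelity (Λ (∑ q, (w q : ℂ) • pureState (η q))) (pureState ψ) =
      ∑ q, w q * ∑ b, ‖star ψ ⬝ᵥ A b *ᵥ η q‖ ^ 2 := by
  have output : Λ (∑ q, (w q : ℂ) • pureState (η q)) =
      ∑ i : Q × B, (w i.1 : ℂ) • pureState (A i.2 *ᵥ η i.1) := by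
    simp only [hA, Matrix.mul_sum, Matrix.sum_mul, Matrix.mul_smul, Matrix.smul_mul,
      mul_pureState_mul_conjTranspose, Fintype.sum_prod_type]
    exact Finset.sum_comm
  rw [output, fidelity_sum_smul_pureState (w := fun i : Q × B => w i.1) fun i => hw i.1,
    Fintype.sum_prod_type]
  simp only [Finset.mul_sum]

/- Each pure state is mapped to a mixture of unit weight, all of whose branches are multiples of
`ψ` if the state is in `good`. -/
theorem HasKrausOps.fidelity_bounds [DecidableEq Y] {Q : Type*} [Fintype Q] {w : Q → ℝ}
    (hw : ∀ q, 0 ≤ w q) (hw1 : ∑ q, w q = 1) {η : Q → X → ℂ} (hη : ∀ q, ∑ x, ‖η q x‖ ^ 2 = 1)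
    {ψ : Y → ℂ} (hψ : ∑ y, ‖ψ y‖ ^ 2 = 1) {good : Finset Q}
    (hΛ : HasKrausOps (fun A => ∀ q ∈ good, ∃ c : ℂ, A *ᵥ η q = c • ψ) Λ)
    (htr : ∀ ρ, (Λ ρ).trace = ρ.trace) :
    ∑ q ∈ good, w q ≤ fidelity (Λ (∑ q, (w q : ℂ) • pureState (η q))) (pureState ψ) ∧
      fidelity (Λ (∑ q, (w q : ℂ) • pureState (η q))) (pureState ψ) ≤ 1 := by
  obtain ⟨B, _, A, hA, hgood⟩ := hΛ
  have overlap_le (q : Q) : ∑ b, ‖star ψ ⬝ᵥ A b *ᵥ η q‖ ^ 2 ≤ 1 :=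
    calc _ ≤ ∑ b, ∑ y, ‖(A b *ᵥ η q) y‖ ^ 2 :=
          Finset.sum_le_sum fun b _ => norm_star_dotProduct_sq_le hψ _
      _ = 1 := (sum_norm_mulVec_kraus hA htr (η q)).trans (hη q)
  have overlap_eq_one (q : Q) (hq : q ∈ good) :
      ∑ b, ‖star ψ ⬝ᵥ A b *ᵥ η q‖ ^ 2 = 1 := by
    rw [← hη q, ← sum_norm_mulVec_kraus hA htr (η q)]
    refine Finset.sum_congr rfl fun b _ => ?_
    obtain ⟨c, hc⟩ := hgood b q hq
    rw [hc, dotProduct_smul, star_dotProduct_self, hψ]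
    simp only [Complex.ofReal_one, smul_eq_mul, mul_one, Pi.smul_apply, norm_mul, mul_pow,
      ← Finset.mul_sum, hψ]
  rw [fidelity_kraus_mixture hA hw]
  constructor
  · calc ∑ q ∈ good, w q = ∑ q ∈ good, w q * ∑ b, ‖star ψ ⬝ᵥ A b *ᵥ η q‖ ^ 2 :=
          Finset.sum_congr rfl fun q hq => by rw [overlap_eq_one q hq, mul_one]
      _ ≤ _ := Finset.sum_le_univ_sum_of_nonneg fun q => mul_nonneg (hw q) (by positivity)
  · calc _ ≤ ∑ q, w q * 1 :=
          Finset.sum_le_sum fun q _ => mul_le_mul_of_nonneg_left (overlap_le q) (hw q)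
      _ = 1 := by simpa using hw1

end KrausFidelity

/-! ## One-way distillation protocols of two parties -/

theorem conj_unitary {H : Type*} [Fintype H] [DecidableEq H] {F : Matrix H H ℂ}
    (hF : Fᴴ * F = 1) : Fᴴᵀᴴ * Fᴴᵀ = 1 := by
  rw [← Matrix.transpose_one, ← hF, Matrix.transpose_mul]
  congr 1
  ext x y
  simp

/-- A one-way protocol of two parties: the first measures with Kraus operators `A s` and announces
`s`, the second then measures with Kraus operators `B s r`. A vector that they share is described
by the matrix `T` of its amplitudes in the product basis `H × H`. -/
structure Gadget (H K : Type) [DecidableEq H] [Fintype K] where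
  S : Type
  R : Type
  [fintypeS : Fintype S]
  [fintypeR : Fintype R]
  A : S → Matrix K H ℂ
  B : S → R → Matrix K H ℂ
  isMeasurement_A : IsMeasurement A
  isMeasurement_B : ∀ s, IsMeasurement (B s)

namespace Gadget

attribute [instance] fintypeS fintypeR

variable {H K L : Type} [DecidableEq H] [Fintype K]

/-- In some branch of the protocol, the shared amplitude matrix `T` becomes `T'`. -/
def Maps [Fintype H] (g : Gadget H K) (T : Matrix H H ℂ) (T' : Matrix K K ℂ) : Prop :=
  ∃ s r, T' = g.A s * T * (g.B s r)ᵀ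

/-- The protocol `g`, followed by `g'`. The first party makes both of its measurements before the
second party starts. -/
def comp [DecidableEq K] [Fintype L] (g' : Gadget K L) (g : Gadget H K) : Gadget H L where
  S := g.S × g'.S
  R := g.R × g'.R
  A s := g'.A s.2 * g.A s.1
  B s r := g'.B s.2 r.2 * g.B s.1 r.1
  isMeasurement_A := g'.isMeasurement_A.mul g.isMeasurement_A
  isMeasurement_B s := (g'.isMeasurement_B s.2).mul (g.isMeasurement_B s.1)

theorem Maps.of_comp [Fintype H] [DecidableEq K] [Fintype L] {g' : Gadget K L} {g : Gadget H K}
    {T : Matrix H H ℂ} {T'' : Matrix L L ℂ} (h : (g'.comp g).Maps T T'') :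
    ∃ T', g.Maps T T' ∧ g'.Maps T' T'' := by
  obtain ⟨s, r, rfl⟩ := h
  refine ⟨_, ⟨s.1, r.1, rfl⟩, s.2, r.2, ?_⟩
  simp only [comp, Matrix.transpose_mul, Matrix.mul_assoc]

section Pi

variable {J : Type} [Fintype J] [DecidableEq J] {H K : J → Type} [∀ j, Fintype (H j)]
  [∀ j, DecidableEq (H j)] [∀ j, Fintype (K j)]

/-- The protocols `g j` side by side. -/
def pi (g : ∀ j, Gadget (H j) (K j)) : Gadget (∀ j, H j) (∀ j, K j) where
  S := ∀ j, (g j).S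
  R := ∀ j, (g j).R
  A s := localTensor fun j => (g j).A (s j)
  B s r := localTensor fun j => (g j).B (s j) (r j)
  isMeasurement_A := .localTensor fun j => (g j).isMeasurement_A
  isMeasurement_B s := .localTensor fun j => (g j).isMeasurement_B (s j)

theorem Maps.of_pi {g : ∀ j, Gadget (H j) (K j)} {T : ∀ j, Matrix (H j) (H j) ℂ}
    {T' : Matrix (∀ j, K j) (∀ j, K j) ℂ} (h : (pi g).Maps (localTensor T) T') :
    ∃ T'', T' = localTensor T'' ∧ ∀ j, (g j).Maps (T j) (T'' j) := by
  obtain ⟨s, r, rfl⟩ := h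
  refine ⟨fun j => (g j).A (s j) * T j * ((g j).B (s j) (r j))ᵀ, ?_, fun j => ⟨s j, r j, rfl⟩⟩
  simp only [pi, localTensor_transpose, localTensor_mul]

end Pi

/-- The protocol `g` after a renaming of the basis. -/
def reindex (g : Gadget H K) {H' : Type} [DecidableEq H'] (e : H' ≃ H) : Gadget H' K where
  S := g.S
  R := g.R
  A s := (g.A s).submatrix id e
  B s r := (g.B s r).submatrix id e
  isMeasurement_A := g.isMeasurement_A.submatrix e
  isMeasurement_B s := (g.isMeasurement_B s).submatrix e

theorem Maps.of_reindex [Fintype H] {g : Gadget H K} {H' : Type} [Fintype H'] [DecidableEq H']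
    {e : H' ≃ H} {T : Matrix H' H' ℂ} {T' : Matrix K K ℂ} (h : (g.reindex e).Maps T T') :
    g.Maps (T.submatrix e.symm e.symm) T' := by
  obtain ⟨s, r, rfl⟩ := h
  refine ⟨s, r, ?_⟩
  have rename : T = (T.submatrix e.symm e.symm).submatrix e e := by simp
  conv_lhs => rw [rename]
  simp only [reindex, Matrix.transpose_submatrix]
  rw [Matrix.submatrix_mul_equiv, Matrix.submatrix_mul_equiv, Matrix.submatrix_id_id]

section Rotate

variable [Fintype H]

/-- The protocol in which the parties apply the unitary `F` and its complex conjugate. -/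
def rotate (F : Matrix H H ℂ) (hF : Fᴴ * F = 1) : Gadget H H where
  S := Unit
  R := Unit
  A _ := F
  B _ _ := Fᴴᵀ
  isMeasurement_A := by simpa [IsMeasurement] using hF
  isMeasurement_B _ := by simpa [IsMeasurement] using conj_unitary hF

theorem Maps.of_rotate {F : Matrix H H ℂ} {hF : Fᴴ * F = 1} {T T' : Matrix H H ℂ}
    (h : (rotate F hF).Maps T T') : T' = F * T * Fᴴ := by
  obtain ⟨s, r, rfl⟩ := h
  rfl

end Rotate

/-- The operator that keeps the basis vectors in the range of `f` and renames `f x` to `x`. -/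
def selectOp {H K : Type} [DecidableEq H] (f : K → H) : Matrix K H ℂ :=
  Matrix.of fun x p => if p = f x then 1 else 0

theorem isMeasurement_selectOp [Finite H] {ι : Type} [Fintype ι] (f : ι → K → H)
    (hf : Function.Bijective fun ix : ι × K => f ix.1 ix.2) :
    IsMeasurement fun i => selectOp (f i) := by
  have := Fintype.ofFinite H
  ext p q
  simp only [Matrix.sum_apply, Matrix.mul_apply, Matrix.conjTranspose_apply, selectOp,
    Matrix.of_apply]
  rw [← Fintype.sum_prod_type', hf.sum_comp
    (g := fun h => star (if p = h then (1 : ℂ) else 0) * if q = h then 1 else 0)]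
  by_cases h : p = q <;> simp [h, Matrix.one_apply]

theorem selectOp_mul_mul_transpose {H K : Type} [Fintype H] [DecidableEq H] (f f' : K → H)
    (T : Matrix H H ℂ) (x y : K) : (selectOp f * T * (selectOp f')ᵀ) x y = T (f x) (f' y) := by
  simp [Matrix.mul_apply, selectOp]

end Gadget

/-! ## Majority codes -/

/-- A multiple of the identity: the amplitude matrix of a maximally entangled link. -/
def IsScalarMatrix {X : Type*} [DecidableEq X] (T : Matrix X X ℂ) : Prop := ∃ c : ℂ, T = c • 1

theorem IsScalarMatrix.isDiag {X : Type*} [DecidableEq X] {T : Matrix X X ℂ}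
    (h : IsScalarMatrix T) : T.IsDiag := by
  obtain ⟨c, rfl⟩ := h
  intro x y hxy
  simp [hxy]

section ShiftInvariant

variable {X : Type*} [AddCommGroup X]

/-- A matrix that commutes with all shifts: the amplitude matrix of a link without phase
errors. -/
def IsShiftInvariant (T : Matrix X X ℂ) : Prop := ∀ x y z, T (x + z) (y + z) = T x y

theorem IsShiftInvariant.isScalarMatrix [DecidableEq X] {T : Matrix X X ℂ}
    (h : IsShiftInvariant T) (h' : T.IsDiag) : IsScalarMatrix T := by
  refine ⟨T 0 0, ?_⟩
  ext x y
  by_cases hxy : x = y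
  · subst hxy
    simpa using h 0 0 x
  · simp [hxy, h' hxy]

theorem IsScalarMatrix.isShiftInvariant [DecidableEq X] {T : Matrix X X ℂ}
    (h : IsScalarMatrix T) : IsShiftInvariant T := by
  obtain ⟨c, rfl⟩ := h
  intro x y z
  simp [Matrix.one_apply]

end ShiftInvariant

section Majority

variable {X : Type} [AddCommGroup X]

/-- The offsets of the three entries of a word from its first entry. -/
def offsets (a : X × X) : Fin 3 → X := ![0, a.1, a.2]

theorem offsets_add (a b : X × X) (i : Fin 3) : offsets (a + b) i = offsets a i + offsets b i := by
  fin_cases i <;> simp [offsets]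

/-- The word with first entry `x` and offsets `a`. -/
def shiftedTriple (a : X × X) (x : X) : Fin 3 → X := fun i => x + offsets a i

theorem shiftedTriple_bijective :
    Function.Bijective fun ax : (X × X) × X => shiftedTriple ax.1 ax.2 := by
  constructor
  · rintro ⟨⟨a, b⟩, x⟩ ⟨⟨a', b'⟩, x'⟩ h
    obtain rfl : x = x' := by simpa [shiftedTriple, offsets] using congrFun h 0
    have h₁ := congrFun h 1
    have h₂ := congrFun h 2
    simp_all [shiftedTriple, offsets]
  · intro p
    refine ⟨((p 1 - p 0, p 2 - p 0), p 0), ?_⟩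
    ext i
    fin_cases i <;> simp [shiftedTriple, offsets]

variable [DecidableEq X]

/-- The offset that occurs at least twice in `offsets r`, if there is one. -/
def majorityOffset (r : X × X) : X := if r.1 = r.2 then r.1 else 0

theorem majorityOffset_eq_of_offsets_eq {r : X × X} {i j : Fin 3} (hij : i ≠ j)
    (h : offsets r i = offsets r j) : majorityOffset r = offsets r i := by
  fin_cases i <;> fin_cases j <;> simp_all [majorityOffset, offsets]

theorem exists_ne_notMem_of_subsingleton {s : Set (Fin 3)} (hs : s.Subsingleton) :
    ∃ i j, i ≠ j ∧ i ∉ s ∧ j ∉ s := by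
  rcases hs.eq_empty_or_singleton with rfl | ⟨i, rfl⟩
  · exact ⟨0, 1, by simp⟩
  · refine ⟨i + 1, i + 2, ?_⟩
    fin_cases i <;> decide

variable [Fintype X]

/-- Three links become one: the parties announce the offsets of their three systems, and the
second party corrects its own by the majority of the differences. -/
def majorityGadget : Gadget (Fin 3 → X) X where
  S := X × X
  R := X × X
  A s := Gadget.selectOp (shiftedTriple s)
  B s r := Gadget.selectOp fun y => shiftedTriple (r + s) (y - majorityOffset r)
  isMeasurement_A := Gadget.isMeasurement_selectOp _ shiftedTriple_bijective
  isMeasurement_B s := by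
    let shift : (X × X) × X ≃ (X × X) × X :=
      { toFun := fun rx => (rx.1 + s, rx.2 - majorityOffset rx.1)
        invFun := fun rx => (rx.1 - s, rx.2 + majorityOffset (rx.1 - s))
        left_inv := fun rx => by simp
        right_inv := fun rx => by simp }
    exact Gadget.isMeasurement_selectOp _ (shiftedTriple_bijective.comp shift.bijective)

variable {T : Fin 3 → Matrix X X ℂ} {T' : Matrix X X ℂ}

theorem majorityGadget_maps (h : majorityGadget.Maps (localTensor T) T') : ∃ a r, ∀ x y,
    T' x y = ∏ i, T i (x + offsets a i) (y - majorityOffset r + offsets r i + offsets a i) := by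
  obtain ⟨(a : X × X), (r : X × X), rfl⟩ := h
  refine ⟨a, r, fun x y => ?_⟩
  simp only [majorityGadget, Gadget.selectOp_mul_mul_transpose, localTensor_apply, shiftedTriple,
    offsets_add, add_assoc]

theorem majorityGadget_isDiag (h : majorityGadget.Maps (localTensor T) T')
    (hT : {i | ¬ IsScalarMatrix (T i)}.Subsingleton) : T'.IsDiag := by
  obtain ⟨a, r, hr⟩ := majorityGadget_maps h
  obtain ⟨i, j, hij, hi, hj⟩ := exists_ne_notMem_of_subsingleton hT
  simp only [Set.mem_ofPred_eq, not_not] at hi hj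
  intro x y hxy
  rw [hr]
  by_contra hne
  have diff {i} (hi : IsScalarMatrix (T i)) : x = y - majorityOffset r + offsets r i :=
    add_right_cancel <| not_imp_comm.1 (fun h => hi.isDiag h)
      (Finset.prod_ne_zero_iff.1 hne i (Finset.mem_univ i))
  have agree : offsets r i = offsets r j := add_left_cancel ((diff hi).symm.trans (diff hj))
  exact hxy (by simpa [majorityOffset_eq_of_offsets_eq hij agree] using diff hi)

theorem majorityGadget_isShiftInvariant (h : majorityGadget.Maps (localTensor T) T')
    (hT : ∀ i, IsShiftInvariant (T i)) : IsShiftInvariant T' := by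
  obtain ⟨a, r, hr⟩ := majorityGadget_maps h
  intro x y z
  rw [hr, hr]
  refine Finset.prod_congr rfl fun i _ => ?_
  rw [← hT i (x + offsets a i) _ z]
  congr 1 <;> abel

theorem majorityGadget_isScalarMatrix (h : majorityGadget.Maps (localTensor T) T')
    (hT : ∀ i, IsShiftInvariant (T i)) (hT' : {i | ¬ IsScalarMatrix (T i)}.Subsingleton) :
    IsScalarMatrix T' :=
  (majorityGadget_isShiftInvariant h hT).isScalarMatrix (majorityGadget_isDiag h hT')

end Majority

/-! ## The concatenated code -/

section Fourier

theorem star_addChar_mul {X : Type*} [AddCommGroup X] [Finite X] (ψ : AddChar X ℂ) (x y : X) :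
    star (ψ x) * ψ y = ψ (y - x) := by
  rw [sub_eq_neg_add, AddChar.map_add_eq_mul, AddChar.map_neg_eq_conj]
  rfl

variable {X : Type} [CommRing X] [Fintype X] {ψ : AddChar X ℂ}

/-- The Fourier matrix of the additive group of `X`, whose characters are named by the elements of
`X` with the help of `ψ`. -/
def fourierMatrix (ψ : AddChar X ℂ) : Matrix X X ℂ :=
  Matrix.of fun x y => ((√(Fintype.card X))⁻¹ : ℝ) * ψ (x * y)

theorem fourierMatrix_mul_diagonal_mul_conjTranspose [DecidableEq X] (ψ : AddChar X ℂ) (t : X → ℂ)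
    (x y : X) :
    (fourierMatrix ψ * Matrix.diagonal t * (fourierMatrix ψ)ᴴ) x y =
      (Fintype.card X : ℂ)⁻¹ * ∑ z, t z * ψ (z * (x - y)) := by
  have normalization : (((√(Fintype.card X))⁻¹ : ℝ) : ℂ) * ((√(Fintype.card X))⁻¹ : ℝ) =
      (Fintype.card X : ℂ)⁻¹ := by
    rw [← Complex.ofReal_mul, ← mul_inv, Real.mul_self_sqrt (by positivity), Complex.ofReal_inv,
      Complex.ofReal_natCast]
  rw [Matrix.mul_apply, Finset.mul_sum]
  refine Finset.sum_congr rfl fun z _ => ?_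
  have real : star (((√(Fintype.card X))⁻¹ : ℝ) : ℂ) = ((√(Fintype.card X))⁻¹ : ℝ) :=
    Complex.conj_ofReal _
  rw [Matrix.mul_diagonal, Matrix.conjTranspose_apply, fourierMatrix, Matrix.of_apply,
    Matrix.of_apply, star_mul', real, mul_sub, mul_comm z x, mul_comm z y, ← star_addChar_mul,
    ← normalization]
  ring

theorem fourierMatrix_conj_isShiftInvariant (ψ : AddChar X ℂ) {D : Matrix X X ℂ} (hD : D.IsDiag) :
    IsShiftInvariant (fourierMatrix ψ * D * (fourierMatrix ψ)ᴴ) := by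
  classical
  intro x y z
  rw [← hD.diagonal_diag]
  simp only [fourierMatrix_mul_diagonal_mul_conjTranspose, add_sub_add_right_eq_sub]

variable [DecidableEq X]

theorem fourierMatrix_mul_conjTranspose (hψ : ψ.IsPrimitive) :
    fourierMatrix ψ * (fourierMatrix ψ)ᴴ = 1 := by
  ext x y
  have expand := fourierMatrix_mul_diagonal_mul_conjTranspose ψ 1 x y
  simp only [Pi.one_def, Matrix.diagonal_one, Matrix.mul_one, one_mul,
    AddChar.sum_mulShift _ hψ, sub_eq_zero] at expand
  rw [expand, Matrix.one_apply]
  by_cases h : x = y <;> simp [h]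

theorem fourierMatrix_conj_isScalarMatrix (hψ : ψ.IsPrimitive) {D : Matrix X X ℂ}
    (hD : IsScalarMatrix D) : IsScalarMatrix (fourierMatrix ψ * D * (fourierMatrix ψ)ᴴ) := by
  obtain ⟨c, rfl⟩ := hD
  exact ⟨c, by rw [Matrix.mul_smul, Matrix.mul_one, Matrix.smul_mul,
    fourierMatrix_mul_conjTranspose hψ]⟩

/-- Nine links become one. The majorities on the inner level correct shift errors, those on the
outer level correct phase errors, which the Fourier matrix turns into shift errors. -/
def nineGadget (hψ : ψ.IsPrimitive) : Gadget (Fin 3 → Fin 3 → X) X :=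
  majorityGadget.comp ((Gadget.pi fun _ => Gadget.rotate (fourierMatrix ψ)
    (mul_eq_one_comm.1 (fourierMatrix_mul_conjTranspose hψ))).comp
      (Gadget.pi fun _ => majorityGadget))

theorem nineGadget_isScalarMatrix (hψ : ψ.IsPrimitive) {T : Fin 3 → Fin 3 → Matrix X X ℂ}
    {T' : Matrix X X ℂ} (h : (nineGadget hψ).Maps (localTensor fun i => localTensor (T i)) T')
    (hT : {i : Fin 3 × Fin 3 | ¬ IsScalarMatrix (T i.1 i.2)}.Subsingleton) :
    IsScalarMatrix T' := by
  obtain ⟨_, h, outer⟩ := h.of_comp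
  obtain ⟨_, inner, rotated⟩ := h.of_comp
  obtain ⟨T₁, rfl, inner_maps⟩ := inner.of_pi
  obtain ⟨T₂, rfl, rotated_maps⟩ := rotated.of_pi
  have rotated_eq i : T₂ i = fourierMatrix ψ * T₁ i * (fourierMatrix ψ)ᴴ :=
    (rotated_maps i).of_rotate
  have inner_isDiag (i) : (T₁ i).IsDiag := majorityGadget_isDiag (inner_maps i) fun j hj j' hj' =>
    congrArg Prod.snd (hT (show (i, j) ∈ _ from hj) (show (i, j') ∈ _ from hj'))
  have exists_error {i} (hi : ¬ IsScalarMatrix (T₂ i)) : ∃ j, ¬ IsScalarMatrix (T i j) := by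
    by_contra! perfect
    have : IsScalarMatrix (T₁ i) := majorityGadget_isScalarMatrix (inner_maps i)
      (fun j => (perfect j).isShiftInvariant) fun j hj => absurd (perfect j) hj
    exact hi (rotated_eq i ▸ fourierMatrix_conj_isScalarMatrix hψ this)
  refine majorityGadget_isScalarMatrix outer
    (fun i => rotated_eq i ▸ fourierMatrix_conj_isShiftInvariant ψ (inner_isDiag i))
    fun i hi i' hi' => ?_
  obtain ⟨j, hj⟩ := exists_error hi
  obtain ⟨j', hj'⟩ := exists_error hi'
  exact congrArg Prod.fst (hT (show (i, j) ∈ _ from hj) (show (i', j') ∈ _ from hj'))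

end Fourier

/-- The positions of the concatenated code with `m` levels. -/
abbrev CodeIndex (m : ℕ) : Type := Fin m → Fin 3 × Fin 3

/-- The concatenated code corrects errors in the positions `bad`: on each level, at most one of
nine blocks is not correctable. -/
def Correctable : ∀ m, (CodeIndex m → Prop) → Prop
  | 0, bad => ¬ bad ![]
  | m + 1, bad => {i | ¬ Correctable m fun x => bad (Fin.cons i x)}.Subsingleton

/-- The words of `m + 1` levels, arranged in nine blocks of `m` levels. -/
def blocksEquiv (X : Type) (m : ℕ) :
    (CodeIndex (m + 1) → X) ≃ (Fin 3 → Fin 3 → CodeIndex m → X) :=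
  ((Fin.consEquiv fun _ => Fin 3 × Fin 3).symm.arrowCongr (Equiv.refl X)).trans
    ((Equiv.curry _ _ X).trans (Equiv.curry _ _ _))

theorem localTensor_submatrix_blocksEquiv {X : Type} {m : ℕ}
    (T : CodeIndex (m + 1) → Matrix X X ℂ) :
    (localTensor T).submatrix (blocksEquiv X m).symm (blocksEquiv X m).symm =
      localTensor fun i => localTensor fun j => localTensor fun x => T (Fin.cons (i, j) x) := by
  ext p q
  simp only [Matrix.submatrix_apply, localTensor_apply]
  rw [← (Fin.consEquiv fun _ => Fin 3 × Fin 3).prod_comp, Fintype.prod_prod_type,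
    Fintype.prod_prod_type]
  rfl

section Code

variable {X : Type} [CommRing X] [Fintype X] [DecidableEq X] {ψ : AddChar X ℂ}

/-- The protocol of the concatenated code with `m` levels, which makes one link of `9 ^ m`. -/
def codeGadget (hψ : ψ.IsPrimitive) : ∀ m, Gadget (CodeIndex m → X) X
  | 0 => (Gadget.rotate (1 : Matrix X X ℂ) (by simp)).reindex (Equiv.funUnique _ X)
  | m + 1 => ((nineGadget hψ).comp (.pi fun _ => .pi fun _ => codeGadget hψ m)).reindex
      (blocksEquiv X m)

theorem codeGadget_isScalarMatrix (hψ : ψ.IsPrimitive) {m : ℕ} {T : CodeIndex m → Matrix X X ℂ}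
    {T' : Matrix X X ℂ} {bad : CodeIndex m → Prop}
    (h : (codeGadget hψ m).Maps (localTensor T) T') (hT : ∀ i, ¬ bad i → IsScalarMatrix (T i))
    (hbad : Correctable m bad) : IsScalarMatrix T' := by
  induction m generalizing T' with
  | zero =>
    obtain rfl : T' = T ![] := by
      rw [h.of_reindex.of_rotate, Matrix.one_mul, Matrix.conjTranspose_one, Matrix.mul_one]
      ext x y
      exact Fintype.prod_unique fun i => T i _ _
    exact hT _ hbad
  | succ m ih =>
    have blocks := h.of_reindex
    rw [localTensor_submatrix_blocksEquiv] at blocks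
    obtain ⟨_, inner, outer⟩ := blocks.of_comp
    obtain ⟨T₁, rfl, rows⟩ := inner.of_pi
    choose T₂ hT₂ entries using fun i => (rows i).of_pi
    obtain rfl : T₁ = fun i => localTensor (T₂ i) := funext hT₂
    refine nineGadget_isScalarMatrix hψ outer (hbad.anti ?_)
    rintro ⟨i, j⟩ hij correctable
    exact hij (ih (entries i j) (fun x hx => hT _ hx) correctable)

/-- The Weyl operators, products of shifts and characters: a basis of the matrices, which consists
of unitaries. -/
def weyl (ψ : AddChar X ℂ) (s : X × X) : Matrix X X ℂ :=
  Matrix.of fun x y => if y = x + s.1 then ψ (s.2 * x) else 0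

theorem weyl_unitary (ψ : AddChar X ℂ) (s : X × X) : (weyl ψ s)ᴴ * weyl ψ s = 1 := by
  ext x y
  simp only [Matrix.mul_apply, Matrix.conjTranspose_apply, weyl, Matrix.of_apply,
    ← sub_eq_iff_eq_add]
  by_cases h : x = y
  · simpa [h, Matrix.one_apply] using star_addChar_mul ψ (s.2 * (y - s.1)) (s.2 * (y - s.1))
  · simp [h]

theorem sum_star_weyl_mul_weyl (hψ : ψ.IsPrimitive) (x y x' y' : X) :
    ∑ s, star (weyl ψ s x y) * weyl ψ s x' y' =
      if x = x' ∧ y = y' then (Fintype.card X : ℂ) else 0 := by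
  have term (a b) : star (weyl ψ (a, b) x y) * weyl ψ (a, b) x' y' =
      (if y - x = a ∧ y' - x' = a then 1 else 0) * ψ (b * (x' - x)) := by
    rw [mul_sub, ← star_addChar_mul]
    by_cases h : y = x + a <;> by_cases h' : y' = x' + a <;>
      simp [weyl, h, h', sub_eq_iff_eq_add']
  rw [Fintype.sum_prod_type]
  simp only [term]
  rw [← Finset.sum_mul_sum, AddChar.sum_mulShift _ hψ]
  by_cases hx : x = x'
  · subst hx
    by_cases hy : y = y' <;> simp [ite_and, hy, eq_comm]
  · simp [hx, sub_eq_zero, Ne.symm hx]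

end Code

theorem exists_isPrimitive_addChar (d : ℕ) [NeZero d] :
    ∃ (_ : CommRing (Fin d)) (ψ : AddChar (Fin d) ℂ), ψ.IsPrimitive := by
  obtain ⟨n, rfl⟩ := Nat.exists_eq_succ_of_ne_zero (NeZero.ne d)
  exact ⟨ZMod.commRing (n + 1), ZMod.stdAddChar (N := n + 1),
    ZMod.isPrimitive_stdAddChar (n + 1)⟩

/-! ## Isotropic network states -/

section NetworkState

/-- A pure state in the decomposition of an isotropic link: `none` is the maximally entangled
state, `some c` is the standard basis state `c`. -/
abbrev LinkLabel (d : ℕ) : Type := Option (Fin d × Fin d)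

/-- The probability of a link label in the isotropic state of visibility `p`. -/
def linkWeight (d : ℕ) (p : ℝ) : LinkLabel d → ℝ
  | none => p
  | some _ => (1 - p) / (d : ℝ) ^ 2

/-- The amplitudes of the pure state of a link with a given label, as a matrix: a perfect link
acts as a multiple of the identity on what is teleported through it. -/
def linkVector (d : ℕ) : LinkLabel d → Matrix (Fin d) (Fin d) ℂ
  | none => (((Real.sqrt d)⁻¹ : ℝ) : ℂ) • 1
  | some c => Matrix.single c.1 c.2 1

theorem isotropic_eq_sum (d : ℕ) (p : ℝ) : isotropic d p =
    ∑ q, (linkWeight d p q : ℂ) • pureState fun a => linkVector d q a.1 a.2 := by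
  have entangled : (fun a : Fin d × Fin d => linkVector d none a.1 a.2) = maxEntangled d := by
    ext a
    simp [linkVector, maxEntangled, Matrix.one_apply]
  have mixed : ∑ c, pureState (fun a : Fin d × Fin d => linkVector d (some c) a.1 a.2) = 1 := by
    ext a b
    simp only [Matrix.sum_apply, pureState, Matrix.vecMulVec_apply, linkVector,
      Matrix.single_apply, ← Prod.ext_iff, Pi.star_apply, apply_ite star, star_one, star_zero,
      mul_ite, mul_one, mul_zero, Matrix.one_apply]
    rw [Finset.sum_eq_single b (fun c _ hc => by simp [hc]) (by simp)]
    simp [eq_comm]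
  rw [Fintype.sum_option, entangled]
  simp only [linkWeight, ← Finset.smul_sum, mixed, isotropic]

theorem sum_linkWeight (d : ℕ) [NeZero d] (p : ℝ) : ∑ q, linkWeight d p q = 1 := by
  have hd : (d : ℝ) ≠ 0 := NeZero.ne _
  simp only [Fintype.sum_option, linkWeight, Finset.sum_const, Finset.card_univ,
    Fintype.card_prod, Fintype.card_fin, nsmul_eq_mul]
  push_cast
  field_simp
  ring

theorem linkWeight_nonneg (d : ℕ) {p : ℝ} (h0 : 0 ≤ p) (h1 : p ≤ 1) :
    ∀ q, 0 ≤ linkWeight d p q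
  | none => h0
  | some _ => div_nonneg (sub_nonneg.2 h1) (by positivity)

theorem sum_norm_linkVector (d : ℕ) [NeZero d] (q : LinkLabel d) :
    ∑ c : Fin d × Fin d, ‖linkVector d q c.1 c.2‖ ^ 2 = 1 := by
  have hd : (d : ℝ) ≠ 0 := NeZero.ne _
  have norm_ite (P : Prop) [Decidable P] : ‖(if P then 1 else 0 : ℂ)‖ ^ 2 = if P then 1 else 0 := by
    split_ifs <;> simp
  cases q with
  | none =>
    simp only [Fintype.sum_prod_type, linkVector, Matrix.smul_apply, Matrix.one_apply, smul_eq_mul,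
      norm_mul, mul_pow, norm_ite]
    simp [hd]
  | some c =>
    simp only [linkVector, Matrix.single_apply, ← Prod.ext_iff, norm_ite]
    simp

variable {W : Type} (G : SimpleGraph W) {d : ℕ}

/-- The basis label, in a basis state of the network, of the system of `h.fst` on the edge of the
dart `h`. -/
def atDart {G : SimpleGraph W} (x : ∀ v, NetSystem G d v) (h : G.Dart) : Fin d :=
  x h.fst ⟨h.snd, h.adj⟩

/-- The systems of the network are indexed by the darts of the graph. -/
def dartEquiv (d : ℕ) : (∀ v, NetSystem G d v) ≃ (G.Dart → Fin d) where
  toFun x := atDart x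
  invFun f v w := f ⟨(v, w.1), w.2⟩
  left_inv _ := rfl
  right_inv _ := rfl

theorem linkEntry_edge [DecidableRel G.Adj] (p : ℝ) (x y : ∀ v, NetSystem G d v) (h : G.Dart) :
    linkEntry G d p x y h.edge =
      isotropic d p (atDart x h, atDart x h.symm) (atDart y h, atDart y h.symm) := by
  rcases h with ⟨⟨u, w⟩, h⟩
  exact dif_pos h

variable [Fintype W] [DecidableRel G.Adj]

/-- The edges of `G`, as a type. -/
abbrev EdgeType : Type := {e // e ∈ G.edgeFinset}

/-- The edge of a dart, as an element of `EdgeType`. -/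
def edgeOfDart (h : G.Dart) : EdgeType G := ⟨h.edge, by simp⟩

theorem exists_edgeOfDart_eq (e : EdgeType G) : ∃ h : G.Dart, edgeOfDart G h = e := by
  obtain ⟨e, he⟩ := e
  induction e with
  | h u w => exact ⟨⟨(u, w), SimpleGraph.mem_edgeFinset.1 he⟩, rfl⟩

/-- An arbitrary orientation of an edge, needed since the two ends of a link in the state
`linkVector d (some c)` are in different states. -/
def orient (e : EdgeType G) : G.Dart := (exists_edgeOfDart_eq G e).choose

theorem edgeOfDart_orient (e : EdgeType G) : edgeOfDart G (orient G e) = e :=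
  (exists_edgeOfDart_eq G e).choose_spec

theorem edgeOfDart_eq_iff (h h' : G.Dart) :
    edgeOfDart G h = edgeOfDart G h' ↔ h = h' ∨ h = h'.symm := by
  rw [← SimpleGraph.dart_edge_eq_iff, edgeOfDart, edgeOfDart, Subtype.mk.injEq]

theorem orient_bijective : Function.Bijective fun eb : EdgeType G × Bool =>
    if eb.2 then (orient G eb.1).symm else orient G eb.1 := by
  have edge_eq (e : EdgeType G) (b : Bool) :
      edgeOfDart G (if b then (orient G e).symm else orient G e) = e := by
    refine ((edgeOfDart_eq_iff G _ _).2 ?_).trans (edgeOfDart_orient G e)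
    cases b <;> simp
  constructor
  · rintro ⟨e, b⟩ ⟨e', b'⟩ h
    obtain rfl : e = e' := by
      rw [← edge_eq e b, ← edge_eq e' b']
      exact congrArg _ h
    have hne := (orient G e).symm_ne
    cases b <;> cases b' <;> simp_all [eq_comm]
  · intro h
    rcases (edgeOfDart_eq_iff G _ _).1 (edgeOfDart_orient G (edgeOfDart G h)) with h' | h'
    · exact ⟨(edgeOfDart G h, false), h'⟩
    · exact ⟨(edgeOfDart G h, true), by simp [h']⟩

variable [DecidableEq W]

/-- The pure network state with given link labels. -/
def netVector (q : EdgeType G → LinkLabel d) (x : ∀ v, NetSystem G d v) : ℂ :=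
  ∏ e, linkVector d (q e) (atDart x (orient G e)) (atDart x (orient G e).symm)

theorem networkState_eq_sum (p : ℝ) : networkState G d p =
    ∑ q : EdgeType G → LinkLabel d, ((∏ e, linkWeight d p (q e) : ℝ) : ℂ) •
      pureState (netVector G q) := by
  ext x y
  have entry (e : EdgeType G) : linkEntry G d p x y e.1 = ∑ q, (linkWeight d p q : ℂ) *
      (linkVector d q (atDart x (orient G e)) (atDart x (orient G e).symm) *
        star (linkVector d q (atDart y (orient G e)) (atDart y (orient G e).symm))) := by
    conv_lhs => rw [← edgeOfDart_orient G e]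
    rw [edgeOfDart, linkEntry_edge, isotropic_eq_sum, Matrix.sum_apply]
    rfl
  calc networkState G d p x y = ∏ e : EdgeType G, linkEntry G d p x y e.1 := by
        rw [networkState, Matrix.of_apply, ← Finset.prod_coe_sort]
    _ = _ := by
        rw [Finset.prod_congr rfl fun e _ => entry e, Finset.prod_univ_sum,
          Fintype.piFinset_univ, Matrix.sum_apply]
        refine Finset.sum_congr rfl fun q _ => ?_
        rw [Finset.prod_mul_distrib, Finset.prod_mul_distrib, Matrix.smul_apply, pureState,
          Matrix.vecMulVec_apply, smul_eq_mul, Complex.ofReal_prod, Pi.star_apply, netVector,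
          netVector, star_prod]

theorem sum_norm_netVector [NeZero d] (q : EdgeType G → LinkLabel d) :
    ∑ x, ‖netVector G q x‖ ^ 2 = 1 := by
  let edgeEquiv : (∀ v, NetSystem G d v) ≃ (EdgeType G → Fin d × Fin d) :=
    (dartEquiv G d).trans
      (((Equiv.ofBijective _ (orient_bijective G)).arrowCongr (Equiv.refl (Fin d))).symm.trans
        ((Equiv.curry _ _ _).trans
          (Equiv.arrowCongr (Equiv.refl _) (Equiv.boolArrowEquivProd _))))
  calc ∑ x, ‖netVector G q x‖ ^ 2
      = ∑ c : EdgeType G → Fin d × Fin d, ∏ e, ‖linkVector d (q e) (c e).1 (c e).2‖ ^ 2 :=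
        Fintype.sum_equiv edgeEquiv _ _ fun x => by
          rw [netVector, norm_prod, Finset.prod_pow]
          rfl
    _ = ∏ e, ∑ c : Fin d × Fin d, ‖linkVector d (q e) c.1 c.2‖ ^ 2 := by
        rw [Finset.prod_univ_sum, Fintype.piFinset_univ]
    _ = 1 := Finset.prod_eq_one fun e _ => sum_norm_linkVector d (q e)

end NetworkState

/-! ## Measurements of a set of systems -/

section MeasuresOn

variable {D X O K : Type} [Fintype O] [Fintype K]

open Classical in
/-- The amplitudes `f i z y`, of outcome `i` and output label `z` given the label `y` of all
systems, belong to a complete measurement of exactly the systems in `s`. Working with labels of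
all systems spares the bookkeeping of which system a party holds. -/
def MeasuresOn (s : Set D) (f : O → K → (D → X) → ℂ) : Prop :=
  ∀ y y', ∑ i, ∑ z, star (f i z y) * f i z y' = if Set.EqOn y y' s then 1 else 0

namespace MeasuresOn

variable {s t : Set D} {f : O → K → (D → X) → ℂ}

theorem eq_of_eqOn (hf : MeasuresOn s f) {y y' : D → X} (h : Set.EqOn y y' s) (i : O) (z : K) :
    f i z y = f i z y' := by
  have expand (i z) : ((‖f i z y - f i z y'‖ ^ 2 : ℝ) : ℂ) =
      star (f i z y) * f i z y - star (f i z y) * f i z y' -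
        (star (f i z y') * f i z y - star (f i z y') * f i z y') := by
    rw [Complex.ofReal_pow, ← Complex.conj_mul', starRingEnd_apply, star_sub]
    ring
  have sum_eq_zero : ∑ i, ∑ z, ‖f i z y - f i z y'‖ ^ 2 = 0 := by
    have : ((∑ i, ∑ z, ‖f i z y - f i z y'‖ ^ 2 : ℝ) : ℂ) = 0 := by
      simp only [Complex.ofReal_sum, expand, Finset.sum_sub_distrib, hf _ _, if_pos h,
        if_pos h.symm, if_pos (Set.eqOn_refl _ _), sub_self]
    exact_mod_cast this
  have sum_row_eq_zero :=
    (Finset.sum_eq_zero_iff_of_nonneg fun i _ => by positivity).1 sum_eq_zero i (Finset.mem_univ i)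
  have entry_eq_zero := (Finset.sum_eq_zero_iff_of_nonneg fun z _ => by positivity).1
    sum_row_eq_zero z (Finset.mem_univ z)
  simpa [sub_eq_zero] using entry_eq_zero

theorem comp {E : Type} {s : Set E} {f : O → K → (E → X) → ℂ} (hf : MeasuresOn s f) (ι : E → D) :
    MeasuresOn (ι '' s) fun i z (y : D → X) => f i z (y ∘ ι) := fun y y' => by
  rw [hf, Set.eqOn_comp_right_iff]

theorem reindex {O' K' : Type} [Fintype O'] [Fintype K'] (hf : MeasuresOn s f) {φ : O' → O}
    (hφ : φ.Bijective) {χ : K' → K} (hχ : χ.Bijective) :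
    MeasuresOn s fun i z y => f (φ i) (χ z) y := fun y y' => by
  rw [← hf y y', ← hφ.sum_comp]
  exact Finset.sum_congr rfl fun i _ =>
    hχ.sum_comp fun z => star (f (φ i) z y) * f (φ i) z y'

theorem mul {O' : Type} [Fintype O'] {g : O' → Unit → (D → X) → ℂ} (hg : MeasuresOn t g)
    (hf : MeasuresOn s f) :
    MeasuresOn (t ∪ s) fun (i : O' × O) z y => g i.1 () y * f i.2 z y := fun y y' => by
  have factor (i : O' × O) : ∑ z, star (g i.1 () y * f i.2 z y) * (g i.1 () y' * f i.2 z y') =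
      (∑ z, star (g i.1 z y) * g i.1 z y') * ∑ z, star (f i.2 z y) * f i.2 z y' := by
    rw [Finset.mul_sum, Fintype.sum_unique fun z => star (g i.1 z y) * g i.1 z y']
    refine Finset.sum_congr rfl fun z _ => ?_
    rw [star_mul']
    exact mul_mul_mul_comm _ _ _ _
  simp only [factor, Fintype.sum_prod_type, ← Finset.mul_sum, ← Finset.sum_mul]
  rw [hg, hf, ite_zero_mul_ite_zero, mul_one]
  congr 1
  rw [Set.eqOn_union]

theorem prod {J : Type} [Fintype J] [DecidableEq J] {O : J → Type} [∀ j, Fintype (O j)]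
    {s : J → Set D} {f : ∀ j, O j → Unit → (D → X) → ℂ} (hf : ∀ j, MeasuresOn (s j) (f j)) :
    MeasuresOn (⋃ j, s j) fun (i : ∀ j, O j) (_ : Unit) y => ∏ j, f j (i j) () y := fun y y' => by
  calc ∑ i : ∀ j, O j, ∑ _z : Unit, star (∏ j : J, f j (i j) () y) * ∏ j : J, f j (i j) () y'
      = ∑ i : ∀ j, O j, ∏ j : J, ∑ z : Unit, star (f j (i j) z y) * f j (i j) z y' := by
        simp only [Fintype.sum_unique, star_prod, Finset.prod_mul_distrib]
    _ = _ := by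
        rw [← Fintype.piFinset_univ, ← Finset.prod_univ_sum (fun j => (Finset.univ : Finset (O j)))
          fun j i => ∑ z : Unit, star (f j i z y) * f j i z y']
        simp only [hf _ _ _, Fintype.prod_boole]
        congr 1
        simp [Set.EqOn, forall_comm (α := J)]

theorem isMeasurement {Y : Type} [DecidableEq Y] (hf : MeasuresOn s f) (e : Y → D → X)
    (he : ∀ x x', Set.EqOn (e x) (e x') s ↔ x = x') :
    IsMeasurement fun i => Matrix.of fun z x => f i z (e x) := by
  ext x x'
  simp only [Matrix.sum_apply, Matrix.mul_apply, Matrix.conjTranspose_apply, Matrix.of_apply,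
    Matrix.one_apply, hf _ _, he]

end MeasuresOn

theorem IsMeasurement.measuresOn {Y : Type} [DecidableEq Y] {A : O → Matrix K Y ℂ}
    (hA : IsMeasurement A) {s : Set D} (π : (D → X) → Y)
    (hπ : ∀ y y', π y = π y' ↔ Set.EqOn y y' s) : MeasuresOn s fun i z y => A i z (π y) := by
  intro y y'
  have := congrFun (congrFun hA.sum_eq (π y)) (π y')
  simp only [Matrix.sum_apply, Matrix.mul_apply, Matrix.conjTranspose_apply,
    Matrix.one_apply] at this
  convert this using 2
  rw [hπ]

theorem measuresOn_basis (s : Set D) [Fintype (s → X)] [DecidableEq (s → X)] :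
    MeasuresOn s fun (w : s → X) (_ : Unit) y => if s.domRestrict y = w then 1 else 0 := by
  intro y y'
  simp only [Fintype.sum_unique, apply_ite star, star_one, star_zero, mul_ite, mul_one, mul_zero,
    Finset.sum_ite_eq, Finset.mem_univ, if_true]
  congr 1
  rw [eq_comm, Set.domRestrict_eq_domRestrict_iff, Set.eqOn_comm]

end MeasuresOn

open Classical in
theorem sum_ite_eqOn_compl_range {D X U : Type} [Fintype (D → X)] [Fintype (U → X)]
    {ι : U → D} (hι : Function.Injective ι) (w : D → X) (g : (D → X) → ℂ) :
    ∑ f, (if Set.EqOn f w (Set.range ι)ᶜ then g f else 0) = ∑ y, g (Function.extend ι y w) := by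
  symm
  refine Fintype.sum_of_injective (fun y => Function.extend ι y w) (fun y y' h => ?_) _ _ ?_ ?_
  · funext u
    simpa only [hι.extend_apply] using congrFun h (ι u)
  · refine fun f hf => if_neg fun h => hf ⟨f ∘ ι, funext fun k => ?_⟩
    by_cases hk : k ∈ Set.range ι
    · obtain ⟨u, rfl⟩ := hk
      exact hι.extend_apply ..
    · exact (Function.extend_apply' _ _ _ hk).trans (h hk).symm
  · exact fun y => (if_pos fun k hk => Function.extend_apply' _ _ _ hk).symm

theorem exists_forall_domRestrict_eq_iff {D W X : Type*} [Nonempty X] (φ : D → W) (s : Set D)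
    (a : ∀ v, {h | φ h = v ∧ h ∉ s} → X) :
    ∃ w : D → X, ∀ f : D → X,
      (∀ v, {h | φ h = v ∧ h ∉ s}.domRestrict f = a v) ↔ Set.EqOn f w sᶜ := by
  classical
  refine ⟨fun h => if hh : h ∈ s then Classical.arbitrary X else a (φ h) ⟨h, rfl, hh⟩,
    fun f => ⟨fun hf h hh => ?_, fun hf v => funext fun ⟨h, hv, hh⟩ => ?_⟩⟩
  · change f h = dite _ _ _
    rw [dif_neg (show h ∉ s from hh)]
    exact congrFun (hf (φ h)) ⟨h, rfl, hh⟩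
  · subst hv
    exact (hf hh).trans (dif_neg hh)

section UsedSystems

variable {W : Type} [DecidableEq W] {G : SimpleGraph W} {d : ℕ} [NeZero d]

/-- A basis label of `v`, extended by `0` to the other parties. -/
def extendLabel (v : W) (x : NetSystem G d v) : ∀ u, NetSystem G d u :=
  Function.update (fun _ _ => 0) v x

theorem atDart_extendLabel (x : ∀ u, NetSystem G d u) (h : G.Dart) :
    atDart (extendLabel h.fst (x h.fst)) h = atDart x h := by
  simp [atDart, extendLabel]

theorem eqOn_atDart_extendLabel_iff {v : W} (a b : NetSystem G d v) :
    Set.EqOn (atDart (extendLabel v a)) (atDart (extendLabel v b)) {h | h.fst = v} ↔ a = b := by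
  refine ⟨fun h => funext fun w => ?_, fun h => h ▸ Set.eqOn_refl _ _⟩
  simpa [atDart, extendLabel] using h (x := ⟨(v, w), w.2⟩) rfl

variable [Fintype W] [DecidableRel G.Adj] {K : W → Type} [∀ v, Fintype (K v)]
  [∀ v, DecidableEq (K v)] {O : W → Type} [∀ v, Fintype (O v)] [∀ v, Nonempty (O v)] {T : Finset W}

theorem exists_isLOCC_of_measuresOn {N : ∀ v, (∀ u, O u) → K v → (G.Dart → Fin d) → ℂ}
    (hN : IsTwoRound T N)
    (hmeas : ∀ v o, MeasuresOn {h | h.fst = v} fun i => N v (Function.update o v i)) :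
    ∃ Λ : MultiOp (NetSystem G d) → MultiOp K, IsLOCC Λ ∧
      HasKrausOps (fun A => ∃ o, ∀ z x, A z x = ∏ v, N v o (z v) (atDart x)) Λ := by
  obtain ⟨Λ, hΛ, hK⟩ :=
    (hN.map (fun _ => id) (X' := fun v => Matrix (K v) (NetSystem G d v) ℂ) fun v f _ =>
      Matrix.of fun z x => f z (atDart (extendLabel v x))).exists_isLOCC fun v o =>
        (hmeas v o).isMeasurement _ eqOn_atDart_extendLabel_iff
  refine ⟨Λ, hΛ, hK.mono fun A ⟨o, hA⟩ => ⟨o, fun z x => ?_⟩⟩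
  rw [hA, localTensor_apply]
  refine Finset.prod_congr rfl fun v _ => ?_
  have := (hmeas v o).eq_of_eqOn (y := atDart (extendLabel v (x v))) (y' := atDart x)
    (fun h hv => by
      obtain rfl : h.fst = v := hv
      exact atDart_extendLabel x h) (o v) (z v)
  rwa [Function.update_eq_self] at this

variable {U : Type} [Fintype U] [DecidableEq U] {ι : U → G.Dart}

theorem exists_isLOCC_of_used (hι : Function.Injective ι)
    {n : ∀ v, (∀ u, O u) → K v → (U → Fin d) → ℂ} (hn : IsTwoRound T n)
    (hmeas : ∀ v o, MeasuresOn {u | (ι u).fst = v} fun i => n v (Function.update o v i)) :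
    ∃ Λ : MultiOp (NetSystem G d) → MultiOp K, IsLOCC Λ ∧
      HasKrausOps (fun A => ∃ o w, ∀ (F : (G.Dart → Fin d) → ℂ) z,
        (A *ᵥ fun x => F (atDart x)) z =
          ∑ y, (∏ v, n v o (z v) y) * F (Function.extend ι y w)) Λ := by
  classical
  let unused (v : W) : Set G.Dart := {h | h.fst = v ∧ h ∉ Set.range ι}
  have cover (v : W) : unused v ∪ ι '' {u | (ι u).fst = v} = {h | h.fst = v} := by
    ext h
    by_cases hh : h ∈ Set.range ι
    · obtain ⟨u, rfl⟩ := hh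
      simp [unused, hι.eq_iff]
    · simp only [unused, Set.mem_union, Set.mem_ofPred_eq, hh, not_false_eq_true, and_true,
        or_iff_left_iff_imp]
      rintro ⟨u, -, rfl⟩
      exact absurd ⟨u, rfl⟩ hh
  obtain ⟨Λ, hΛ, hK⟩ := exists_isLOCC_of_measuresOn
    (hn.map (O' := fun v => (unused v → Fin d) × O v) (fun _ => Prod.snd) fun v n' i z f =>
      (if (unused v).domRestrict f = i.1 then 1 else 0) * n' z (f ∘ ι)) fun v o => by
    have := (measuresOn_basis (X := Fin d) (unused v)).mul
      ((hmeas v fun u => (o u).2).comp ι)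
    rw [cover] at this
    convert this using 3 with i
    have : (fun u => (Function.update o v i u).2) = Function.update (fun u => (o u).2) v i.2 :=
      funext (Function.apply_update (fun _ => Prod.snd) o v i)
    rw [this, Function.update_self]
  refine ⟨Λ, hΛ, hK.mono fun A ⟨o, hA⟩ => ?_⟩
  obtain ⟨w, agree⟩ := exists_forall_domRestrict_eq_iff
    (fun h : G.Dart => h.fst) (Set.range ι) fun v => (o v).1
  refine ⟨fun v => (o v).2, w, fun F z => ?_⟩
  calc (A *ᵥ fun x => F (atDart x)) z
      = ∑ f : G.Dart → Fin d, if Set.EqOn f w (Set.range ι)ᶜ then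
          (∏ v, n v (fun v => (o v).2) (z v) (f ∘ ι)) * F f else 0 := by
        refine Fintype.sum_equiv (dartEquiv G d) _ _ fun x => ?_
        change A z x * F (atDart x) = if Set.EqOn (atDart x) w _ then _ * F (atDart x) else 0
        rw [hA, Finset.prod_mul_distrib, Fintype.prod_boole, ite_mul, one_mul, zero_mul, ite_mul,
          zero_mul]
        exact if_congr (agree _) rfl rfl
    _ = _ := by
        rw [sum_ite_eqOn_compl_range hι w]
        simp only [Function.extend_comp hι]

end UsedSystems

/-! ## Unitary error bases and teleportation -/

section UnitaryErrorBasis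

variable {X Y : Type} [Fintype X] [DecidableEq X] [Fintype Y] {A : Y → Matrix X X ℂ}

/-- The unitaries `A s` form a basis of the matrices that is orthogonal for the Hilbert–Schmidt
inner product; its vectors are those of a Bell measurement. The orthogonality is stated in the
equivalent form of the completeness relation of that measurement. -/
structure IsUnitaryErrorBasis (A : Y → Matrix X X ℂ) : Prop where
  unitary : ∀ s, (A s)ᴴ * A s = 1
  sum_star_mul : ∀ x y x' y', ∑ s, star (A s x y) * A s x' y' =
    if x = x' ∧ y = y' then (Fintype.card X : ℂ) else 0

/-- The normalization of a Bell measurement in dimension `n`. -/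
def bellScale (n : ℕ) : ℂ := ((√n)⁻¹ : ℝ)

theorem star_bellScale_mul_self (n : ℕ) : star (bellScale n) * bellScale n = (n : ℂ)⁻¹ := by
  rw [bellScale, ← starRingEnd_apply, Complex.conj_ofReal, ← Complex.ofReal_mul, ← mul_inv,
    Real.mul_self_sqrt n.cast_nonneg, Complex.ofReal_inv, Complex.ofReal_natCast]

namespace IsUnitaryErrorBasis

theorem pi (hA : IsUnitaryErrorBasis A) (T : Type) [Fintype T] [DecidableEq T] :
    IsUnitaryErrorBasis fun σ : T → Y => localTensor fun t => A (σ t) where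
  unitary σ := by
    simp only [localTensor_conjTranspose, localTensor_mul, hA.unitary, localTensor_one]
  sum_star_mul x y x' y' := by
    simp only [localTensor_apply, star_prod, ← Finset.prod_mul_distrib]
    rw [← Fintype.piFinset_univ, ← Finset.prod_univ_sum (fun _ => Finset.univ)
      fun t s => star (A s (x t) (y t)) * A s (x' t) (y' t)]
    simp only [hA.sum_star_mul, Finset.prod_ite_zero, Finset.prod_const, Finset.card_univ,
      Fintype.card_pi, Nat.cast_pow, Finset.mem_univ, true_imp_iff, forall_and, funext_iff]

theorem measuresOn [Nonempty X] (hA : IsUnitaryErrorBasis A) {D : Type} (a b : D) :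
    MeasuresOn {a, b} fun s (_ : Unit) (y : D → X) =>
      bellScale (Fintype.card X) * A s (y a) (y b) := fun y y' => by
  have hX : (Fintype.card X : ℂ) ≠ 0 := Nat.cast_ne_zero.2 Fintype.card_ne_zero
  simp only [Fintype.sum_unique, star_mul', mul_mul_mul_comm, star_bellScale_mul_self,
    ← Finset.mul_sum, hA.sum_star_mul, mul_ite, mul_zero, inv_mul_cancel₀ hX]
  congr 1
  simp [Set.EqOn]

theorem sum_transpose_mul_mul (hA : IsUnitaryErrorBasis A) (M : Matrix X X ℂ) :
    ∑ s, (A s)ᵀᴴ * M * (A s)ᵀ = (Fintype.card X * M.trace) • (1 : Matrix X X ℂ) := by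
  ext x x'
  have entry (s) : ((A s)ᵀᴴ * M * (A s)ᵀ) x x' =
      ∑ y', ∑ y, M y y' * (star (A s x y) * A s x' y') := by
    simp only [Matrix.mul_apply, Matrix.conjTranspose_apply, Matrix.transpose_apply,
      Finset.sum_mul]
    exact Finset.sum_congr rfl fun _ _ => Finset.sum_congr rfl fun _ _ => by ring
  simp only [Matrix.sum_apply, entry]
  rw [Finset.sum_comm]
  simp only [Finset.sum_comm (s := Finset.univ (α := Y)), ← Finset.mul_sum, hA.sum_star_mul]
  by_cases h : x = x'
  · simp [h, Matrix.trace, Finset.mul_sum, mul_comm]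
  · simp [h]

end IsUnitaryErrorBasis

variable {Z : Type}

/-- The measurement by which the register `X` of the state `ψ` is teleported: a Bell measurement
of that register and of the system at hand. -/
def teleportOp (A : Y → Matrix X X ℂ) (ψ : Matrix Z X ℂ) (s : Y) : Matrix Z X ℂ :=
  bellScale (Fintype.card X) • (ψ * (A s)ᵀ)

theorem IsUnitaryErrorBasis.isMeasurement_teleportOp [Fintype Z] [Nonempty X]
    (hA : IsUnitaryErrorBasis A)
    {ψ : Matrix Z X ℂ} (hψ : ∑ z, ∑ x, ‖ψ z x‖ ^ 2 = 1) :
    IsMeasurement (teleportOp A ψ) := by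
  have hX : (Fintype.card X : ℂ) ≠ 0 := Nat.cast_ne_zero.2 Fintype.card_ne_zero
  have trace_eq : (ψᴴ * ψ).trace = 1 := by
    simp only [Matrix.trace, Matrix.diag_apply, Matrix.mul_apply, Matrix.conjTranspose_apply]
    rw [Finset.sum_comm, ← Complex.ofReal_one, ← hψ]
    push_cast
    exact Finset.sum_congr rfl fun _ _ => Finset.sum_congr rfl fun _ _ => Complex.conj_mul' _
  have term (s) : (teleportOp A ψ s)ᴴ * teleportOp A ψ s =
      (Fintype.card X : ℂ)⁻¹ • ((A s)ᵀᴴ * (ψᴴ * ψ) * (A s)ᵀ) := by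
    simp only [teleportOp, Matrix.conjTranspose_smul, Matrix.conjTranspose_mul, Matrix.smul_mul,
      Matrix.mul_smul, smul_smul, star_bellScale_mul_self, mul_comm (bellScale _),
      Matrix.mul_assoc]
  rw [IsMeasurement]
  simp only [term]
  rw [← Finset.smul_sum, hA.sum_transpose_mul_mul, trace_eq, mul_one, smul_smul,
    inv_mul_cancel₀ hX, one_smul]

theorem IsUnitaryErrorBasis.teleportOp_mul (hA : IsUnitaryErrorBasis A) (ψ : Matrix Z X ℂ)
    (s : Y) : teleportOp A ψ s * (A s)ᴴᵀ = bellScale (Fintype.card X) • ψ := by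
  rw [teleportOp, Matrix.smul_mul, Matrix.mul_assoc, ← Matrix.transpose_mul, hA.unitary,
    Matrix.transpose_one, Matrix.mul_one]

end UnitaryErrorBasis

theorem isUnitaryErrorBasis_weyl {X : Type} [CommRing X] [Fintype X] [DecidableEq X]
    {ψ : AddChar X ℂ} (hψ : ψ.IsPrimitive) : IsUnitaryErrorBasis (weyl ψ) :=
  ⟨weyl_unitary ψ, sum_star_weyl_mul_weyl hψ⟩

/-! ## Teleportation along legs -/

theorem sum_path_eq_prod {X : Type} [Fintype X] [DecidableEq X] {r : ℕ}
    (A : Fin r → Matrix X X ℂ) (p q : X) :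
    ∑ a : Fin (r + 1) → X, (if a 0 = p ∧ a (Fin.last r) = q then
      ∏ j, A j (a j.castSucc) (a j.succ) else 0) = (List.ofFn A).prod p q := by
  induction r generalizing p with
  | zero =>
    rw [Fintype.sum_equiv (Equiv.funUnique (Fin 1) X) _
      (fun x => if x = p ∧ x = q then (1 : ℂ) else 0) (fun a => by simp)]
    by_cases h : p = q
    · simp [h]
    · simp [h, show ∀ x, ¬ (x = p ∧ x = q) from fun _ hx => h (hx.1.symm.trans hx.2)]
  | succ r ih =>
    have step (m) : A 0 p m * (List.ofFn fun i : Fin r => A i.succ).prod m q =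
        ∑ a : Fin (r + 1) → X, if a 0 = m then (if a (Fin.last r) = q then
          A 0 p (a 0) * ∏ j : Fin r, A j.succ (a j.castSucc) (a j.succ) else 0) else 0 := by
      rw [← ih, Finset.mul_sum]
      refine Finset.sum_congr rfl fun a _ => ?_
      by_cases h : a 0 = m <;> by_cases h' : a (Fin.last r) = q <;> simp [h, h']
    rw [List.ofFn_succ, List.prod_cons, Matrix.mul_apply,
      Fintype.sum_equiv (Fin.consEquiv fun _ : Fin (r + 2) => X).symm _
      (fun c : X × (Fin (r + 1) → X) => if c.1 = p ∧ c.2 (Fin.last r) = q then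
        A 0 c.1 (c.2 0) * ∏ j : Fin r, A j.succ (c.2 j.castSucc) (c.2 j.succ) else 0) ?_]
    · rw [Fintype.sum_prod_type, Fintype.sum_eq_single p fun x hx => by simp [hx]]
      simp only [true_and, step]
      rw [Finset.sum_comm]
      exact Finset.sum_congr rfl fun a _ => by simp
    · intro a
      simp only [Fin.consEquiv, Equiv.coe_fn_symm_mk, Fin.prod_univ_succ, Fin.castSucc_zero,
        Fin.tail]
      rfl

theorem sum_mul_prod_fiberwise {L Z : Type} [Fintype L] [DecidableEq L] [Fintype Z]
    [DecidableEq Z] {Y : L → Type} [∀ l, Fintype (Y l)] (s : ∀ l, Y l → Z) (F : (L → Z) → ℂ)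
    (g : ∀ l, Y l → ℂ) :
    ∑ y : ∀ l, Y l, F (fun l => s l (y l)) * ∏ l, g l (y l) =
      ∑ z : L → Z, F z * ∏ l, ∑ y, if s l y = z l then g l y else 0 := by
  simp only [Finset.prod_univ_sum, Fintype.piFinset_univ, Finset.mul_sum]
  rw [Finset.sum_comm]
  refine Finset.sum_congr rfl fun y _ => ?_
  rw [Fintype.sum_eq_single fun l => s l (y l)]
  · simp
  · intro z hz
    obtain ⟨l, hl⟩ := Function.ne_iff.1 hz
    rw [Finset.prod_eq_zero (Finset.mem_univ l) (if_neg hl.symm), mul_zero]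

/-- Pairwise edge-disjoint legs from `v₀` to the vertices `tgt l`, given by their darts; leg `l`
has `r l` inner vertices, none of them in `T`. -/
structure LegSystem {W : Type} (G : SimpleGraph W) (v₀ : W) (T : Finset W) {L : Type}
    (tgt : L → W) where
  r : L → ℕ
  dart : ∀ l, Fin (r l + 1) → G.Dart
  start : ∀ l, (dart l 0).fst = v₀
  finish : ∀ l, (dart l (Fin.last _)).snd = tgt l
  chain : ∀ l (j : Fin (r l)), (dart l j.castSucc).snd = (dart l j.succ).fst
  inner : ∀ l (j : Fin (r l)), (dart l j.succ).fst ∉ T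
  edge_injective : Function.Injective fun u : Σ l, Fin (r l + 1) => (dart u.1 u.2).edge

namespace LegSystem

variable {W : Type} {G : SimpleGraph W} {v₀ : W} {T : Finset W} {L : Type} {tgt : L → W}
  (S : LegSystem G v₀ T tgt)

/-- The systems on the legs: each link has two of them, at its first (`false`) and at its second
(`true`) vertex. -/
abbrev Used : Type := (Σ l, Fin (S.r l + 1)) × Bool

/-- The inner positions of the legs. -/
abbrev Inner : Type := Σ l, Fin (S.r l)

/-- The dart that stands for a system on the legs. -/
def usedDart (u : S.Used) : G.Dart :=
  if u.2 then (S.dart u.1.1 u.1.2).symm else S.dart u.1.1 u.1.2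

/-- The vertex at an inner position. -/
def node (j : S.Inner) : W := (S.dart j.1 j.2.succ).fst

/-- The system at an inner position that belongs to the link coming from `v₀`. -/
def arrival (j : S.Inner) : S.Used := (⟨j.1, j.2.castSucc⟩, true)

/-- The system at an inner position that belongs to the link leading away from `v₀`. -/
def departure (j : S.Inner) : S.Used := (⟨j.1, j.2.succ⟩, false)

/-- The system at the beginning (`false`) or at the end (`true`) of a leg. -/
def legEnd (x : L × Bool) : S.Used :=
  if x.2 then (⟨x.1, Fin.last _⟩, true) else (⟨x.1, 0⟩, false)

theorem node_notMem (j : S.Inner) : S.node j ∉ T := S.inner j.1 j.2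

theorem setOf_usedDart_fst_eq (v : W) : {u | (S.usedDart u).fst = v} =
    (⋃ j : {j // S.node j = v}, {S.arrival j.1, S.departure j.1}) ∪
      S.legEnd '' {x | (if x.2 then tgt x.1 else v₀) = v} := by
  ext u
  simp only [Set.mem_ofPred_eq, Set.mem_union, Set.mem_iUnion, Set.mem_insert_iff,
    Set.mem_singleton_iff, Set.mem_image]
  constructor
  · obtain ⟨⟨l, j⟩, b⟩ := u
    rintro hu
    cases b
    · change (S.dart l j).fst = v at hu
      induction j using Fin.cases with
      | zero => exact Or.inr ⟨(l, false), (S.start l).symm.trans hu, rfl⟩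
      | succ j => exact Or.inl ⟨⟨⟨l, j⟩, hu⟩, Or.inr rfl⟩
    · change (S.dart l j).snd = v at hu
      induction j using Fin.lastCases with
      | last => exact Or.inr ⟨(l, true), (S.finish l).symm.trans hu, rfl⟩
      | cast j => exact Or.inl ⟨⟨⟨l, j⟩, (S.chain l j).symm.trans hu⟩, Or.inl rfl⟩
  · rintro (⟨⟨j, hj⟩, rfl | rfl⟩ | ⟨⟨l, _ | _⟩, hx, rfl⟩)
    · exact (S.chain j.1 j.2).trans hj
    · exact hj
    · exact (S.start l).trans hx
    · exact (S.finish l).trans hx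

theorem edge_usedDart (u : S.Used) : (S.usedDart u).edge = (S.dart u.1.1 u.1.2).edge := by
  cases h : u.2 <;> simp [usedDart, h]

theorem usedDart_injective : Function.Injective S.usedDart := by
  rintro ⟨u, b⟩ ⟨u', b'⟩ h
  obtain rfl : u = u' :=
    S.edge_injective (by simpa only [edge_usedDart] using congrArg SimpleGraph.Dart.edge h)
  have := (S.dart u.1 u.2).symm_ne
  cases b <;> cases b' <;> simp_all [usedDart, eq_comm]

section Contraction

variable [Fintype W] [DecidableEq W] [DecidableRel G.Adj]

/-- The edge of a link of a leg. -/
def edge (l : L) (j : Fin (S.r l + 1)) : EdgeType G := edgeOfDart G (S.dart l j)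

variable {d : ℕ} (q : EdgeType G → LinkLabel d)

/-- The matrix of a link of a leg, oriented along the leg. -/
def linkMatrix (l : L) (j : Fin (S.r l + 1)) : Matrix (Fin d) (Fin d) ℂ :=
  if S.dart l j = orient G (S.edge l j) then linkVector d (q (S.edge l j))
  else (linkVector d (q (S.edge l j)))ᵀ

theorem linkVector_edge (f : G.Dart → Fin d) (l : L) (j : Fin (S.r l + 1)) :
    linkVector d (q (S.edge l j)) (f (orient G (S.edge l j))) (f (orient G (S.edge l j)).symm) =
      S.linkMatrix q l j (f (S.dart l j)) (f (S.dart l j).symm) := by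
  rw [linkMatrix]
  split_ifs with hd
  · rw [← hd]
  · have h : orient G (S.edge l j) = (S.dart l j).symm :=
      ((edgeOfDart_eq_iff G _ _).1 (edgeOfDart_orient G (S.edge l j))).resolve_left (Ne.symm hd)
    rw [h, SimpleGraph.Dart.symm_symm, Matrix.transpose_apply]

theorem exists_prod_linkVector_eq [Fintype L] (w : G.Dart → Fin d) :
    ∃ c : ℂ, ∀ y : S.Used → Fin d,
      ∏ e, linkVector d (q e) (Function.extend S.usedDart y w (orient G e))
        (Function.extend S.usedDart y w (orient G e).symm) =
      c * ∏ l, ∏ j, S.linkMatrix q l j (y (⟨l, j⟩, false)) (y (⟨l, j⟩, true)) := by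
  classical
  let used : Finset (EdgeType G) :=
    Finset.univ.image fun u : Σ l, Fin (S.r l + 1) => S.edge u.1 u.2
  refine ⟨∏ e ∈ usedᶜ, linkVector d (q e) (w (orient G e)) (w (orient G e).symm), fun y => ?_⟩
  have extend_unused {e} (he : e ∈ usedᶜ) (h : G.Dart) (hh : edgeOfDart G h = e) :
      Function.extend S.usedDart y w h = w h := by
    refine Function.extend_apply' _ _ _ ?_
    rintro ⟨u, rfl⟩
    exact Finset.mem_compl.1 he (Finset.mem_image.2
      ⟨u.1, Finset.mem_univ _, (Subtype.ext (S.edge_usedDart u).symm).trans hh⟩)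
  rw [← Finset.prod_compl_mul_prod used]
  congr 1
  · refine Finset.prod_congr rfl fun e he => ?_
    have h := edgeOfDart_orient G e
    rw [extend_unused he _ h,
      extend_unused he _ (((edgeOfDart_eq_iff G _ _).2 (Or.inr rfl)).trans h)]
  · rw [Finset.prod_image fun u _ u' _ h => S.edge_injective (congrArg Subtype.val h),
      Fintype.prod_sigma]
    refine Finset.prod_congr rfl fun l _ => Finset.prod_congr rfl fun j _ => ?_
    rw [linkVector_edge]
    congr 1
    · exact S.usedDart_injective.extend_apply y w (⟨l, j⟩, false)
    · exact S.usedDart_injective.extend_apply y w (⟨l, j⟩, true)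

/-- The matrix of the state that a leg ends up in, after its inner parties have projected onto the
vectors with matrices `A`. -/
def legMatrix (l : L) (A : Fin (S.r l) → Matrix (Fin d) (Fin d) ℂ) : Matrix (Fin d) (Fin d) ℂ :=
  Matrix.of fun a b => ∑ y : Fin (S.r l + 1) → Bool → Fin d,
    if y 0 false = a ∧ y (Fin.last _) true = b then
      (∏ j, A j (y j.castSucc true) (y j.succ false)) *
        ∏ j, S.linkMatrix q l j (y j false) (y j true) else 0

theorem exists_legMatrix_eq_smul {l : L} (hq : ∀ j, q (S.edge l j) = none)
    (A : Fin (S.r l) → Matrix (Fin d) (Fin d) ℂ) :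
    ∃ c : ℂ, S.legMatrix q l A = c • (List.ofFn A).prod := by
  obtain ⟨c₀, hc₀⟩ : ∃ c₀ : ℂ, ∀ j, S.linkMatrix q l j = c₀ • 1 :=
    ⟨((√d)⁻¹ : ℝ), fun j => by simp [linkMatrix, hq j, linkVector]⟩
  refine ⟨c₀ ^ (S.r l + 1), ?_⟩
  ext a b
  rw [Matrix.smul_apply, smul_eq_mul, ← sum_path_eq_prod, Finset.mul_sum, legMatrix,
    Matrix.of_apply]
  symm
  refine Fintype.sum_of_injective (fun x j _ => x j) (fun x x' h => ?_) _ _ ?_ ?_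
  · exact funext fun j => congrFun (congrFun h j) true
  · intro y hy
    obtain ⟨j, hj⟩ : ∃ j, y j false ≠ y j true := by
      by_contra! hcon
      exact hy ⟨fun j => y j true, funext fun j => funext fun b => by cases b <;> simp [hcon]⟩
    rw [Finset.prod_eq_zero (f := fun j => S.linkMatrix q l j (y j false) (y j true))
      (Finset.mem_univ j) (by simp [hc₀, hj]), mul_zero, ite_self]
  · intro x
    simp only [hc₀, Matrix.smul_apply, Matrix.one_apply_eq, smul_eq_mul, mul_one,
      Finset.prod_const, Finset.card_univ, Fintype.card_fin]
    split_ifs <;> ring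

end Contraction

end LegSystem

/-! ## Reduction of a network to its legs -/

namespace LegSystem

variable {W : Type} {G : SimpleGraph W} [DecidableEq W] {d : ℕ} {v₀ : W} {T : Finset W} {L : Type}
  {tgt : L → W} (S : LegSystem G v₀ T tgt) {Y : Type}

/-- The outcomes of all inner positions. -/
def collect {O : W → Type} (o : ∀ v, ({j // S.node j = v} → Y) × O v) (j : S.Inner) : Y :=
  (o (S.node j)).1 ⟨j, rfl⟩

theorem collect_update {O : W → Type} (o : ∀ v, ({j // S.node j = v} → Y) × O v) {v : W}
    (hv : v ∈ T) (i) : S.collect (Function.update o v i) = S.collect o := by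
  funext j
  have : S.node j ≠ v := fun h => S.node_notMem j (h ▸ hv)
  rw [collect, Function.update_of_ne this, collect]

variable [Fintype L]

/-- The Bell measurements of `v` at the inner positions of the legs that it holds. -/
def innerAmplitude (A : Y → Matrix (Fin d) (Fin d) ℂ) (v : W) (i : {j // S.node j = v} → Y)
    (y : S.Used → Fin d) : ℂ :=
  ∏ j, bellScale d * A (i j) (y (S.arrival j.1)) (y (S.departure j.1))

theorem measuresOn_innerAmplitude [DecidableEq L] [NeZero d] [Fintype Y]
    {A : Y → Matrix (Fin d) (Fin d) ℂ} (hA : IsUnitaryErrorBasis A) (v : W) :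
    MeasuresOn (⋃ j : {j // S.node j = v}, {S.arrival j.1, S.departure j.1})
      fun i (_ : Unit) y => S.innerAmplitude A v i y := by
  have := MeasuresOn.prod fun j : {j // S.node j = v} =>
    hA.measuresOn (S.arrival j.1) (S.departure j.1)
  rwa [Fintype.card_fin] at this

theorem prod_innerAmplitude [Fintype W] (A : Y → Matrix (Fin d) (Fin d) ℂ) {O : W → Type}
    (o : ∀ v, ({j // S.node j = v} → Y) × O v) (y : S.Used → Fin d) :
    ∏ v, S.innerAmplitude A v (o v).1 y = bellScale d ^ Fintype.card S.Inner *
      ∏ l, ∏ j, A (S.collect o ⟨l, j⟩) (y (⟨l, j.castSucc⟩, true)) (y (⟨l, j.succ⟩, false)) := by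
  have regroup (v) : S.innerAmplitude A v (o v).1 y = ∏ j : {j // S.node j = v},
      bellScale d * A (S.collect o j.1) (y (S.arrival j.1)) (y (S.departure j.1)) :=
    Finset.prod_congr rfl fun ⟨j, hj⟩ _ => by subst hj; rfl
  simp only [regroup]
  rw [Fintype.prod_fiberwise S.node
    fun j => bellScale d * A (S.collect o j) (y (S.arrival j)) (y (S.departure j)),
    Finset.prod_mul_distrib, Finset.prod_const, Finset.card_univ, Fintype.prod_sigma]
  rfl

theorem sum_mul_prod_legs [DecidableEq L] [Fintype W] [DecidableRel G.Adj]
    (q : EdgeType G → LinkLabel d)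
    (A : ∀ l, Fin (S.r l) → Matrix (Fin d) (Fin d) ℂ) (F : (L × Bool → Fin d) → ℂ) :
    ∑ y : S.Used → Fin d, F (y ∘ S.legEnd) *
      ((∏ l, ∏ j, A l j (y (⟨l, j.castSucc⟩, true)) (y (⟨l, j.succ⟩, false))) *
        ∏ l, ∏ j, S.linkMatrix q l j (y (⟨l, j⟩, false)) (y (⟨l, j⟩, true))) =
      ∑ y, F y * ∏ l, S.legMatrix q l (A l) (y (l, false)) (y (l, true)) := by
  let ends (l : L) (y : Fin (S.r l + 1) → Bool → Fin d) (b : Bool) : Fin d :=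
    if b then y (Fin.last _) true else y 0 false
  have ends_eq_iff (l y z) : ends l y = z ↔ y 0 false = z false ∧ y (Fin.last _) true = z true := by
    simp [ends, funext_iff, Bool.forall_bool]
  calc _ = ∑ y : ∀ l, Fin (S.r l + 1) → Bool → Fin d,
        F (Function.uncurry fun l => ends l (y l)) *
          ∏ l, ((∏ j, A l j (y l j.castSucc true) (y l j.succ false)) *
            ∏ j, S.linkMatrix q l j (y l j false) (y l j true)) := by
        refine Fintype.sum_equiv ((Equiv.curry _ _ _).trans
          (Equiv.piCurry fun _ _ => Bool → Fin d)) _ _ fun y => ?_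
        rw [Finset.prod_mul_distrib]
        congr 2
        funext ⟨l, b⟩
        cases b <;> rfl
    _ = _ := by
        rw [sum_mul_prod_fiberwise ends (fun z => F (Function.uncurry z))
          fun l y => (∏ j, A l j (y j.castSucc true) (y j.succ false)) *
            ∏ j, S.linkMatrix q l j (y j false) (y j true)]
        refine (Fintype.sum_equiv (Equiv.curry _ _ _) _ _ fun y => ?_).symm
        simp only [ends_eq_iff]
        rfl

variable [Fintype W] [DecidableRel G.Adj] [DecidableEq L] [NeZero d] [Fintype Y] [Nonempty Y]
  {K : W → Type} [∀ v, Fintype (K v)] [∀ v, DecidableEq (K v)]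
  {O : W → Type} [∀ v, Fintype (O v)] [∀ v, Nonempty (O v)]

theorem exists_isLOCC {A : Y → Matrix (Fin d) (Fin d) ℂ} (hA : IsUnitaryErrorBasis A)
    {e : (S.Inner → Y) → ∀ v, (∀ u, O u) → K v → (L × Bool → Fin d) → ℂ}
    (he : ∀ m, IsTwoRound T (e m)) (heT : ∀ v ∉ T, ∀ m m', e m v = e m' v)
    (hmeas : ∀ m v o, MeasuresOn {x | (if x.2 then tgt x.1 else v₀) = v}
      fun i => e m v (Function.update o v i)) :
    ∃ Λ : MultiOp (NetSystem G d) → MultiOp K, IsLOCC Λ ∧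
      HasKrausOps (fun M => ∃ o m, ∀ q : EdgeType G → LinkLabel d, ∃ c : ℂ, ∀ z,
        (M *ᵥ netVector G q) z = c * ∑ y, (∏ v, e m v o (z v) y) *
          ∏ l, S.legMatrix q l (fun j => A (m ⟨l, j⟩)) (y (l, false)) (y (l, true))) Λ := by
  let n (v : W) (o : ∀ u, ({j // S.node j = u} → Y) × O u) (z : K v) (y : S.Used → Fin d) : ℂ :=
    S.innerAmplitude A v (o v).1 y * e (S.collect o) v (fun u => (o u).2) z (y ∘ S.legEnd)
  have isTwoRound : IsTwoRound T n := by
    refine ⟨fun v hv o o' h => ?_, fun v hv o o' h => ?_⟩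
    · have outcome := (he (S.collect o)).first v hv fun u hu => congrArg Prod.snd (h u hu)
      simp only [n, h v rfl, outcome, heT v hv (S.collect o) (S.collect o')]
    · have collect_eq : S.collect o = S.collect o' := funext fun j => by
        rw [collect, h (S.node j) fun hj => absurd hj (S.node_notMem j), collect]
      have outcome := (he (S.collect o')).second v hv fun u hu => congrArg Prod.snd (h u hu)
      simp only [n, h v fun _ => rfl, outcome, collect_eq]
  have measures (v o) : MeasuresOn {u | (S.usedDart u).fst = v}
      fun i => n v (Function.update o v i) := by
    have := (S.measuresOn_innerAmplitude hA v).mul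
      ((hmeas (S.collect o) v fun u => (o u).2).comp S.legEnd)
    rw [← setOf_usedDart_fst_eq] at this
    convert this using 3 with i z
    have snd_update : (fun u => (Function.update o v i u).2) =
        Function.update (fun u => (o u).2) v i.2 :=
      funext (Function.apply_update (fun _ => Prod.snd) o v i)
    have collect_update : e (S.collect (Function.update o v i)) v = e (S.collect o) v := by
      by_cases hv : v ∈ T
      · rw [S.collect_update o hv]
      · exact heT v hv _ _
    simp only [n, snd_update, collect_update, Function.update_self]
  obtain ⟨Λ, hΛ, hK⟩ := exists_isLOCC_of_used S.usedDart_injective isTwoRound measures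
  refine ⟨Λ, hΛ, hK.mono fun M ⟨o, w, hM⟩ => ⟨fun u => (o u).2, S.collect o, fun q => ?_⟩⟩
  obtain ⟨c, hc⟩ := S.exists_prod_linkVector_eq q w
  refine ⟨bellScale d ^ Fintype.card S.Inner * c, fun z => ?_⟩
  rw [← S.sum_mul_prod_legs q (fun l j => A (S.collect o ⟨l, j⟩))
    fun y => ∏ v, e (S.collect o) v (fun u => (o u).2) (z v) y, Finset.mul_sum]
  refine (hM (fun f => ∏ e, linkVector d (q e) (f (orient G e)) (f (orient G e).symm)) z).trans
    (Finset.sum_congr rfl fun y _ => ?_)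
  rw [hc, Finset.prod_mul_distrib, prod_innerAmplitude]
  ring

end LegSystem

/-! ## Distillation of a state of the ends of the legs -/

theorem IsScalarMatrix.localTensor {X T : Type} [DecidableEq X] [Fintype T]
    {T' : T → Matrix X X ℂ} (h : ∀ t, IsScalarMatrix (T' t)) :
    IsScalarMatrix (localTensor T') := by
  choose c hc using h
  refine ⟨∏ t, c t, ?_⟩
  rw [← localTensor_one, ← localTensor_smul]
  exact congrArg _ (funext hc)

section Distill

variable {X T : Type} [CommRing X] [Fintype X] [DecidableEq X] [Fintype T] [DecidableEq T]
  {χ : AddChar X ℂ} (hχ : χ.IsPrimitive) (m : ℕ)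

/-- The codes of all ends `T` of the legs, side by side. -/
abbrev codeGadgets (T : Type) [Fintype T] [DecidableEq T] :
    Gadget (T → CodeIndex m → X) (T → X) :=
  .pi fun _ => codeGadget hχ m

/-- The outcomes of the centre: those of the codes and those of the teleportation. -/
abbrev CenterOutcome (T : Type) [Fintype T] [DecidableEq T] : Type :=
  (codeGadgets hχ m T).S × (T → X × X)

variable {Z : Type}

/-- The measurement by which the centre of the legs shares `ψ` with their ends: it decodes the legs
and teleports through the resulting links. -/
def centerOp (ψ : Matrix Z (T → X) ℂ) (a : CenterOutcome hχ m T) :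
    Matrix Z (T → CodeIndex m → X) ℂ :=
  teleportOp (fun σ : T → X × X => localTensor fun t => weyl χ (σ t)) ψ a.2 *
    (codeGadgets hχ m T).A a.1

/-- The measurement of the end `t` of the legs: it undoes the unitaries `V` of the legs, decodes,
and corrects the teleported state. -/
def endOp (V : CodeIndex m → Matrix X X ℂ) (a : CenterOutcome hχ m T) (t : T)
    (r : (codeGadget hχ m).R) : Matrix X (CodeIndex m → X) ℂ :=
  (weyl χ (a.2 t))ᴴ * ((codeGadget hχ m).B (a.1 t) r * localTensor fun i => (V i)ᴴᵀ)

theorem isMeasurement_centerOp [Fintype Z] {ψ : Matrix Z (T → X) ℂ}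
    (hψ : ∑ z, ∑ x, ‖ψ z x‖ ^ 2 = 1) : IsMeasurement (centerOp hχ m ψ) :=
  (((isUnitaryErrorBasis_weyl hχ).pi T).isMeasurement_teleportOp hψ).mul
    (codeGadgets hχ m T).isMeasurement_A

theorem isMeasurement_endOp {V : CodeIndex m → Matrix X X ℂ} (hV : ∀ i, (V i)ᴴ * V i = 1)
    (a : CenterOutcome hχ m T) (t : T) : IsMeasurement (endOp hχ m V a t) := by
  have weyl_mul : weyl χ (a.2 t) * (weyl χ (a.2 t))ᴴ = 1 :=
    mul_eq_one_comm.1 (weyl_unitary χ (a.2 t))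
  have undo : (localTensor fun i => (V i)ᴴᵀ)ᴴ * (localTensor fun i => (V i)ᴴᵀ) = 1 := by
    rw [localTensor_conjTranspose, localTensor_mul]
    simp only [conj_unitary (hV _), localTensor_one]
  have term (r) : (endOp hχ m V a t r)ᴴ * endOp hχ m V a t r =
      (localTensor fun i => (V i)ᴴᵀ)ᴴ * (((codeGadget hχ m).B (a.1 t) r)ᴴ *
        (codeGadget hχ m).B (a.1 t) r) * localTensor fun i => (V i)ᴴᵀ := by
    simp only [endOp, Matrix.conjTranspose_mul, Matrix.conjTranspose_conjTranspose,
      Matrix.mul_assoc]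
    rw [← Matrix.mul_assoc (weyl χ _), weyl_mul, Matrix.one_mul]
  simp only [IsMeasurement, term]
  rw [← Matrix.sum_mul, ← Matrix.mul_sum, ((codeGadget hχ m).isMeasurement_B _).sum_eq,
    Matrix.mul_one, undo]

theorem exists_centerOp_mul_endOp_eq_smul (ψ : Matrix Z (T → X) ℂ)
    {V R : T → CodeIndex m → Matrix X X ℂ} (hV : ∀ t i, (V t i)ᴴ * V t i = 1)
    {bad : T → CodeIndex m → Prop} (hbad : ∀ t, Correctable m (bad t))
    (hR : ∀ t i, ¬ bad t i → ∃ c : ℂ, R t i = c • V t i) (a : CenterOutcome hχ m T)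
    (r : T → (codeGadget hχ m).R) :
    ∃ c : ℂ, centerOp hχ m ψ a * localTensor (fun t => localTensor (R t)) *
      (localTensor fun t => endOp hχ m (V t) a t (r t))ᵀ = c • ψ := by
  let R' (t i) : Matrix X X ℂ := R t i * (V t i)ᴴ
  have good_isScalarMatrix (t i) (h : ¬ bad t i) : IsScalarMatrix (R' t i) := by
    obtain ⟨c, hc⟩ := hR t i h
    exact ⟨c, by rw [← mul_eq_one_comm.1 (hV t i), ← Matrix.smul_mul, ← hc]⟩
  obtain ⟨R'', decoded_eq, hR''⟩ := Gadget.Maps.of_pi (g := fun _ : T => codeGadget hχ m)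
    (T := fun t => localTensor (R' t)) ⟨a.1, r, rfl⟩
  obtain ⟨c, hc⟩ := IsScalarMatrix.localTensor fun t =>
    codeGadget_isScalarMatrix hχ (hR'' t) (good_isScalarMatrix t) (hbad t)
  have undone : localTensor (fun t => localTensor (R t)) *
      (localTensor fun t => localTensor fun i => (V t i)ᴴᵀ)ᵀ =
        localTensor fun t => localTensor (R' t) := by
    simp only [localTensor_transpose, localTensor_mul]
    rfl
  have endOps_eq : (localTensor fun t => endOp hχ m (V t) a t (r t)) =
      (localTensor fun t => weyl χ (a.2 t))ᴴ *
        ((codeGadgets hχ m T).B a.1 r * localTensor fun t => localTensor fun i => (V t i)ᴴᵀ) := by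
    have codes_eq : (codeGadgets hχ m T).B a.1 r =
        localTensor fun t => (codeGadget hχ m).B (a.1 t) (r t) := rfl
    rw [localTensor_conjTranspose, codes_eq, localTensor_mul, localTensor_mul]
    rfl
  refine ⟨c * bellScale (Fintype.card (T → X)), ?_⟩
  calc _ = teleportOp (fun σ : T → X × X => localTensor fun t => weyl χ (σ t)) ψ a.2 *
          ((codeGadgets hχ m T).A a.1 * (localTensor (fun t => localTensor (R t)) *
            (localTensor fun t => localTensor fun i => (V t i)ᴴᵀ)ᵀ) *
            ((codeGadgets hχ m T).B a.1 r)ᵀ) * (localTensor fun t => weyl χ (a.2 t))ᴴᵀ := by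
        rw [endOps_eq]
        simp only [centerOp, Matrix.transpose_mul, Matrix.mul_assoc]
    _ = _ := by
        rw [undone, decoded_eq, hc, Matrix.mul_smul, Matrix.mul_one, Matrix.smul_mul,
          ((isUnitaryErrorBasis_weyl hχ).pi T).teleportOp_mul ψ a.2, smul_smul]

end Distill

/-! ## Protocols at the ends of the legs -/

section Contraction

variable {T I X Z Z' : Type} [Fintype T] [DecidableEq T] [Fintype I] [DecidableEq I] [Fintype X]

theorem sum_mul_mul_prod_eq_mul_localTensor_mul (M : Matrix Z (T → I → X) ℂ)
    (N : Matrix Z' (T → I → X) ℂ) (R : T × I → Matrix X X ℂ) (z : Z) (z' : Z') :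
    ∑ y : (T × I) × Bool → X,
      M z (fun t i => y ((t, i), false)) * N z' (fun t i => y ((t, i), true)) *
        ∏ l, R l (y (l, false)) (y (l, true)) =
      (M * localTensor (fun t => localTensor fun i => R (t, i)) * Nᵀ) z z' := by
  let split : ((T × I) × Bool → X) ≃ (T → I → X) × (T → I → X) :=
    { toFun := fun y => (fun t i => y ((t, i), false), fun t i => y ((t, i), true))
      invFun := fun y u => if u.2 then y.2 u.1.1 u.1.2 else y.1 u.1.1 u.1.2
      left_inv := fun y => funext fun u => by obtain ⟨u, _ | _⟩ := u <;> rfl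
      right_inv := fun y => rfl }
  rw [← split.symm.sum_comp, Fintype.sum_prod_type_right, Matrix.mul_apply]
  refine Finset.sum_congr rfl fun y' _ => ?_
  rw [Matrix.mul_apply, Finset.sum_mul]
  refine Finset.sum_congr rfl fun y _ => ?_
  rw [Fintype.prod_prod_type, mul_right_comm]
  rfl

end Contraction

theorem apply_bijective {p : Prop} (h : p) (α : Type) :
    Function.Bijective fun f : p → α => f h :=
  ⟨fun _ _ hfg => funext fun _ => hfg, fun a => ⟨fun _ => a, rfl⟩⟩

section Star

variable {W : Type} {d : ℕ} {v₀ : W} {T : Finset W} {P : W → Prop} {I α β : Type}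

/-- The outcomes of `v` if the outcomes of `v₀` are in `α` and those of each party in `T` in `β`. -/
abbrev StarOutcome (v₀ : W) (T : Finset W) (α β : Type) (v : W) : Type :=
  (v = v₀ → α) × (v ∈ T → β)

theorem starOutcome_apply_fst_bijective {v : W} (h : v = v₀) (hv : v ∉ T) :
    Function.Bijective fun i : StarOutcome v₀ T α β v => i.1 h :=
  ⟨fun _ _ hij => Prod.ext (funext fun _ => hij) (funext fun ht => absurd ht hv),
    fun a => ⟨(fun _ => a, fun ht => absurd ht hv), rfl⟩⟩

theorem starOutcome_apply_snd_bijective {v : W} (h : v ∈ T) (hv : v ≠ v₀) :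
    Function.Bijective fun i : StarOutcome v₀ T α β v => i.2 h :=
  ⟨fun _ _ hij => Prod.ext (funext fun hv' => absurd hv' hv) (funext fun _ => hij),
    fun b => ⟨(fun hv' => absurd hv' hv, fun _ => b), rfl⟩⟩

variable [DecidableEq W]

/-- The measurement by `v` of its ends of the legs: by `M` if `v = v₀`, and by `N` if `v ∈ T`, where
`N` may depend on the outcome of `v₀`. -/
def starAmplitude (hP : ∀ v, P v ↔ v = v₀ ∨ v ∈ T) (M : α → Matrix (Fin d) (T → I → Fin d) ℂ)
    (N : α → T → β → Matrix (Fin d) (I → Fin d) ℂ) (v : W) (o : ∀ u, StarOutcome v₀ T α β u)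
    (z : P v → Fin d) (y : (T × I) × Bool → Fin d) : ℂ :=
  if h : v = v₀ then
    M ((o v).1 h) (z ((hP v).2 (Or.inl h))) fun t i => y ((t, i), false)
  else if h : v ∈ T then
    N ((o v₀).1 rfl) ⟨v, h⟩ ((o v).2 h) (z ((hP v).2 (Or.inr h))) fun i => y ((⟨v, h⟩, i), true)
  else 1

variable {hP : ∀ v, P v ↔ v = v₀ ∨ v ∈ T} {M : α → Matrix (Fin d) (T → I → Fin d) ℂ}
  {N : α → T → β → Matrix (Fin d) (I → Fin d) ℂ}

theorem starAmplitude_isTwoRound (hv₀ : v₀ ∉ T) : IsTwoRound T (starAmplitude hP M N) where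
  first v hv o o' h := by
    funext z y
    simp only [starAmplitude, h v rfl, hv, dif_neg, not_false_iff]
  second v _ o o' h := by
    funext z y
    simp only [starAmplitude, h v fun _ => rfl, h v₀ fun hv₀' => absurd hv₀' hv₀]

theorem prod_starAmplitude [Fintype W] (hv₀ : v₀ ∉ T) (o : ∀ u, StarOutcome v₀ T α β u)
    (z : ∀ v, P v → Fin d) (y : (T × I) × Bool → Fin d) :
    ∏ v, starAmplitude hP M N v o (z v) y =
      M ((o v₀).1 rfl) (z v₀ ((hP v₀).2 (Or.inl rfl))) (fun t i => y ((t, i), false)) *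
        localTensor (fun t : T => N ((o v₀).1 rfl) t ((o t).2 t.2))
          (fun t => z t ((hP t).2 (Or.inr t.2))) fun t i => y ((t, i), true) := by
  rw [← Finset.prod_subset (Finset.subset_univ (insert v₀ T)) fun v _ hv => ?_,
    Finset.prod_insert hv₀, ← Finset.prod_coe_sort, localTensor_apply]
  · congr 1
    · simp [starAmplitude]
    · refine Finset.prod_congr rfl fun t _ => ?_
      have : t.1 ≠ v₀ := fun h => hv₀ (h ▸ t.2)
      simp [starAmplitude, this]
  · rw [Finset.mem_insert, not_or] at hv
    simp [starAmplitude, hv]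

variable [∀ v, Decidable (P v)] [Fintype I] [Fintype α] [Fintype β]

theorem measuresOn_starAmplitude (hv₀ : v₀ ∉ T) (hM : IsMeasurement M)
    (hN : ∀ a t, IsMeasurement (N a t)) (v : W) (o : ∀ u, StarOutcome v₀ T α β u) :
    MeasuresOn {x : (T × I) × Bool | (if x.2 then x.1.1.1 else v₀) = v} fun i =>
      starAmplitude hP M N v (Function.update o v i) := by
  by_cases h : v = v₀
  · subst h
    have hvP : P v := (hP v).2 (Or.inl rfl)
    have ne (t : T) : t.1 ≠ v := fun h => hv₀ (h ▸ t.2)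
    have measures := hM.measuresOn (s := {x : (T × I) × Bool | (if x.2 then x.1.1.1 else v) = v})
      (fun y t i => y ((t, i), false)) fun y y' => by simp [funext_iff, Set.EqOn, ne]
    have amplitude_eq : (fun i => starAmplitude hP M N v (Function.update o v i)) =
        fun i z y => M (i.1 rfl) (z hvP) fun t i => y ((t, i), false) := by
      funext i z y
      simp [starAmplitude]
    rw [amplitude_eq]
    exact measures.reindex (starOutcome_apply_fst_bijective (β := β) rfl hv₀)
      (apply_bijective hvP (Fin d))
  by_cases ht : v ∈ T
  · have hvP : P v := (hP v).2 (Or.inr ht)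
    have measures := (hN ((o v₀).1 rfl) ⟨v, ht⟩).measuresOn
      (s := {x : (T × I) × Bool | (if x.2 then x.1.1.1 else v₀) = v})
      (fun y i => y ((⟨v, ht⟩, i), true)) fun y y' => by
        rw [funext_iff]
        refine ⟨?_, fun hy i => hy (x := ((⟨v, ht⟩, i), true)) rfl⟩
        rintro hy ⟨⟨t, i⟩, _ | _⟩ hx
        · exact absurd hx (Ne.symm h)
        · obtain rfl : t = ⟨v, ht⟩ := Subtype.ext hx
          exact hy i
    have amplitude_eq : (fun i => starAmplitude hP M N v (Function.update o v i)) =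
        fun i z y => N ((o v₀).1 rfl) ⟨v, ht⟩ (i.2 ht) (z hvP) fun i => y ((⟨v, ht⟩, i), true) := by
      funext i z y
      simp [starAmplitude, h, ht, Function.update_of_ne (Ne.symm h)]
    rw [amplitude_eq]
    exact measures.reindex (starOutcome_apply_snd_bijective (α := α) ht h)
      (apply_bijective hvP (Fin d))
  · have : IsEmpty (v = v₀) := ⟨h⟩
    have : IsEmpty (v ∈ T) := ⟨ht⟩
    have : IsEmpty (P v) := ⟨fun hv => ((hP v).1 hv).elim h ht⟩
    intro y y'
    have not_measured (x : (T × I) × Bool) : (if x.2 then x.1.1.1 else v₀) ≠ v := by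
      split_ifs
      · exact fun hx => ht (hx ▸ x.1.1.2)
      · exact Ne.symm h
    simp [starAmplitude, h, ht, Set.EqOn, not_measured]

end Star

section Correct

variable {W : Type} {d : ℕ} {v₀ : W} {T : Finset W} {P : W → Prop}

theorem IsMeasurement.nonempty {ι X Y : Type*} [Fintype ι] [Fintype Y] [DecidableEq X] [Nonempty X]
    {A : ι → Matrix Y X ℂ} (hA : IsMeasurement A) : Nonempty ι := by
  by_contra h
  rw [not_nonempty_iff] at h
  obtain ⟨x⟩ := ‹Nonempty X›
  simpa using congrFun₂ hA.sum_eq x x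

theorem list_prod_unitary {X : Type*} [Fintype X] [DecidableEq X] (l : List (Matrix X X ℂ))
    (hl : ∀ A ∈ l, Aᴴ * A = 1) : l.prodᴴ * l.prod = 1 := by
  have : l.prod ∈ Matrix.unitaryGroup X ℂ :=
    list_prod_mem fun A hA => Matrix.mem_unitaryGroup_iff'.2 (hl A hA)
  exact Matrix.mem_unitaryGroup_iff'.1 this

/-- The labels of `v₀` and of the parties in `T`, separated. -/
def starLabelEquiv [DecidableEq W] (hP : ∀ v, P v ↔ v = v₀ ∨ v ∈ T) (hv₀ : v₀ ∉ T) (X : Type) :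
    (∀ v, P v → X) ≃ X × (T → X) where
  toFun z := (z v₀ ((hP v₀).2 (Or.inl rfl)), fun t => z t ((hP t).2 (Or.inr t.2)))
  invFun x v hv := if h : v = v₀ then x.1 else x.2 ⟨v, ((hP v).1 hv).resolve_left h⟩
  left_inv z := by
    funext v hv
    by_cases h : v = v₀
    · subst h
      simp
    · simp [h]
  right_inv x := by
    refine Prod.ext (by simp) (funext fun t => ?_)
    have : t.1 ≠ v₀ := fun h => hv₀ (h ▸ t.2)
    simp [this]

variable [DecidableEq W] [Fintype W] [∀ v, Decidable (P v)] {G : SimpleGraph W} [DecidableRel G.Adj]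
  [NeZero d] {m : ℕ}

theorem LegSystem.exists_isLOCC_of_correctable (hv₀ : v₀ ∉ T) (hP : ∀ v, P v ↔ v = v₀ ∨ v ∈ T)
    (S : LegSystem G v₀ T fun l : T × CodeIndex m => l.1.1) {Ψ : (∀ v, P v → Fin d) → ℂ}
    (hΨ : ∑ z, ‖Ψ z‖ ^ 2 = 1) :
    ∃ Λ : MultiOp (NetSystem G d) → MultiOp fun v => P v → Fin d, IsLOCC Λ ∧
      HasKrausOps (fun A => ∀ q : EdgeType G → LinkLabel d,
        (∀ t, Correctable m fun i => ∃ j, q (S.edge (t, i) j) ≠ none) →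
          ∃ c : ℂ, A *ᵥ netVector G q = c • Ψ) Λ := by
  obtain ⟨_, χ, hχ⟩ := exists_isPrimitive_addChar d
  let split := starLabelEquiv hP hv₀ (Fin d)
  let ψ : Matrix (Fin d) (T → Fin d) ℂ := .of fun z x => Ψ (split.symm (z, x))
  let V (μ : S.Inner → Fin d × Fin d) (t : T) (i : CodeIndex m) : Matrix (Fin d) (Fin d) ℂ :=
    (List.ofFn fun j => weyl χ (μ ⟨(t, i), j⟩)).prod
  have hV (μ t i) : (V μ t i)ᴴ * V μ t i = 1 := list_prod_unitary _ fun A hA => by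
    obtain ⟨j, rfl⟩ := List.mem_ofFn.1 hA
    exact weyl_unitary χ _
  have center : IsMeasurement (centerOp hχ m ψ) := isMeasurement_centerOp hχ m <| by
    rw [← Fintype.sum_prod_type', ← hΨ]
    exact split.symm.sum_comp fun z => ‖Ψ z‖ ^ 2
  have ends (μ a t) : IsMeasurement (endOp hχ m (V μ t) a t) :=
    isMeasurement_endOp hχ m (hV μ t) a t
  obtain ⟨a₀⟩ := center.nonempty
  have (v : W) : Nonempty (StarOutcome v₀ T (CenterOutcome hχ m T) (codeGadget hχ m).R v) :=
    ⟨fun _ => a₀, fun h => Classical.choice (ends (fun _ => 0) a₀ ⟨v, h⟩).nonempty⟩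
  obtain ⟨Λ, hΛ, hK⟩ := S.exists_isLOCC (isUnitaryErrorBasis_weyl hχ)
    (e := fun μ => starAmplitude hP (centerOp hχ m ψ) fun a t => endOp hχ m (V μ t) a t)
    (fun _ => starAmplitude_isTwoRound hv₀)
    (fun v hv _ _ => by funext o z y; simp [starAmplitude, hv])
    fun μ => measuresOn_starAmplitude hv₀ center (ends μ)
  refine ⟨Λ, hΛ, hK.mono fun A ⟨o, μ, hA⟩ q hq => ?_⟩
  obtain ⟨c, hc⟩ := hA q
  obtain ⟨c', hc'⟩ := exists_centerOp_mul_endOp_eq_smul hχ m ψ (hV μ) hq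
    (R := fun t i => S.legMatrix q (t, i) fun j => weyl χ (μ ⟨(t, i), j⟩))
    (fun t i hi => S.exists_legMatrix_eq_smul q (by simpa using hi) _) ((o v₀).1 rfl)
    fun t => (o t).2 t.2
  refine ⟨c * c', funext fun z => ?_⟩
  have contraction := congrFun₂ hc' (split z).1 (split z).2
  rw [← sum_mul_mul_prod_eq_mul_localTensor_mul _ _
    fun l => S.legMatrix q l fun j => weyl χ (μ ⟨l, j⟩)] at contraction
  rw [hc z]
  simp only [prod_starAmplitude hv₀]
  refine (congrArg (c * ·) contraction).trans ?_
  simp [ψ, mul_assoc]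

end Correct

/-! ## The legs of edge-disjoint spiders -/

section OfSpiders

variable {W : Type} {G : SimpleGraph W} {v₀ : W} {T : Finset W}

namespace Spider

variable (S : Spider G v₀ T)

theorem length_pos (t : T) : 0 < (S.leg t).length :=
  Nat.pos_of_ne_zero fun h => S.center_notMem (SimpleGraph.Walk.eq_of_length_eq_zero h ▸ t.2)

/-- The edge number `j` of a leg of a spider, directed away from the centre. -/
def dart (t : T) (j : Fin ((S.leg t).length - 1 + 1)) : G.Dart :=
  ⟨((S.leg t).getVert j, (S.leg t).getVert (j + 1)),
    (S.leg t).adj_getVert_succ (by have := S.length_pos t; lia)⟩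

theorem edge_dart_mem_edges (t : T) (j : Fin ((S.leg t).length - 1 + 1)) :
    (S.dart t j).edge ∈ S.edges :=
  have hj : (j : ℕ) < (S.leg t).darts.length := by
    have := S.length_pos t
    rw [SimpleGraph.Walk.length_darts]
    lia
  ⟨t, List.mem_map.2 ⟨(S.leg t).darts[(j : ℕ)], List.getElem_mem hj, by
    rw [SimpleGraph.Walk.darts_getElem_eq_getVert]
    rfl⟩⟩

theorem eq_of_getVert_eq {t : T} {i j : ℕ} (hi : i ≤ (S.leg t).length) (hj : j ≤ (S.leg t).length)
    (h : (S.leg t).getVert i = (S.leg t).getVert j) : i = j :=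
  (S.isPath t).getVert_injOn hi hj h

theorem getVert_eq_center {t t' : T} (ht : t ≠ t') {i i' : ℕ}
    (h : (S.leg t).getVert i = (S.leg t').getVert i') : (S.leg t).getVert i = v₀ :=
  S.legs_disjoint t t' ht _ ((S.leg t).getVert_mem_support i)
    (h ▸ (S.leg t').getVert_mem_support i')

theorem dart_edge_injective :
    Function.Injective fun u : Σ t, Fin ((S.leg t).length - 1 + 1) => (S.dart u.1 u.2).edge := by
  rintro ⟨t, j⟩ ⟨t', j'⟩ h
  have := S.length_pos t
  have := S.length_pos t'
  have hj : (j : ℕ) < (S.leg t).length := by lia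
  have hj' : (j' : ℕ) < (S.leg t').length := by lia
  replace h : s((S.leg t).getVert j, (S.leg t).getVert (j + 1)) =
    s((S.leg t').getVert j', (S.leg t').getVert (j' + 1)) := h
  rw [Sym2.eq_iff] at h
  by_cases ht : t = t'
  · subst ht
    refine congrArg (Sigma.mk t) (Fin.ext ?_)
    rcases h with ⟨h, -⟩ | ⟨h, h'⟩
    · exact S.eq_of_getVert_eq hj.le hj'.le h
    · have := S.eq_of_getVert_eq hj.le hj' h
      have := S.eq_of_getVert_eq hj hj'.le h'
      lia
  · refine absurd ?_ ((S.leg t).adj_getVert_succ hj).ne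
    rcases h with h | h <;>
      exact (S.getVert_eq_center ht h.1).trans (S.getVert_eq_center ht h.2).symm

theorem getVert_notMem {t : T} {i : ℕ} (hi : i < (S.leg t).length) :
    (S.leg t).getVert i ∉ T := fun hmem => by
  have end_eq : (S.leg ⟨_, hmem⟩).getVert (S.leg ⟨_, hmem⟩).length = (S.leg t).getVert i :=
    (S.leg ⟨_, hmem⟩).getVert_length
  by_cases ht : t = ⟨_, hmem⟩
  · have := S.eq_of_getVert_eq hi.le le_rfl
      ((congrArg Subtype.val ht).symm.trans (S.leg t).getVert_length.symm)
    lia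
  · exact S.center_notMem (S.getVert_eq_center ht end_eq.symm ▸ hmem)

end Spider

/-- The legs of pairwise edge-disjoint spiders. -/
def LegSystem.ofSpiders {I : Type} (S : I → Spider G v₀ T)
    (hS : Pairwise fun i j => Disjoint (S i).edges (S j).edges) :
    LegSystem G v₀ T fun l : T × I => l.1.1 where
  r l := ((S l.2).leg l.1).length - 1
  dart l j := (S l.2).dart l.1 j
  start l := by simp [Spider.dart]
  finish l := by
    have := (S l.2).length_pos l.1
    simp only [Spider.dart, Fin.val_last]
    rw [Nat.sub_add_cancel this, SimpleGraph.Walk.getVert_length]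
  chain l j := by simp [Spider.dart]
  inner l j := (S l.2).getVert_notMem (by simp; lia)
  edge_injective := by
    rintro ⟨⟨t, i⟩, j⟩ ⟨⟨t', i'⟩, j'⟩ h
    obtain rfl : i = i' := by
      by_contra hne
      refine Set.disjoint_left.1 (hS hne) ((S i).edge_dart_mem_edges t j) ?_
      exact (show ((S i).dart t j).edge = ((S i').dart t' j').edge from h) ▸
        (S i').edge_dart_mem_edges t' j'
    obtain ⟨rfl, h'⟩ := Sigma.mk.inj_iff.1 ((S i).dart_edge_injective (a₁ := ⟨t, j⟩)
      (a₂ := ⟨t', j'⟩) h)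
    exact congrArg (Sigma.mk _) (eq_of_heq h')

end OfSpiders

/-! ## The probability that errors are correctable -/

section ErrorProbability

open MeasureTheory ProbabilityTheory

section Concatenation

variable {Ω : Type*}

theorem measurableSet_not_correctable [MeasurableSpace Ω] {m : ℕ} {bad : CodeIndex m → Set Ω}
    (hbad : ∀ i, MeasurableSet (bad i)) :
    MeasurableSet {ω | ¬ Correctable m fun i => ω ∈ bad i} :=
  (Set.toFinite {x | ¬ Correctable m x}).measurableSet.preimage
    (measurable_pi_iff.2 fun i => measurableSet_setOfPred.1 (hbad i))

theorem not_correctable_succ_subset {m : ℕ} (bad : CodeIndex (m + 1) → Set Ω) :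
    {ω | ¬ Correctable (m + 1) fun i => ω ∈ bad i} ⊆
      ⋃ ij : {ij : (Fin 3 × Fin 3) × (Fin 3 × Fin 3) // ij.1 ≠ ij.2},
        {ω | ¬ Correctable m fun x => ω ∈ bad (Fin.cons ij.1.1 x)} ∩
          {ω | ¬ Correctable m fun x => ω ∈ bad (Fin.cons ij.1.2 x)} := by
  intro ω hω
  obtain ⟨i, hi, j, hj, hij⟩ := Set.not_subsingleton_iff.1 hω
  exact Set.mem_iUnion.2 ⟨⟨(i, j), hij⟩, hi, hj⟩

-- Two of the nine blocks have to fail, so a level turns the bound `ε` into less than `81 * ε ^ 2`;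
-- this is at most `ε / 2` as long as `ε ≤ 1 / 162`.
theorem measureReal_not_correctable_le {mΩ : MeasurableSpace Ω} {μ : Measure Ω}
    [IsProbabilityMeasure μ] {E : Type*} {σ : E → MeasurableSpace Ω} (hσ : ∀ e, σ e ≤ mΩ)
    (hind : iIndep σ μ) (m : ℕ) {bad : CodeIndex m → Set Ω} {s : CodeIndex m → Set E}
    (hs : Pairwise fun i j => Disjoint (s i) (s j))
    (hmeas : ∀ i, MeasurableSet[⨆ e ∈ s i, σ e] (bad i)) (hbad : ∀ i, μ.real (bad i) ≤ 1 / 162) :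
    μ.real {ω | ¬ Correctable m fun i => ω ∈ bad i} ≤ 1 / 81 * (1 / 2) ^ (m + 1) := by
  induction m with
  | zero => simpa [Correctable] using (hbad ![]).trans (by norm_num)
  | succ m ih =>
    let fails (i : Fin 3 × Fin 3) : Set Ω := {ω | ¬ Correctable m fun x => ω ∈ bad (Fin.cons i x)}
    have fails_le (i : Fin 3 × Fin 3) : μ.real (fails i) ≤ 1 / 81 * (1 / 2) ^ (m + 1) :=
      ih (fun _ _ hxy => hs ((Fin.cons_right_injective (α := fun _ => Fin 3 × Fin 3) i).ne hxy))
        (fun x => hmeas _) fun x => hbad _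
    have measurable_fails (i : Fin 3 × Fin 3) :
        MeasurableSet[⨆ e ∈ ⋃ x, s (Fin.cons i x), σ e] (fails i) :=
      @measurableSet_not_correctable _ (_) _ _ fun x =>
        (biSup_mono fun _ he => Set.mem_iUnion.2 ⟨x, he⟩ :
          ⨆ e ∈ s (Fin.cons i x), σ e ≤ _) _ (hmeas (Fin.cons i x))
    have both_fail_le (i j : Fin 3 × Fin 3) (hij : i ≠ j) :
        μ.real (fails i ∩ fails j) ≤ (1 / 81 * (1 / 2) ^ (m + 1)) ^ 2 := by
      have disj : Disjoint (⋃ x, s (Fin.cons i x)) (⋃ x, s (Fin.cons j x)) := by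
        simp only [Set.disjoint_iUnion_left, Set.disjoint_iUnion_right]
        exact fun x y => hs fun h => hij (Fin.cons_inj.1 h).1
      have indep : μ (fails i ∩ fails j) = μ (fails i) * μ (fails j) :=
        Indep_iff .. |>.1 (indep_iSup_of_disjoint hσ hind disj) _ _ (measurable_fails i)
          (measurable_fails j)
      rw [measureReal_def, indep, ENNReal.toReal_mul, sq]
      exact mul_le_mul (fails_le i) (fails_le j) ENNReal.toReal_nonneg (by positivity)
    calc μ.real {ω | ¬ Correctable (m + 1) fun i => ω ∈ bad i}
      _ ≤ ∑ ij : {ij : (Fin 3 × Fin 3) × (Fin 3 × Fin 3) // ij.1 ≠ ij.2},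
            μ.real (fails ij.1.1 ∩ fails ij.1.2) :=
          (measureReal_mono (not_correctable_succ_subset bad)).trans
            (measureReal_iUnion_fintype_le _)
      _ ≤ 81 * (1 / 81 * (1 / 2) ^ (m + 1)) ^ 2 := by
          refine (Finset.sum_le_card_nsmul _ _ _ fun ij _ => both_fail_le _ _ ij.2).trans ?_
          rw [nsmul_eq_mul, Finset.card_univ]
          gcongr
          exact_mod_cast (Fintype.card_subtype_le _).trans (by simp)
      _ = 1 / 81 * (1 / 2) ^ (m + 1 + 1) * (1 / 2) ^ m := by ring
      _ ≤ 1 / 81 * (1 / 2) ^ (m + 1 + 1) :=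
          mul_le_of_le_one_right (by positivity) (pow_le_one₀ (by norm_num) (by norm_num))

end Concatenation

instance (d : ℕ) : MeasurableSpace (LinkLabel d) := ⊤

instance (d : ℕ) : DiscreteMeasurableSpace (LinkLabel d) := ⟨fun _ => trivial⟩

/-- The distribution of the label of a link of visibility `p`. -/
def linkPMF (d : ℕ) [NeZero d] {p : ℝ} (h0 : 0 ≤ p) (h1 : p ≤ 1) : PMF (LinkLabel d) :=
  PMF.ofFintype (fun z => ENNReal.ofReal (linkWeight d p z)) <| by
    rw [← ENNReal.ofReal_sum_of_nonneg fun z _ => linkWeight_nonneg d h0 h1 z, sum_linkWeight,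
      ENNReal.ofReal_one]

/-- The joint distribution of the labels of independent links of visibility `p`. -/
def labelMeasure (E : Type*) [Fintype E] (d : ℕ) [NeZero d] {p : ℝ} (h0 : 0 ≤ p) (h1 : p ≤ 1) :
    Measure (E → LinkLabel d) :=
  Measure.pi fun _ => (linkPMF d h0 h1).toMeasure

instance (E : Type*) [Fintype E] (d : ℕ) [NeZero d] {p : ℝ} (h0 : 0 ≤ p) (h1 : p ≤ 1) :
    IsProbabilityMeasure (labelMeasure E d h0 h1) :=
  Measure.pi.instIsProbabilityMeasure _

section LabelMeasure

variable {E : Type*} [Fintype E] {d : ℕ} [NeZero d] {p : ℝ} (h0 : 0 ≤ p) (h1 : p ≤ 1)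

theorem linkPMF_real_singleton (z : LinkLabel d) :
    (linkPMF d h0 h1).toMeasure.real {z} = linkWeight d p z := by
  rw [measureReal_def, PMF.toMeasure_apply_singleton _ _ (MeasurableSet.singleton _), linkPMF,
    PMF.ofFintype_apply, ENNReal.toReal_ofReal (linkWeight_nonneg d h0 h1 z)]

theorem labelMeasure_real_singleton (q : E → LinkLabel d) :
    (labelMeasure E d h0 h1).real {q} = ∏ e, linkWeight d p (q e) := by
  rw [measureReal_def, labelMeasure, Measure.pi_singleton, ENNReal.toReal_prod]
  exact Finset.prod_congr rfl fun e _ => linkPMF_real_singleton h0 h1 (q e)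

theorem labelMeasure_real_ne_none (e : E) :
    (labelMeasure E d h0 h1).real {q | q e ≠ none} = 1 - p := by
  have map_eval := measurePreserving_eval (fun _ : E => (linkPMF d h0 h1).toMeasure) e
  have preimage : {q : E → LinkLabel d | q e ≠ none} =
      Function.eval e ⁻¹' ({none} : Set (LinkLabel d))ᶜ := rfl
  rw [preimage, labelMeasure, measureReal_def,
    map_eval.measure_preimage (MeasurableSet.of_discrete).nullMeasurableSet, ← measureReal_def,
    probReal_compl_eq_one_sub (MeasurableSet.singleton _), linkPMF_real_singleton, linkWeight]

theorem iIndep_labels :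
    iIndep (fun e => MeasurableSpace.comap (fun q : E → LinkLabel d => q e) inferInstance)
      (labelMeasure E d h0 h1) :=
  (iIndepFun_iff_iIndep _ _ _).1
    (iIndepFun_pi (X := fun _ => id) fun _ => measurable_id.aemeasurable)

end LabelMeasure

namespace LegSystem

variable {W : Type} [Fintype W] {G : SimpleGraph W} [DecidableRel G.Adj]
  {d : ℕ} [NeZero d] {v₀ : W} {T : Finset W} {p : ℝ}

theorem labelMeasure_real_error_le (h0 : 0 ≤ p) (h1 : p ≤ 1) {L : Type} {tgt : L → W}
    (S : LegSystem G v₀ T tgt) (l : L) :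
    (labelMeasure (EdgeType G) d h0 h1).real {q | ∃ j, q (S.edge l j) ≠ none} ≤
      (S.r l + 1) * (1 - p) := by
  have union : {q : EdgeType G → LinkLabel d | ∃ j, q (S.edge l j) ≠ none} =
      ⋃ j, {q | q (S.edge l j) ≠ none} := by
    ext
    simp
  rw [union]
  refine (measureReal_iUnion_fintype_le _).trans (le_of_eq ?_)
  simp only [labelMeasure_real_ne_none, Finset.sum_const, Finset.card_univ, Fintype.card_fin,
    nsmul_eq_mul, Nat.cast_add, Nat.cast_one]

theorem labelMeasure_real_not_correctable_le (h0 : 0 ≤ p) (h1 : p ≤ 1) {m : ℕ}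
    (S : LegSystem G v₀ T fun l : T × CodeIndex m => l.1.1)
    (hS : ∀ l, (S.r l + 1) * (1 - p) ≤ 1 / 162) (t : T) :
    (labelMeasure (EdgeType G) d h0 h1).real
      {q | ¬ Correctable m fun i => ∃ j, q (S.edge (t, i) j) ≠ none} ≤ (1 / 2) ^ (m + 1) := by
  have edge_disjoint : Pairwise fun i i' =>
      Disjoint (Set.range (S.edge (t, i))) (Set.range (S.edge (t, i'))) := by
    intro i i' hne
    rw [Set.disjoint_left]
    rintro _ ⟨j, rfl⟩ ⟨j', h⟩
    have := S.edge_injective (a₁ := ⟨(t, i'), j'⟩) (a₂ := ⟨(t, i), j⟩) (congrArg Subtype.val h)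
    exact hne (congrArg (fun u => u.1.2) this).symm
  refine (measureReal_not_correctable_le
    (bad := fun i => {q : EdgeType G → LinkLabel d | ∃ j, q (S.edge (t, i) j) ≠ none})
    (fun e => (measurable_pi_apply e).comap_le) (iIndep_labels h0 h1) m edge_disjoint
    (fun i => ?_) fun i => (S.labelMeasure_real_error_le h0 h1 (t, i)).trans (hS _)).trans
      (mul_le_of_le_one_left (by positivity) (by norm_num))
  simp only [Set.ofPred_exists]
  refine MeasurableSet.iUnion fun j => ?_
  exact le_iSup₂ (f := fun e (_ : e ∈ Set.range (S.edge (t, i))) => MeasurableSpace.comap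
    (fun q : EdgeType G → LinkLabel d => q e) inferInstance) _ ⟨j, rfl⟩ _ ⟨{none}ᶜ, trivial, rfl⟩

theorem le_labelMeasure_real_correctable (h0 : 0 ≤ p) (h1 : p ≤ 1) {m : ℕ}
    (S : LegSystem G v₀ T fun l : T × CodeIndex m => l.1.1)
    (hS : ∀ l, (S.r l + 1) * (1 - p) ≤ 1 / 162) :
    1 - T.card * (1 / 2) ^ (m + 1) ≤ (labelMeasure (EdgeType G) d h0 h1).real
      {q | ∀ t, Correctable m fun i => ∃ j, q (S.edge (t, i) j) ≠ none} := by
  have compl : {q : EdgeType G → LinkLabel d |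
      ∀ t, Correctable m fun i => ∃ j, q (S.edge (t, i) j) ≠ none} =
      (⋃ t, {q | ¬ Correctable m fun i => ∃ j, q (S.edge (t, i) j) ≠ none})ᶜ := by
    ext
    simp
  rw [compl, probReal_compl_eq_one_sub (Set.toFinite _).measurableSet]
  refine sub_le_sub_left ((measureReal_iUnion_fintype_le _).trans ?_) 1
  refine (Finset.sum_le_card_nsmul _ _ _ fun t _ =>
    S.labelMeasure_real_not_correctable_le h0 h1 hS t).trans (le_of_eq ?_)
  simp

end LegSystem

end ErrorProbability

/-! ## Distillation from edge-disjoint spiders -/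

section Fidelity

variable {W : Type} [Fintype W] [DecidableEq W] {G : SimpleGraph W} [DecidableRel G.Adj]
  {d : ℕ} [NeZero d] {P : W → Prop} [∀ v, Decidable (P v)]

theorem HasKrausOps.fidelity_networkState_bounds
    {Λ : MultiOp (NetSystem G d) → MultiOp fun v => P v → Fin d} {Ψ : (∀ v, P v → Fin d) → ℂ}
    {good : Set (EdgeType G → LinkLabel d)}
    (hΛ : HasKrausOps (fun A => ∀ q ∈ good, ∃ c : ℂ, A *ᵥ netVector G q = c • Ψ) Λ)
    (htr : ∀ ρ, (Λ ρ).trace = ρ.trace) (hΨ : ∑ z, ‖Ψ z‖ ^ 2 = 1) {p : ℝ} (h0 : 0 ≤ p)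
    (h1 : p ≤ 1) :
    (labelMeasure (EdgeType G) d h0 h1).real good ≤
        fidelity (Λ (networkState G d p)) (pureState Ψ) ∧
      fidelity (Λ (networkState G d p)) (pureState Ψ) ≤ 1 := by
  classical
  have total : ∑ q, (labelMeasure (EdgeType G) d h0 h1).real {q} = 1 := by
    rw [MeasureTheory.sum_measureReal_singleton, Finset.coe_univ, MeasureTheory.probReal_univ]
  have bounds := HasKrausOps.fidelity_bounds (good := good.toFinset)
    (fun _ => MeasureTheory.measureReal_nonneg) total (sum_norm_netVector (G := G)) hΨ
    (hΛ.mono fun A hA q hq => hA q (Set.mem_toFinset.1 hq)) htr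
  rw [MeasureTheory.sum_measureReal_singleton, Set.coe_toFinset] at bounds
  simpa only [labelMeasure_real_singleton, ← networkState_eq_sum] using bounds

variable (G d P) in
theorem exists_isLOCC_hasKrausOps :
    ∃ Λ : MultiOp (NetSystem G d) → MultiOp fun v => P v → Fin d, IsLOCC Λ ∧
      HasKrausOps (fun _ => True) Λ := by
  let prepare (v : W) (_ : W → Unit) (z : P v → Fin d) (_ : Empty → Fin d) : ℂ :=
    if z = fun _ => 0 then 1 else 0
  obtain ⟨Λ, hΛ, hK⟩ := exists_isLOCC_of_used (ι := (Empty.elim : Empty → G.Dart)) (T := ∅)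
    (n := prepare) (fun u => u.elim)
    ⟨fun _ _ _ _ _ => rfl, fun _ hv => absurd hv (Finset.notMem_empty _)⟩
    fun v o y y' => by
      rw [Subsingleton.elim y y']
      simp [prepare, Set.eqOn_refl]
  exact ⟨Λ, hΛ, hK.mono fun _ _ => trivial⟩

theorem exists_isLOCC_fidelity_le_one {Ψ : (∀ v, P v → Fin d) → ℂ} (hΨ : ∑ z, ‖Ψ z‖ ^ 2 = 1) :
    ∃ Λ : MultiOp (NetSystem G d) → MultiOp fun v => P v → Fin d, IsLOCC Λ ∧
      ∀ p : ℝ, 0 ≤ p → p ≤ 1 →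
        0 ≤ fidelity (Λ (networkState G d p)) (pureState Ψ) ∧
          fidelity (Λ (networkState G d p)) (pureState Ψ) ≤ 1 := by
  obtain ⟨Λ, hΛ, hK⟩ := exists_isLOCC_hasKrausOps G d P
  refine ⟨Λ, hΛ, fun p h0 h1 => ?_⟩
  have bounds := HasKrausOps.fidelity_networkState_bounds (good := ∅)
    (hK.mono fun A _ q hq => hq.elim) hΛ.trace_eq hΨ h0 h1
  rwa [MeasureTheory.measureReal_empty] at bounds

theorem exists_isLOCC_fidelity_eq_one (hP : ∀ v, ¬ P v) {Ψ : (∀ v, P v → Fin d) → ℂ}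
    (hΨ : ∑ z, ‖Ψ z‖ ^ 2 = 1) :
    ∃ Λ : MultiOp (NetSystem G d) → MultiOp fun v => P v → Fin d, IsLOCC Λ ∧
      ∀ p : ℝ, 0 ≤ p → p ≤ 1 → fidelity (Λ (networkState G d p)) (pureState Ψ) = 1 := by
  obtain ⟨Λ, hΛ, hK⟩ := exists_isLOCC_hasKrausOps G d P
  refine ⟨Λ, hΛ, fun p h0 h1 => ?_⟩
  let z₀ : ∀ v, P v → Fin d := fun _ _ => 0
  have hsub : Subsingleton (∀ v, P v → Fin d) :=
    ⟨fun z z' => funext fun v => funext fun hv => absurd hv (hP v)⟩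
  have hne (z) : Ψ z ≠ 0 := fun hz => by simp [Fintype.sum_subsingleton _ z, hz] at hΨ
  have bounds := HasKrausOps.fidelity_networkState_bounds (good := Set.univ) (Ψ := Ψ)
    (hK.mono fun A _ q _ => ⟨(A *ᵥ netVector G q) z₀ / Ψ z₀, funext fun z => by
      rw [Subsingleton.elim z z₀, Pi.smul_apply, smul_eq_mul, div_mul_cancel₀ _ (hne z₀)]⟩)
    hΛ.trace_eq hΨ h0 h1
  rw [MeasureTheory.probReal_univ] at bounds
  exact le_antisymm bounds.2 bounds.1

theorem LegSystem.exists_isLOCC_le_fidelity {v₀ : W} {T : Finset W} (hv₀ : v₀ ∉ T)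
    (hP : ∀ v, P v ↔ v = v₀ ∨ v ∈ T) {Ψ : (∀ v, P v → Fin d) → ℂ} (hΨ : ∑ z, ‖Ψ z‖ ^ 2 = 1) {m : ℕ}
    (S : LegSystem G v₀ T fun l : T × CodeIndex m => l.1.1) :
    ∃ Λ : MultiOp (NetSystem G d) → MultiOp fun v => P v → Fin d, IsLOCC Λ ∧
      ∀ p : ℝ, 0 ≤ p → p ≤ 1 → (∀ l, (S.r l + 1) * (1 - p) ≤ 1 / 162) →
        1 - T.card * (1 / 2) ^ (m + 1) ≤ fidelity (Λ (networkState G d p)) (pureState Ψ) ∧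
          fidelity (Λ (networkState G d p)) (pureState Ψ) ≤ 1 := by
  obtain ⟨Λ, hΛ, hK⟩ := S.exists_isLOCC_of_correctable hv₀ hP hΨ
  refine ⟨Λ, hΛ, fun p h0 h1 hS => ?_⟩
  have bounds := HasKrausOps.fidelity_networkState_bounds
    (good := {q | ∀ t, Correctable m fun i => ∃ j, q (S.edge (t, i) j) ≠ none})
    hK hΛ.trace_eq hΨ h0 h1
  exact ⟨(S.le_labelMeasure_real_correctable h0 h1 hS).trans bounds.1, bounds.2⟩

end Fidelity

section Spiders

variable {W : Type} [DecidableEq W] {G : SimpleGraph W}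

/-- At every vertex of `V₀` there are `N` pairwise edge-disjoint spiders, with legs of length at
most `ℓ`, to the other vertices of `V₀`. -/
def HasEdgeDisjointSpiders (G : SimpleGraph W) (V₀ : Finset W) (N ℓ : ℕ) : Prop :=
  ∀ v₀ ∈ V₀, ∃ S : Fin N → Spider G v₀ (V₀.erase v₀),
    (∀ i t, ((S i).leg t).length ≤ ℓ) ∧ Pairwise fun i j => Disjoint (S i).edges (S j).edges

theorem hasEdgeDisjointSpiders_of_card_le_one {V₀ : Finset W} (hV₀ : V₀.card ≤ 1) (N ℓ : ℕ) :
    HasEdgeDisjointSpiders G V₀ N ℓ := by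
  intro v₀ hv₀
  have : IsEmpty {t // t ∈ V₀.erase v₀} := ⟨fun t =>
    (Finset.mem_erase.1 t.2).1 (Finset.card_le_one.1 hV₀ _ (Finset.mem_of_mem_erase t.2) _ hv₀)⟩
  refine ⟨fun _ => ⟨Finset.notMem_erase _ _, isEmptyElim, isEmptyElim, isEmptyElim⟩,
    fun _ => isEmptyElim, fun i j _ => Set.disjoint_left.2 ?_⟩
  rintro e ⟨t, -⟩
  exact isEmptyElim t

variable [Fintype W] [DecidableRel G.Adj] {d : ℕ} [NeZero d] {V₀ : Finset W} {P : W → Prop}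
  [∀ v, Decidable (P v)]

theorem HasEdgeDisjointSpiders.exists_isLOCC_le_fidelity {N ℓ : ℕ}
    (hG : HasEdgeDisjointSpiders G V₀ N ℓ) (hP : ∀ v, P v ↔ v ∈ V₀) {Ψ : (∀ v, P v → Fin d) → ℂ}
    (hΨ : ∑ z, ‖Ψ z‖ ^ 2 = 1) :
    ∃ Λ : MultiOp (NetSystem G d) → MultiOp fun v => P v → Fin d, IsLOCC Λ ∧
      ∀ p : ℝ, 0 ≤ p → p ≤ 1 → ℓ * (1 - p) ≤ 1 / 162 →
        1 - V₀.card * (1 / 2) ^ Nat.log 9 N ≤ fidelity (Λ (networkState G d p)) (pureState Ψ) ∧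
          fidelity (Λ (networkState G d p)) (pureState Ψ) ≤ 1 := by
  rcases V₀.eq_empty_or_nonempty with rfl | ⟨v₀, hv₀⟩
  · obtain ⟨Λ, hΛ, hF⟩ := exists_isLOCC_fidelity_eq_one (G := G) (fun v => by simp [hP]) hΨ
    exact ⟨Λ, hΛ, fun p h0 h1 _ => by simp [hF p h0 h1]⟩
  rcases Nat.eq_zero_or_pos N with rfl | hN
  · obtain ⟨Λ, hΛ, hF⟩ := exists_isLOCC_fidelity_le_one (G := G) hΨ
    have one_le_card : (1 : ℝ) ≤ V₀.card := by exact_mod_cast Finset.card_pos.2 ⟨v₀, hv₀⟩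
    refine ⟨Λ, hΛ, fun p h0 h1 _ => ⟨le_trans ?_ (hF p h0 h1).1, (hF p h0 h1).2⟩⟩
    simpa using one_le_card
  obtain ⟨S, hlen, hdisj⟩ := hG v₀ hv₀
  obtain ⟨e⟩ : Nonempty (CodeIndex (Nat.log 9 N) ↪ Fin N) := by
    rw [Function.Embedding.nonempty_iff_card_le]
    simpa using Nat.pow_log_le_self 9 hN.ne'
  let legs := LegSystem.ofSpiders (fun i => S (e i)) fun i j hij => hdisj (e.injective.ne hij)
  obtain ⟨Λ, hΛ, hF⟩ := legs.exists_isLOCC_le_fidelity (Finset.notMem_erase v₀ V₀)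
    (fun v => by rw [hP, ← Finset.mem_insert, Finset.insert_erase hv₀]) hΨ
  refine ⟨Λ, hΛ, fun p h0 h1 hp => ?_⟩
  have legs_error_le (l) : ((legs.r l : ℝ) + 1) * (1 - p) ≤ 1 / 162 := by
    have length_eq : legs.r l + 1 = ((S (e l.2)).leg l.1).length :=
      Nat.sub_add_cancel ((S (e l.2)).length_pos l.1)
    have length_le : (legs.r l : ℝ) + 1 ≤ ℓ := by exact_mod_cast length_eq ▸ hlen (e l.2) l.1
    exact (mul_le_mul_of_nonneg_right length_le (by linarith)).trans hp
  refine ⟨le_trans (sub_le_sub_left ?_ 1) (hF p h0 h1 legs_error_le).1,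
    (hF p h0 h1 legs_error_le).2⟩
  gcongr ?_ * ?_
  · exact_mod_cast Finset.card_erase_le
  · exact pow_le_pow_of_le_one (by norm_num) (by norm_num) (Nat.le_succ _)

end Spiders

section GraphSequence

theorem card_subtype_mem_of_subset {Q : Type*} [DecidableEq Q] {s t : Finset Q} (h : s ⊆ t) :
    (s.subtype (· ∈ t)).card = s.card := by
  rw [Finset.card_subtype, Finset.filter_true_of_mem fun v hv => h hv]

theorem sum_norm_extendVector {Q : Type} [DecidableEq Q] {V V₀ : Finset Q} (h : V₀ ⊆ V) {d : ℕ}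
    (ψ : ({v // v ∈ V₀} → Fin d) → ℂ) :
    ∑ x, ‖extendVector h ψ x‖ ^ 2 = ∑ x, ‖ψ x‖ ^ 2 :=
  Fintype.sum_bijective (fun (x : ∀ v, OutSystem V V₀ d v) (v : {v // v ∈ V₀}) =>
      x ⟨v.1, h v.2⟩ v.2)
    ⟨fun _ _ hxy => funext fun v => funext fun hv => congrFun hxy ⟨v.1, hv⟩,
      fun y => ⟨fun v hv => y ⟨v.1, hv⟩, rfl⟩⟩ _ _ fun _ => rfl

theorem GraphSequence.tendsto_val_atTop (S : GraphSequence) (V₀ : Finset S.Party) :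
    Tendsto (fun n : {n // V₀ ⊆ S.V n} => n.1) atTop atTop := by
  have hmono : Monotone S.V := monotone_nat_of_le_succ S.nested
  rcases isEmpty_or_nonempty {n // V₀ ⊆ S.V n} with h | ⟨⟨n₀, hn₀⟩⟩
  · exact tendsto_of_isEmpty
  · refine tendsto_atTop.2 fun b => ?_
    filter_upwards [eventually_ge_atTop
      (⟨max b n₀, hn₀.trans (hmono (le_max_right _ _))⟩ : {n // V₀ ⊆ S.V n})] with n hn
    exact (le_max_left b n₀).trans hn

theorem tendsto_one_sub_mul_half_pow_log {ι : Type*} {l : Filter ι} {N : ι → ℕ}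
    (hN : Tendsto N l atTop) (c : ℝ) :
    Tendsto (fun n => 1 - c * (1 / 2) ^ Nat.log 9 (N n)) l (𝓝 1) := by
  have hlog : Tendsto (Nat.log 9) atTop atTop :=
    tendsto_atTop_atTop.2 fun b => ⟨9 ^ b, fun n hn => Nat.le_log_of_pow_le (by norm_num) hn⟩
  have hpow := (tendsto_pow_atTop_nhds_zero_of_lt_one (r := (1 / 2 : ℝ)) (by norm_num)
    (by norm_num)).comp (hlog.comp hN)
  simpa using (hpow.const_mul c).const_sub 1

theorem partiallyDistillable_of_hasEdgeDisjointSpiders (S : GraphSequence) (d : ℕ) [NeZero d]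
    (ℓ : ℕ) (hS : ∀ V₀ : Finset S.Party, ∃ N : ℕ → ℕ, Tendsto N atTop atTop ∧
      ∀ n, V₀ ⊆ S.V n →
        HasEdgeDisjointSpiders (S.graph n) (V₀.subtype (· ∈ S.V n)) (N n) ℓ) :
    PartiallyDistillable S d := by
  refine ⟨1 - 1 / (162 * (ℓ + 1)), sub_lt_self 1 (by positivity), fun V₀ ψ hψ => ?_⟩
  obtain ⟨N, hN, hspiders⟩ := hS V₀
  choose Λ hΛ hF using fun n : {n // V₀ ⊆ S.V n} =>
    (hspiders n n.2).exists_isLOCC_le_fidelity (P := fun v => v.1 ∈ V₀)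
      (fun v => Finset.mem_subtype.symm) ((sum_norm_extendVector n.2 ψ).trans hψ)
  refine ⟨fun n _ => Λ n, fun n _ => hΛ n, fun p h0 hp h1 => ?_⟩
  have hp' : ℓ * (1 - p) ≤ 1 / 162 :=
    calc ℓ * (1 - p) ≤ (ℓ + 1) * (1 / (162 * (ℓ + 1))) := by
          gcongr <;> linarith
      _ = 1 / 162 := by field_simp
  have hcard (n : {n // V₀ ⊆ S.V n}) : (V₀.subtype (· ∈ S.V n)).card = V₀.card :=
    card_subtype_mem_of_subset n.2
  simp only [hcard] at hF
  exact tendsto_of_tendsto_of_tendsto_of_le_of_le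
    (tendsto_one_sub_mul_half_pow_log (hN.comp (S.tendsto_val_atTop V₀)) V₀.card)
    tendsto_const_nhds (fun n => (hF n p h0 h1 hp').1) fun n => (hF n p h0 h1 hp').2

theorem tendsto_div_sub_one_mul_atTop {c k : ℕ} (hc : 0 < c) (hk : 0 < k) :
    Tendsto (fun n => (n / c - 1) * k) atTop atTop :=
  tendsto_atTop_atTop.2 fun b => ⟨(b + 1) * c, fun _ hn =>
    (Nat.le_sub_one_of_lt ((Nat.le_div_iff_mul_le hc).2 hn)).trans
      (Nat.le_mul_of_pos_right _ hk)⟩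

theorem hammingSequence_partiallyDistillable {k : ℕ} (hk : 1 ≤ k) (d : ℕ) [NeZero d] :
    PartiallyDistillable (hammingSequence k hk) d := by
  refine partiallyDistillable_of_hasEdgeDisjointSpiders _ d (k + 1) fun V₀ => ?_
  by_cases hV₀ : 2 ≤ V₀.card
  · refine ⟨_, tendsto_div_sub_one_mul_atTop (Nat.sub_pos_of_lt hV₀) hk, fun n hn v₀ hv₀ => ?_⟩
    rw [← card_subtype_mem_of_subset hn] at hV₀ ⊢
    exact exists_edgeDisjoint_spiders _ hv₀ hV₀
  · refine ⟨id, tendsto_id, fun _ hn => hasEdgeDisjointSpiders_of_card_le_one ?_ _ _⟩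
    rw [card_subtype_mem_of_subset hn]
    lia

end GraphSequence

end

theorem theorem10 (α : ℝ) (hα₀ : 0 < α) (hα₁ : α < 1) :
    ∃ (k : ℕ) (hk : 1 ≤ k),
      -- the maximum degree is `O(|G_n|^α)`
      ((fun n => (((hammingSequence k hk).graph n).maxDegree : ℝ)) =O[atTop]
        fun n => (((hammingSequence k hk).V n).card : ℝ) ^ α) ∧
      -- partial distillability, for every local dimension of the links
      (∀ d : ℕ, 2 ≤ d → PartiallyDistillable (hammingSequence k hk) d) ∧
      -- edge-disjoint spiders with short legs in the graph on `[n]^k`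
      (∀ (n : ℕ) (V₀ : Finset {v // v ∈ hammingVertices k n}), 2 ≤ V₀.card → ∀ v₀ ∈ V₀,
        ∃ S : Fin (((n - 1) / (V₀.card - 1) - 1) * k) →
            Spider (hammingGraph k n) v₀ (V₀.erase v₀),
          (∀ i t, ((S i).leg t).length ≤ k + 1) ∧
          Pairwise fun i j => Disjoint (S i).edges (S j).edges) := by
  obtain ⟨k, hk⟩ := exists_nat_ge (1 / α)
  have hk₁ : 1 ≤ k := by
    have : (0 : ℝ) < k := (one_div_pos.2 hα₀).trans_le hk
    exact_mod_cast this
  refine ⟨k, hk₁, hammingSequence_maxDegree_isBigO hk₁ ((div_le_iff₀ hα₀).1 hk), fun d hd => ?_,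
    fun n V₀ hV₀ v₀ hv₀ => exists_edgeDisjoint_spiders V₀ hv₀ hV₀⟩
  have : NeZero d := ⟨by lia⟩
  exact hammingSequence_partiallyDistillable hk₁ d
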